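/- Consider the planar system $$\dot x=\partial_yH(x,y,t),\qquad \dot y=-\partial_xH(x,y,t)+F(x,y,t),\qquad t>0, \tag{1}$$ under the following assumptions. $H,F$ are $C^\infty$ on $\mathbb R^2\times(0,\infty)$, $q\ge 1$ is an integer, $E_0>0$, and there are $C^\infty$ functions $H_0$, $H_k$, $F_k$ ($k\ge1$) on $\mathbb R^2$ such that, as $t\to\infty$, $$H(x,y,t)-H_0(x,y)\sim\sum_{k\ge1}t^{-k/q}H_k(x,y),\qquad F(x,y,t)\sim\sum_{k\ge1}t^{-k/q}F_k(x,y)$$ as asymptotic series, uniformly on compact subsets of $\mathbb R^2$, where the first series may be differentiated termwise in $(x,y)$ twice and the second once. $H_0(x,y)=\frac{x^2+y^2}{2}+O(r^3)$ as $r=\sqrt{x^2+y^2}\to0$; there is an open set $U\ni(0,0)$ (for example $U=\mathbb R^2$) such that for every $E\in(0,E_0]$ the level line $\{(x,y)\in U:H_0(x,y)=E\}$ is a simple closed curve containing no critical point of $H_0$. Finally $\partial_xH(0,0,t)=\partial_yH(0,0,t)=F(0,0,t)=0$ for all $t>0$. Then there exist: (a) Action–angle variables: a function $\omega:[0,E_0]\to(0,\infty)$,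 smooth on $(0,E_0]$, with $\omega(0)=1$ and $\omega(E)=1+O(E)$ as $E\to0+$, and functions $X(\varphi,E),Y(\varphi,E)$, $2\pi$-periodic in $\varphi$, smooth for $E\in(0,E_0]$, continuous for $E\in[0,E_0]$ with $X(\varphi,0)=Y(\varphi,0)=0$, taking values in $U$, such that $H_0(X,Y)=E$ and, for $E\in(0,E_0]$, $\omega\,\partial_\varphi X=\partial_yH_0(X,Y)$, $\omega\,\partial_\varphi Y=-\partial_xH_0(X,Y)$. The Jacobian $\partial_\varphi X\,\partial_EY-\partial_EX\,\partial_\varphi Y$ equals $1/\omega(E)$ for $E\in(0,E_0)$, and $(\varphi,E)\mapsto(X,Y)$ maps $\mathbb R\times(0,E_0]$ onto $\{p\in U:0<H_0(p)\le E_0\}$, injectively up to shifts of $\varphi$ by multiples of $2\pi$; every continuous curve in this region, parametrized by an interval, has a continuous angle $\varphi$. (b) Functions $v_k(E,\varphi)$ and $\Lambda_k(E)$, $k\ge1$, smooth for $E\in(0,E_0]$, with $v_k$ $2\pi$-periodic in $\varphi$, $v_k(0,\varphi)=0$, $\Lambda_k(0)=0$ and $\Lambda_k(E)=O(E)$ as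 $E\to0+$, with the following property. For every integer $N\ge0$ put $V_N(E,\varphi,t)=E+\sum_{k=1}^Nt^{-k/q}v_k(E,\varphi)$. There are functions $R_{N+1}(v,\varphi,t)$, $G_N(v,\varphi,t)$ and $g_{N,k}(v,\varphi)$, $k\ge1$, such that for every $\sigma\in(0,1)$ there is $t_0>0$ for which, with $d_0=(1-\sigma)E_0$: 1. For all $E\in[0,E_0]$, $\varphi\in\mathbb R$, $t\ge t_0$: $(1-\sigma)E\le V_N\le(1+\sigma)E$ and $1-\sigma\le\partial_EV_N\le1+\sigma$ (one-sided derivatives at the end points). For every $t\ge t_0$ the map $(E,\varphi)\mapsto(v,\varphi)$, $v=V_N(E,\varphi,t)$, is invertible over $v\in[0,d_0]$: each such $v$ has exactly one preimage $E\in[0,E_0]$, and $E$ is a smooth function of $(v,\varphi,t)$ for $v\in(0,d_0)$, $t>t_0$. 2. $R_{N+1}$ and $G_N$ are smooth for $v\in(0,d_0)$, $t>t_0$; for $t\ge t_0$ they are $2\pi$-periodic in $\varphi$ ($R_{N+1}$ for $v\in[0,d_0]$, $G_N$ for $v\in(0,d_0]$), and $R_{N+1}(0,\varphi,t)=0$.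 There is a constant $C$ with $|R_{N+1}(v,\varphi,t)|\le C\,t^{-(N+1)/q}$ for all $v\in[0,d_0]$, $\varphi\in\mathbb R$, $t\ge t_0$. The $g_{N,k}$ are smooth and $2\pi$-periodic in $\varphi$ for $v\in(0,d_0]$, and $G_N\sim\sum_{k\ge1}t^{-k/q}g_{N,k}(v,\varphi)$ as $t\to\infty$, uniformly in $v\in(0,d_0]$, $\varphi\in\mathbb R$. 3. Let $I\subseteq(t_0,\infty)$ be open, let $E(t)\in(0,E_0)$ and $\varphi(t)$ be continuous on $I$, and put $x=X(\varphi,E)$, $y=Y(\varphi,E)$, $v=V_N(E,\varphi,t)$. If $v(t)\le d_0$ on $I$, then $(x(t),y(t))$ solves (1) on $I$ if and only if $(v(t),\varphi(t))$ solves on $I$ $$\frac{dv}{dt}=\sum_{k=1}^Nt^{-k/q}\Lambda_k(v)+R_{N+1}(v,\varphi,t),\qquad \frac{d\varphi}{dt}=\omega(v)+G_N(v,\varphi,t).$$ -/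

import Mathlib

open Filter Topology Asymptotics
open scoped ContDiff

noncomputable section

namespace AsympHam

/-- `∂h/∂x` at the point `p = (x, y)`. -/
def partialX (h : ℝ × ℝ → ℝ) (p : ℝ × ℝ) : ℝ := deriv (fun x => h (x, p.2)) p.1

/-- `∂h/∂y` at the point `p = (x, y)`. -/
def partialY (h : ℝ × ℝ → ℝ) (p : ℝ × ℝ) : ℝ := deriv (fun y => h (p.1, y)) p.2

/-- A simple closed curve in the plane: a continuous injective image of the circle. -/
def IsClosedCurve (S : Set (ℝ × ℝ)) : Prop :=
  ∃ γ : Circle → ℝ × ℝ, Continuous γ ∧ Function.Injective γ ∧ Set.range γ = S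

/-- `f(x,y,t) ~ ∑_{k ≥ 1} t^{-k/q} c_k(x,y)` as `t → ∞`, an asymptotic series (no convergence),
uniform on compact sets of the plane and valid also after termwise differentiation in `(x,y)` up
to order `m`. -/
def HasPowerExpansion (m q : ℕ) (f : ℝ × ℝ → ℝ → ℝ) (c : ℕ → ℝ × ℝ → ℝ) : Prop :=
  ∀ K : Set (ℝ × ℝ), IsCompact K → ∀ M : ℕ, ∀ j ≤ m, ∃ C : ℝ, ∀ᶠ t : ℝ in atTop, ∀ p ∈ K,
    ‖iteratedFDeriv ℝ j
        (fun p' => f p' t - ∑ k ∈ Finset.Icc 1 M, t ^ (-(k : ℝ) / (q : ℝ)) * c k p') p‖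
      ≤ C * t ^ (-((M : ℝ) + 1) / (q : ℝ))

/-- The class of asymptotically Hamiltonian systems
`x' = ∂_y H(x,y,t)`, `y' = -∂_x H(x,y,t) + F(x,y,t)`, `t > 0`.
Level lines of `H₀` are taken inside an open set `U` around the equilibrium (`U` may be the whole
plane); this allows `H₀` to have other level components far from the center. -/
structure IsSystem (q : ℕ) (E₀ : ℝ) (U : Set (ℝ × ℝ)) (H F : ℝ × ℝ → ℝ → ℝ) (H₀ : ℝ × ℝ → ℝ)
    (Hk Fk : ℕ → ℝ × ℝ → ℝ) : Prop where
  q_pos : 0 < q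
  E₀_pos : 0 < E₀
  isOpen_U : IsOpen U
  zero_mem_U : (0, 0) ∈ U
  smooth_H : ContDiffOn ℝ ∞ (fun z : (ℝ × ℝ) × ℝ => H z.1 z.2) {z | 0 < z.2}
  smooth_F : ContDiffOn ℝ ∞ (fun z : (ℝ × ℝ) × ℝ => F z.1 z.2) {z | 0 < z.2}
  smooth_H₀ : ContDiff ℝ ∞ H₀
  smooth_Hk : ∀ k, 1 ≤ k → ContDiff ℝ ∞ (Hk k)
  smooth_Fk : ∀ k, 1 ≤ k → ContDiff ℝ ∞ (Fk k)
  /-- `H₀ = (x² + y²)/2 + O(r³)` as `r → 0`. -/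
  center : (fun p : ℝ × ℝ => H₀ p - (p.1 ^ 2 + p.2 ^ 2) / 2) =O[𝓝 (0, 0)]
    (fun p : ℝ × ℝ => Real.sqrt (p.1 ^ 2 + p.2 ^ 2) ^ 3)
  /-- The level lines with `0 < E ≤ E₀` are closed curves. -/
  closed_levels : ∀ E ∈ Set.Ioc 0 E₀, IsClosedCurve {p | p ∈ U ∧ H₀ p = E}
  /-- These level lines contain no equilibria of the limiting system. -/
  regular_levels : ∀ p ∈ U, H₀ p ∈ Set.Ioc 0 E₀ → ¬ (partialX H₀ p = 0 ∧ partialY H₀ p = 0)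
  /-- `H - H₀ ~ ∑ t^{-k/q} H_k`. -/
  expansion_H : HasPowerExpansion 2 q (fun p t => H p t - H₀ p) Hk
  /-- `F ~ ∑ t^{-k/q} F_k`. -/
  expansion_F : HasPowerExpansion 1 q F Fk
  /-- The perturbations preserve the equilibrium. -/
  partialX_H_zero : ∀ t > 0, partialX (fun p => H p t) (0, 0) = 0
  partialY_H_zero : ∀ t > 0, partialY (fun p => H p t) (0, 0) = 0
  F_zero : ∀ t > 0, F (0, 0) t = 0

/-- `(x(t), y(t))` solves the full system for all `t ∈ I`. -/
def IsSolutionOn (H F : ℝ × ℝ → ℝ → ℝ) (I : Set ℝ) (x y : ℝ → ℝ) : Prop :=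
  ∀ t ∈ I, HasDerivAt x (partialY (fun p => H p t) (x t, y t)) t ∧
    HasDerivAt y (-partialX (fun p => H p t) (x t, y t) + F (x t, y t) t) t

/-- `x = X(φ,E)`, `y = Y(φ,E)` are action-angle (energy-angle) variables of `H₀` on the region
`{p ∈ U : 0 < H₀ p ≤ E₀}`, with frequency `freq(E) = ω(E)`. -/
structure IsActionAngle (E₀ : ℝ) (U : Set (ℝ × ℝ)) (H₀ : ℝ × ℝ → ℝ) (freq : ℝ → ℝ)
    (X Y : ℝ → ℝ → ℝ) : Prop where
  freq_smooth : ContDiffOn ℝ ∞ freq (Set.Ioc 0 E₀)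
  freq_pos : ∀ E ∈ Set.Icc 0 E₀, 0 < freq E
  freq_zero : freq 0 = 1
  freq_near_zero : (fun E => freq E - 1) =O[𝓝[>] 0] (fun E : ℝ => E)
  X_smooth : ContDiffOn ℝ ∞ (fun z : ℝ × ℝ => X z.1 z.2) (Set.univ ×ˢ Set.Ioc 0 E₀)
  Y_smooth : ContDiffOn ℝ ∞ (fun z : ℝ × ℝ => Y z.1 z.2) (Set.univ ×ˢ Set.Ioc 0 E₀)
  X_cont : ContinuousOn (fun z : ℝ × ℝ => X z.1 z.2) (Set.univ ×ˢ Set.Icc 0 E₀)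
  Y_cont : ContinuousOn (fun z : ℝ × ℝ => Y z.1 z.2) (Set.univ ×ˢ Set.Icc 0 E₀)
  X_zero : ∀ φ, X φ 0 = 0
  Y_zero : ∀ φ, Y φ 0 = 0
  X_periodic : ∀ E ∈ Set.Icc 0 E₀, ∀ φ, X (φ + 2 * Real.pi) E = X φ E
  Y_periodic : ∀ E ∈ Set.Icc 0 E₀, ∀ φ, Y (φ + 2 * Real.pi) E = Y φ E
  mem_U : ∀ E ∈ Set.Icc 0 E₀, ∀ φ, (X φ E, Y φ E) ∈ U
  energy : ∀ E ∈ Set.Icc 0 E₀, ∀ φ, H₀ (X φ E, Y φ E) = E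
  /-- `freq ∂_φ X = ∂_Y H₀(X,Y)`, `freq ∂_φ Y = -∂_X H₀(X,Y)`. -/
  hamilton_X : ∀ E ∈ Set.Ioc 0 E₀, ∀ φ,
    HasDerivAt (fun s => X s E) (partialY H₀ (X φ E, Y φ E) / freq E) φ
  hamilton_Y : ∀ E ∈ Set.Ioc 0 E₀, ∀ φ,
    HasDerivAt (fun s => Y s E) (-partialX H₀ (X φ E, Y φ E) / freq E) φ
  jacobian : ∀ E ∈ Set.Ioo 0 E₀, ∀ φ,
    deriv (fun s => X s E) φ * deriv (fun e => Y φ e) E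
      - deriv (fun e => X φ e) E * deriv (fun s => Y s E) φ = 1 / freq E
  /-- Injectivity, up to the period of the angle. -/
  injective : ∀ E ∈ Set.Ioc 0 E₀, ∀ E' ∈ Set.Ioc 0 E₀, ∀ φ φ', X φ E = X φ' E' →
    Y φ E = Y φ' E' → E = E' ∧ ∃ n : ℤ, φ' = φ + n * (2 * Real.pi)
  surjective : ∀ p ∈ U, H₀ p ∈ Set.Ioc 0 E₀ → ∃ φ, (X φ (H₀ p), Y φ (H₀ p)) = p
  /-- Every continuous curve in the region has a continuous angle. -/
  lift : ∀ (I : Set ℝ) (x y : ℝ → ℝ), I.OrdConnected → ContinuousOn x I → ContinuousOn y I →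
    (∀ t ∈ I, (x t, y t) ∈ U ∧ H₀ (x t, y t) ∈ Set.Ioc 0 E₀) →
    ∃ φ : ℝ → ℝ, ContinuousOn φ I ∧
      ∀ t ∈ I, x t = X (φ t) (H₀ (x t, y t)) ∧ y t = Y (φ t) (H₀ (x t, y t))

/-- The near-identity transformation `V_N(E,φ,t) = E + ∑_{k=1}^N t^{-k/q} v_k(E,φ)`. -/
def VN (q N : ℕ) (v : ℕ → ℝ → ℝ → ℝ) (E φ t : ℝ) : ℝ :=
  E + ∑ k ∈ Finset.Icc 1 N, t ^ (-(k : ℝ) / (q : ℝ)) * v k E φ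

/-- `(w(t), φ(t))` solves, for all `t ∈ I`, the reduced system
`w' = ∑_{k=1}^N t^{-k/q} Λ_k(w) + R(w,φ,t)`, `φ' = freq(w) + G(w,φ,t)`. -/
def IsReducedSolutionOn (q N : ℕ) (Λ : ℕ → ℝ → ℝ) (R : ℝ → ℝ → ℝ → ℝ) (freq : ℝ → ℝ)
    (G : ℝ → ℝ → ℝ → ℝ) (I : Set ℝ) (w φ : ℝ → ℝ) : Prop :=
  ∀ t ∈ I,
    HasDerivAt w
      ((∑ k ∈ Finset.Icc 1 N, t ^ (-(k : ℝ) / (q : ℝ)) * Λ k (w t)) + R (w t) (φ t) t) t ∧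
    HasDerivAt φ (freq (w t) + G (w t) (φ t) t) t

/-- The coefficients `v_k(E,φ)` and `Λ_k(E)`: smooth, periodic in the angle, vanishing at the
equilibrium `E = 0`. -/
structure IsCoefficients (E₀ : ℝ) (v : ℕ → ℝ → ℝ → ℝ) (Λ : ℕ → ℝ → ℝ) : Prop where
  v_smooth : ∀ k, 1 ≤ k →
    ContDiffOn ℝ ∞ (fun z : ℝ × ℝ => v k z.1 z.2) (Set.Ioc 0 E₀ ×ˢ Set.univ)
  v_periodic : ∀ k, 1 ≤ k → ∀ E ∈ Set.Icc 0 E₀, ∀ φ, v k E (φ + 2 * Real.pi) = v k E φ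
  v_zero : ∀ k, 1 ≤ k → ∀ φ, v k 0 φ = 0
  Λ_smooth : ∀ k, 1 ≤ k → ContDiffOn ℝ ∞ (Λ k) (Set.Ioc 0 E₀)
  Λ_zero : ∀ k, 1 ≤ k → Λ k 0 = 0
  Λ_near_zero : ∀ k, 1 ≤ k → (Λ k) =O[𝓝[>] 0] (fun E : ℝ => E)

/-- For `t ≥ t₀`, `(E,φ) ↦ (V_N(E,φ,t),φ)` is close to the identity (with tolerance `σ`) on
`0 ≤ E ≤ E₀`, and it is invertible onto `0 ≤ w ≤ (1-σ)E₀` with smooth inverse. The derivative at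
the end points of `[0,E₀]` is one-sided. -/
structure IsReversible (q N : ℕ) (E₀ σ t₀ : ℝ) (v : ℕ → ℝ → ℝ → ℝ) : Prop where
  bounds : ∀ E ∈ Set.Icc 0 E₀, ∀ φ, ∀ t ≥ t₀,
    (1 - σ) * E ≤ VN q N v E φ t ∧ VN q N v E φ t ≤ (1 + σ) * E
  deriv_bounds : ∀ E ∈ Set.Icc 0 E₀, ∀ φ, ∀ t ≥ t₀,
    1 - σ ≤ derivWithin (fun e => VN q N v e φ t) (Set.Icc 0 E₀) E ∧
    derivWithin (fun e => VN q N v e φ t) (Set.Icc 0 E₀) E ≤ 1 + σ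
  inverse : ∃ J : ℝ → ℝ → ℝ → ℝ,
    ContDiffOn ℝ ∞ (fun z : ℝ × ℝ × ℝ => J z.1 z.2.1 z.2.2)
      (Set.Ioo 0 ((1 - σ) * E₀) ×ˢ Set.univ ×ˢ Set.Ioi t₀) ∧
    (∀ w ∈ Set.Icc 0 ((1 - σ) * E₀), ∀ φ, ∀ t ≥ t₀,
      J w φ t ∈ Set.Icc 0 E₀ ∧ VN q N v (J w φ t) φ t = w) ∧
    (∀ E ∈ Set.Icc 0 E₀, ∀ φ, ∀ t ≥ t₀, VN q N v E φ t ≤ (1 - σ) * E₀ →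
      J (VN q N v E φ t) φ t = E)

/-- The remainder `R_{N+1}(w,φ,t)`, `0 ≤ w ≤ d₀`, `t ≥ t₀`: smooth, periodic in the angle, zero at
`w = 0`, and `O(t^{-(N+1)/q})` uniformly. -/
structure IsRemainder (q N : ℕ) (d₀ t₀ : ℝ) (R : ℝ → ℝ → ℝ → ℝ) : Prop where
  smooth : ContDiffOn ℝ ∞ (fun z : ℝ × ℝ × ℝ => R z.1 z.2.1 z.2.2)
    (Set.Ioo 0 d₀ ×ˢ Set.univ ×ˢ Set.Ioi t₀)
  periodic : ∀ w ∈ Set.Icc 0 d₀, ∀ φ, ∀ t ≥ t₀, R w (φ + 2 * Real.pi) t = R w φ t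
  zero : ∀ φ, ∀ t ≥ t₀, R 0 φ t = 0
  bound : ∃ C : ℝ, ∀ w ∈ Set.Icc 0 d₀, ∀ φ, ∀ t ≥ t₀,
    |R w φ t| ≤ C * t ^ (-((N : ℝ) + 1) / (q : ℝ))

/-- The function `G_N(w,φ,t)`, `0 < w ≤ d₀`, `t ≥ t₀`: smooth, periodic in the angle, with
`G_N ~ ∑_{k ≥ 1} t^{-k/q} g_{N,k}(w,φ)` as `t → ∞`, uniformly. -/
structure IsAngularPerturbation (q : ℕ) (d₀ t₀ : ℝ) (G : ℝ → ℝ → ℝ → ℝ)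
    (g : ℕ → ℝ → ℝ → ℝ) : Prop where
  smooth : ContDiffOn ℝ ∞ (fun z : ℝ × ℝ × ℝ => G z.1 z.2.1 z.2.2)
    (Set.Ioo 0 d₀ ×ˢ Set.univ ×ˢ Set.Ioi t₀)
  periodic : ∀ w ∈ Set.Ioc 0 d₀, ∀ φ, ∀ t ≥ t₀, G w (φ + 2 * Real.pi) t = G w φ t
  coeff_smooth : ∀ k, 1 ≤ k →
    ContDiffOn ℝ ∞ (fun z : ℝ × ℝ => g k z.1 z.2) (Set.Ioc 0 d₀ ×ˢ Set.univ)
  coeff_periodic : ∀ k, 1 ≤ k → ∀ w ∈ Set.Ioc 0 d₀, ∀ φ, g k w (φ + 2 * Real.pi) = g k w φ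
  expansion : ∀ M : ℕ, ∃ C : ℝ, ∀ᶠ t : ℝ in atTop, ∀ w ∈ Set.Ioc 0 d₀, ∀ φ,
    |G w φ t - ∑ k ∈ Finset.Icc 1 M, t ^ (-(k : ℝ) / (q : ℝ)) * g k w φ|
      ≤ C * t ^ (-((M : ℝ) + 1) / (q : ℝ))

end AsympHam

end

open Filter Topology Asymptotics
open scoped ContDiff

noncomputable section

namespace AsympHam


/-! ### Integrals depending on parameters, Hadamard's lemma, inverses of families of bijections -/

section Calculus

/-! The argument runs in the amplitude `s = √(2E)` and the small parameter `ε = t^{-1/q}`. In these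
variables the angle map, the coefficients and the transformation are smooth across `s = 0` and `ε =
0`. The energy returns only at the end, through `s = amp E`; the coefficients then have the form `E`
times a smooth function of `(√(2E), φ)`, so they vanish at the equilibrium.

Action-angle variables (`IsCenter.exists_angleMap`, `IsAngleMap.isActionAngle`). Let `Φ` be the
Hamiltonian flow of `H₀`, cut off far away. A level curve is compact, connected and free of critical
points. Recurrence makes its points periodic, and a flow box makes orbits relatively open in it, so
it is a single periodic orbit. Take a transversal curve `c` with `H₀ (c s) = s²/2`, let `T s` be the
minimal period of `c s`, and put `x (s, φ) = Φ (φ T(s)/2π, c s)`. The delicate point is the center.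
Since `H₀ (s v) = s² K (v, s)` with `K` smooth, the flow divided by the amplitude extends smoothly
to amplitude zero, where it is a rotation; so `T` is smooth at `0` and `T 0 = 2π`. The points `c s`
and `c (-s)` lie on one orbit, so `T` is even and the frequency is `1 + O(s²) = 1 + O(E)`.

Averaging (`IsAngleMap.exists_reduced_field`, `IsAveraged.step`, `exists_averaging`). The
perturbations vanish at the origin, so the system becomes `s' = s a`, `φ' = Ω + g`, where `a` and
`g` have series in `ε` that are uniform on `0 < s ≤ √(2E₀)`. One seeks `V = (s²/2) W` with `W = 1 +
∑ ε^k b_k (s, φ)` and `V' = V L (√(2V), ε)`, `L = ∑ ε^k l_k`. Because `ε' = -ε^{q+1}/q`, time enters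
only through powers of `ε`, and each order is a homological equation `Ω ∂_φ b = l - (known terms)`.
It has a periodic solution once `l` is chosen as a suitable mean. Orders already solved are never
changed, so `v_k = E b_k` and `Λ_k = E l_k` do not depend on `N`.

Remainders and equivalence (`exists_amplitude_inverse`, `IsReduction.isRemainder`,
`IsReduction.isAngularPerturbation`, `IsReduction.hasDerivAt_iff`). For small `ε` the map `s ↦ s √W`
is close to the identity and has a smooth inverse `S`. Substituting `S` into the exact equations
defines the remainder and the angular perturbation, so these depend on `N` but not on `σ`; the
tolerance `σ` only decides how late `t₀` must be. One direction of the equivalence is the chain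
rule. The other recovers differentiability of the amplitude from `s = S (√(2V), φ, ε)`. -/

theorem hasFDerivAt_intervalIntegral_of_contDiff {E F : Type} [NormedAddCommGroup E]
    [NormedSpace ℝ E] [ProperSpace E] [NormedAddCommGroup F] [NormedSpace ℝ F] [CompleteSpace F]
    {f : E × ℝ → F} (hf : ContDiff ℝ 1 f) (x₀ : E) :
    HasFDerivAt (fun x => ∫ τ in (0 : ℝ)..1, f (x, τ))
      (∫ τ in (0 : ℝ)..1, (fderiv ℝ f (x₀, τ)).comp (ContinuousLinearMap.inl ℝ E ℝ)) x₀ := by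
  have hD : Continuous fun z : E × ℝ =>
      (fderiv ℝ f z).comp (ContinuousLinearMap.inl ℝ E ℝ) :=
    (hf.continuous_fderiv one_ne_zero).clm_comp continuous_const
  obtain ⟨C, hC⟩ := ((isCompact_closedBall x₀ 1).prod (isCompact_Icc (a := (0 : ℝ)) (b := 1))
    ).exists_bound_of_continuousOn hD.continuousOn
  refine intervalIntegral.hasFDerivAt_integral_of_dominated_of_fderiv_le
    (F' := fun x τ => (fderiv ℝ f (x, τ)).comp (ContinuousLinearMap.inl ℝ E ℝ))
    (bound := fun _ => C) (Metric.closedBall_mem_nhds x₀ one_pos) ?_ ?_ ?_ ?_ ?_ ?_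
  · exact Eventually.of_forall fun x =>
      (hf.continuous.comp (Continuous.prodMk_right x)).aestronglyMeasurable
  · exact (hf.continuous.comp (Continuous.prodMk_right x₀)).intervalIntegrable _ _
  · exact (hD.comp (Continuous.prodMk_right x₀)).aestronglyMeasurable
  · refine Eventually.of_forall fun τ hτ x hx => hC (x, τ) ⟨hx, ?_⟩
    rw [Set.uIoc_of_le zero_le_one] at hτ
    exact Set.Ioc_subset_Icc_self hτ
  · exact intervalIntegrable_const
  · refine Eventually.of_forall fun τ _ x _ => ?_
    have h1 : HasFDerivAt f (fderiv ℝ f (x, τ)) (x, τ) :=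
      (hf.differentiable one_ne_zero _).hasFDerivAt
    exact h1.comp x (hasFDerivAt_prodMk_left x τ)

/-- The derivative of such an integral is again such an integral, with values in a space of linear
maps; hence the induction lets the target space vary. -/
theorem contDiff_intervalIntegral_nat {E : Type} [NormedAddCommGroup E]
    [NormedSpace ℝ E] [ProperSpace E] (n : ℕ) :
    ∀ {F : Type} [NormedAddCommGroup F] [NormedSpace ℝ F] [CompleteSpace F]
    {f : E × ℝ → F}, ContDiff ℝ ∞ f → ContDiff ℝ n (fun x => ∫ τ in (0 : ℝ)..1, f (x, τ)) := by
  induction n with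
  | zero =>
    intro F _ _ _ f hf
    rw [Nat.cast_zero, contDiff_zero, continuous_iff_continuousAt]
    exact fun x => (hasFDerivAt_intervalIntegral_of_contDiff (hf.of_le (by simp)) x).continuousAt
  | succ n ih =>
    intro F _ _ _ f hf
    have h1 : ContDiff ℝ 1 f := hf.of_le (by simp)
    rw [Nat.cast_add, Nat.cast_one, contDiff_succ_iff_fderiv]
    refine ⟨fun x => (hasFDerivAt_intervalIntegral_of_contDiff h1 x).differentiableAt,
      by simp, ?_⟩
    have h2 : (fderiv ℝ fun x => ∫ τ in (0 : ℝ)..1, f (x, τ)) =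
        fun x => ∫ τ in (0 : ℝ)..1, (fderiv ℝ f (x, τ)).comp (ContinuousLinearMap.inl ℝ E ℝ) :=
      funext fun x => (hasFDerivAt_intervalIntegral_of_contDiff h1 x).fderiv
    rw [h2]
    refine ih (f := fun z => (fderiv ℝ f z).comp (ContinuousLinearMap.inl ℝ E ℝ)) ?_
    exact (hf.fderiv_right (by simp)).clm_comp contDiff_const

theorem contDiff_intervalIntegral {E F : Type} [NormedAddCommGroup E]
    [NormedSpace ℝ E] [ProperSpace E] [NormedAddCommGroup F] [NormedSpace ℝ F] [CompleteSpace F]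
    {f : E × ℝ → F} (hf : ContDiff ℝ ∞ f) :
    ContDiff ℝ ∞ (fun x => ∫ τ in (0 : ℝ)..1, f (x, τ)) :=
  contDiff_infty.2 fun n => contDiff_intervalIntegral_nat n hf

/-- The quotient `Q'` in Hadamard's lemma `Q (z, η) = Q (z, 0) + η Q' (z, η)`. -/
def hadamardQuot {E F : Type} [NormedAddCommGroup E] [NormedSpace ℝ E] [NormedAddCommGroup F]
    [NormedSpace ℝ F] (Q : E × ℝ → F) (z : E × ℝ) : F :=
  ∫ τ in (0 : ℝ)..1, fderiv ℝ Q (z.1, τ * z.2) (0, 1)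

variable {E F : Type} [NormedAddCommGroup E] [NormedSpace ℝ E] [NormedAddCommGroup F]
  [NormedSpace ℝ F]

theorem hasDerivAt_snd {Q : E × ℝ → F} (hQ : Differentiable ℝ Q) (z : E) (η : ℝ) :
    HasDerivAt (fun η => Q (z, η)) (fderiv ℝ Q (z, η) (0, 1)) η := by
  have h1 : HasFDerivAt Q (fderiv ℝ Q (z, η)) (z, η) := (hQ _).hasFDerivAt
  exact h1.comp_hasDerivAt η ((hasDerivAt_const η z).prodMk (hasDerivAt_id η))

theorem contDiff_hadamardQuot [ProperSpace E] [CompleteSpace F] {Q : E × ℝ → F}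
    (hQ : ContDiff ℝ ∞ Q) : ContDiff ℝ ∞ (hadamardQuot Q) := by
  refine contDiff_intervalIntegral
    (f := fun w : (E × ℝ) × ℝ => fderiv ℝ Q (w.1.1, w.2 * w.1.2) (0, 1)) ?_
  have h : ContDiff ℝ ∞ (fderiv ℝ Q) := hQ.fderiv_right (by simp)
  exact (h.comp (by fun_prop : ContDiff ℝ ∞ fun w : (E × ℝ) × ℝ =>
    (w.1.1, w.2 * w.1.2))).clm_apply contDiff_const

/-- Fundamental theorem of calculus along `τ ↦ Q (z, τ η)`. This is the tool used throughout to
divide smoothly by a variable. -/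
theorem eq_add_hadamardQuot [CompleteSpace F] {Q : E × ℝ → F} (hQ : ContDiff ℝ ∞ Q) (z : E)
    (η : ℝ) : Q (z, η) = Q (z, 0) + η • hadamardQuot Q (z, η) := by
  have hd : Differentiable ℝ Q := hQ.differentiable (by simp)
  have hc : Continuous (fderiv ℝ Q) := hQ.continuous_fderiv (by simp)
  have h1 : ∀ τ ∈ Set.uIcc (0 : ℝ) 1, HasDerivAt (fun τ : ℝ => Q (z, τ * η))
      (η • fderiv ℝ Q (z, τ * η) (0, 1)) τ := fun τ _ => by
    have h2 := (hasDerivAt_snd hd z (τ * η)).scomp τ ((hasDerivAt_id τ).mul_const η)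
    simpa [Function.comp_def] using h2
  have h3 := intervalIntegral.integral_eq_sub_of_hasDerivAt h1 (Continuous.intervalIntegrable
    (by fun_prop) _ _)
  rw [intervalIntegral.integral_smul] at h3
  simp only [one_mul, zero_mul] at h3
  rw [hadamardQuot]
  simp [h3]

theorem hadamardQuot_zero {Q : E × ℝ → F} [CompleteSpace F] (z : E) :
    hadamardQuot Q (z, 0) = fderiv ℝ Q (z, 0) (0, 1) := by
  simp [hadamardQuot]

theorem hadamardQuot_add_of_periodic {Q : E × ℝ → F} {v : E}
    (h : ∀ z η, Q (z + v, η) = Q (z, η)) (z : E) (η : ℝ) :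
    hadamardQuot Q (z + v, η) = hadamardQuot Q (z, η) := by
  have h1 : ∀ w : E × ℝ, fderiv ℝ Q (w + (v, 0)) = fderiv ℝ Q w := fun w => by
    rw [← fderiv_comp_add_right]
    congr 1
    funext w
    obtain ⟨a, b⟩ := w
    simpa using h a b
  unfold hadamardQuot
  refine intervalIntegral.integral_congr fun τ _ => ?_
  have := h1 (z, τ * η)
  simp only [Prod.mk_add_mk, add_zero] at this
  simp only [this]

theorem isInvertible_of_apply_one_ne_zero {f : ℝ →L[ℝ] ℝ} (h : f 1 ≠ 0) : f.IsInvertible := by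
  refine ⟨ContinuousLinearEquiv.unitsEquivAut ℝ (Units.mk0 (f 1) h), ?_⟩
  ext
  simp

/-- The inverse of a smooth family of increasing bijections of the line is smooth. -/
theorem exists_contDiff_inverse [FiniteDimensional ℝ E] {B : E × ℝ → ℝ} (hB : ContDiff ℝ ∞ B)
    (hpos : ∀ z, 0 < fderiv ℝ B z (0, 1)) (hsurj : ∀ z u, ∃ s, B (z, s) = u) :
    ∃ S : E × ℝ → ℝ, ContDiff ℝ ∞ S ∧ (∀ z u, B (z, S (z, u)) = u) ∧
      ∀ z s, S (z, B (z, s)) = s := by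
  have hd : Differentiable ℝ B := hB.differentiable (by simp)
  have hmono : ∀ z, StrictMono fun s => B (z, s) := fun z =>
    strictMono_of_deriv_pos fun s => by
      rw [(hasDerivAt_snd hd z s).deriv]; exact hpos _
  choose S hS using hsurj
  have hleft : ∀ z s, S z (B (z, s)) = s := fun z s => (hmono z).injective (hS z _)
  refine ⟨fun w => S w.1 w.2, ?_, hS, hleft⟩
  rw [contDiff_iff_contDiffAt]
  rintro ⟨z, u⟩
  have := FiniteDimensional.complete ℝ E
  let f : (E × ℝ) × ℝ → ℝ := fun w => B (w.1.1, w.2) - w.1.2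
  have hf : ContDiff ℝ ∞ f := by
    have : ContDiff ℝ ∞ fun w : (E × ℝ) × ℝ => B (w.1.1, w.2) := hB.comp (by fun_prop)
    exact this.sub (by fun_prop)
  have hder : fderiv ℝ f ((z, u), S z u) ((0, 0), 1) = fderiv ℝ B (z, S z u) (0, 1) := by
    have h1 := hasDerivAt_snd (hf.differentiable (by simp)) (z, u) (S z u)
    have h2 := (hasDerivAt_snd hd z (S z u)).sub_const u
    exact h1.unique h2
  have hinv : (fderiv ℝ f ((z, u), S z u) ∘L .inr ℝ (E × ℝ) ℝ).IsInvertible := by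
    apply isInvertible_of_apply_one_ne_zero
    have : (fderiv ℝ f ((z, u), S z u) ∘L .inr ℝ (E × ℝ) ℝ) 1 =
      fderiv ℝ f ((z, u), S z u) ((0, 0), 1) := rfl
    rw [this, hder]
    exact (hpos _).ne'
  have hn : (∞ : WithTop ℕ∞) ≠ 0 := by simp
  have hev := hf.contDiffAt.eventually_apply_implicitFunction (u := ((z, u), S z u)) hn hinv
  have hsm := hf.contDiffAt.contDiffAt_implicitFunction (u := ((z, u), S z u)) hn hinv
  refine hsm.congr_of_eventuallyEq ?_
  filter_upwards [hev] with w hw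
  have h0 : f ((z, u), S z u) = 0 := by simp [f, hS]
  rw [h0] at hw
  apply (hmono w.1).injective
  simp only [f, sub_eq_zero] at hw
  simp only [hS]
  exact hw.symm

end Calculus


/-! ### Smoothness of postcomposition on spaces of continuous functions -/

section Nemytskii

variable {I : Type} [TopologicalSpace I] [CompactSpace I]
variable {E F : Type} [NormedAddCommGroup E] [NormedSpace ℝ E] [NormedAddCommGroup F]
  [NormedSpace ℝ F]

/-- Pointwise application of operator-valued continuous functions, as a bilinear map. -/
def pointwiseApply : C(I, E →L[ℝ] F) →L[ℝ] C(I, E) →L[ℝ] C(I, F) :=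
  LinearMap.mkContinuous₂
    (LinearMap.mk₂ ℝ (fun (A : C(I, E →L[ℝ] F)) (h : C(I, E)) =>
        (⟨fun t => A t (h t), A.continuous.clm_apply h.continuous⟩ : C(I, F)))
      (fun _ _ _ => by ext; simp) (fun _ _ _ => by ext; simp) (fun _ _ _ => by ext; simp)
      (fun _ _ _ => by ext; simp)) 1 (fun A h => by
    rw [one_mul, ContinuousMap.norm_le _ (by positivity)]
    intro t
    exact ((A t).le_opNorm _).trans (mul_le_mul (A.norm_coe_le_norm t) (h.norm_coe_le_norm t)
      (norm_nonneg _) (by positivity)))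

/-- The range of `u` is compact, so `fderiv ℝ f` varies by less than `ε` within a uniform distance
`δ` of it; the mean value inequality on each ball of radius `δ` then gives the estimate uniformly in
`t`. -/
theorem hasFDerivAt_postcomp {f : E → F} (hf : ContDiff ℝ 1 f) (u : C(I, E)) :
    HasFDerivAt (fun u : C(I, E) => (⟨f, hf.continuous⟩ : C(E, F)).comp u)
      (pointwiseApply ((⟨fderiv ℝ f, hf.continuous_fderiv one_ne_zero⟩ : C(E, E →L[ℝ] F)).comp u))
      u := by
  have hd := hf.differentiable one_ne_zero
  have hc := hf.continuous_fderiv one_ne_zero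
  rw [hasFDerivAt_iff_isLittleO_nhds_zero, Asymptotics.isLittleO_iff]
  intro ε hε
  have hK : IsCompact (Set.range u) := isCompact_range u.continuous
  have h1 := hK.uniformContinuousAt_of_continuousAt (fderiv ℝ f) (fun x _ => hc.continuousAt)
    (Metric.dist_mem_uniformity hε)
  obtain ⟨δ, hδ, h2⟩ := Metric.mem_uniformity_dist.1 h1
  filter_upwards [Metric.ball_mem_nhds 0 hδ] with h hh
  rw [ContinuousMap.norm_le _ (by positivity)]
  intro t
  have ht : ‖h t‖ < δ := (h.norm_coe_le_norm t).trans_lt (by simpa using hh)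
  have h3 := (convex_ball (u t) δ).norm_image_sub_le_of_norm_hasFDerivWithin_le'
    (f := f) (f' := fderiv ℝ f) (φ := fderiv ℝ f (u t)) (C := ε) (x := u t) (y := u t + h t)
    (fun x _ => (hd x).hasFDerivAt.hasFDerivWithinAt) (fun x hx => by
      have h4 := h2 (a := u t) (b := x) (by rw [dist_comm]; exact hx) ⟨t, rfl⟩
      simp only [Set.mem_ofPred_eq] at h4
      rw [← dist_eq_norm, dist_comm]
      exact h4.le) (Metric.mem_ball_self hδ) (by simpa using ht)
  simp only [add_sub_cancel_left] at h3
  exact h3.trans (by gcongr; exact h.norm_coe_le_norm t)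

/-- The derivative is postcomposition with `fderiv ℝ f` followed by the continuous linear map
`pointwiseApply`, which feeds the induction with another target space. -/
theorem contDiff_postcomp_nat (n : ℕ) : ∀ {F : Type} [NormedAddCommGroup F] [NormedSpace ℝ F]
    {f : E → F} (hf : ContDiff ℝ ∞ f),
    ContDiff ℝ n (fun u : C(I, E) => (⟨f, hf.continuous⟩ : C(E, F)).comp u) := by
  induction n with
  | zero =>
    intro F _ _ f hf
    rw [Nat.cast_zero, contDiff_zero]
    exact ContinuousMap.continuous_postcomp _
  | succ n ih =>
    intro F _ _ f hf
    have h1 : ContDiff ℝ 1 f := hf.of_le (by simp)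
    rw [Nat.cast_add, Nat.cast_one, contDiff_succ_iff_fderiv]
    refine ⟨fun u => (hasFDerivAt_postcomp h1 u).differentiableAt, by simp, ?_⟩
    have h2 : fderiv ℝ (fun u : C(I, E) => (⟨f, hf.continuous⟩ : C(E, F)).comp u) = fun u =>
      pointwiseApply ((⟨fderiv ℝ f, h1.continuous_fderiv one_ne_zero⟩ : C(E, E →L[ℝ] F)).comp u) :=
      funext fun u => (hasFDerivAt_postcomp h1 u).fderiv
    rw [h2]
    exact pointwiseApply.contDiff.comp (ih (hf.fderiv_right (m := ∞) (by simp)))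

theorem contDiff_postcomp {f : E → F} (hf : ContDiff ℝ ∞ f) :
    ContDiff ℝ ∞ (fun u : C(I, E) => (⟨f, hf.continuous⟩ : C(E, F)).comp u) :=
  contDiff_infty.2 fun n => contDiff_postcomp_nat n hf

end Nemytskii

/-! ### Smoothness of flows -/

section Flow

variable {E : Type} [NormedAddCommGroup E] [NormedSpace ℝ E] [CompleteSpace E]

/-- The primitive `t ↦ ∫₀ᵗ u` of a continuous function on the unit interval. -/
def primitiveFun (u : C(unitInterval, E)) (t : ℝ) : E :=
  ∫ τ in (0 : ℝ)..t, u (Set.projIcc 0 1 zero_le_one τ)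

theorem hasDerivAt_primitiveFun (u : C(unitInterval, E)) (t : ℝ) :
    HasDerivAt (primitiveFun u) (u (Set.projIcc 0 1 zero_le_one t)) t := by
  have hc : Continuous fun τ : ℝ => u (Set.projIcc 0 1 zero_le_one τ) :=
    u.continuous.comp continuous_projIcc
  exact intervalIntegral.integral_hasDerivAt_right (hc.intervalIntegrable _ _)
    (hc.stronglyMeasurableAtFilter _ _) hc.continuousAt

/-- The Volterra operator `u ↦ ∫₀ᵗ u` on `C([0,1], E)`. -/
def volterra : C(unitInterval, E) →L[ℝ] C(unitInterval, E) :=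
  LinearMap.mkContinuous
    { toFun := fun u => ⟨fun t => primitiveFun u t, by
        have : Continuous (primitiveFun u) := continuous_iff_continuousAt.2 fun t =>
          (hasDerivAt_primitiveFun u t).continuousAt
        exact this.comp continuous_subtype_val⟩
      map_add' := fun u v => by
        ext t
        have hc : ∀ u : C(unitInterval, E), Continuous fun τ : ℝ =>
          u (Set.projIcc 0 1 zero_le_one τ) := fun u => u.continuous.comp continuous_projIcc
        exact intervalIntegral.integral_add ((hc u).intervalIntegrable _ _)
          ((hc v).intervalIntegrable _ _)
      map_smul' := fun c u => by
        ext t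
        exact intervalIntegral.integral_smul c _ } 1 (fun u => by
    rw [one_mul, ContinuousMap.norm_le _ (norm_nonneg _)]
    intro t
    have h := intervalIntegral.norm_integral_le_of_norm_le_const (a := (0 : ℝ)) (b := t)
      (f := fun τ : ℝ => u (Set.projIcc 0 1 zero_le_one τ)) (C := ‖u‖)
      (fun τ _ => u.norm_coe_le_norm _)
    refine h.trans ?_
    rw [sub_zero, abs_of_nonneg t.2.1]
    exact mul_le_of_le_one_right (norm_nonneg _) t.2.2)

theorem volterra_apply (u : C(unitInterval, E)) (t : unitInterval) :
    volterra u t = primitiveFun u t := rfl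

/-- A flow of a smooth Lipschitz vector field is smooth near time zero. -/
theorem contDiffAt_flow_zero {f : E → E} (hf : ContDiff ℝ ∞ f) {K : NNReal}
    (hL : LipschitzWith K f) {Φ : ℝ × E → E} (h0 : ∀ x, Φ (0, x) = x)
    (hd : ∀ t x, HasDerivAt (fun t => Φ (t, x)) (f (Φ (t, x))) t) (x₀ : E) :
    ContDiffAt ℝ ∞ Φ (0, x₀) := by
  let N : C(unitInterval, E) → C(unitInterval, E) := fun u =>
    (⟨f, hf.continuous⟩ : C(E, E)).comp u
  have hN : ContDiff ℝ ∞ N := contDiff_postcomp hf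
  let c : E →L[ℝ] C(unitInterval, E) := ContinuousLinearMap.const ℝ unitInterval
  -- Time is rescaled to the unit interval: `u τ = Φ (l τ, x)` is characterized by `u = x + l ∫
  -- f(u)`, that is `G ((l, x), u) = 0`. At `l = 0` the derivative in `u` is the identity, so the
  -- implicit function theorem in `C([0,1], E)` applies.
  let G : (ℝ × E) × C(unitInterval, E) → C(unitInterval, E) := fun w =>
    w.2 - c w.1.2 - w.1.1 • volterra (N w.2)
  have hG : ContDiff ℝ ∞ G := by
    have h1 : ContDiff ℝ ∞ fun w : (ℝ × E) × C(unitInterval, E) => volterra (N w.2) :=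
      volterra.contDiff.comp (hN.comp contDiff_snd)
    have h2 : ContDiff ℝ ∞ fun w : (ℝ × E) × C(unitInterval, E) => c w.1.2 :=
      c.contDiff.comp (contDiff_snd.comp contDiff_fst)
    have h3 : ContDiff ℝ ∞ fun w : (ℝ × E) × C(unitInterval, E) => w.1.1 :=
      contDiff_fst.comp contDiff_fst
    exact (contDiff_snd.sub h2).sub (h3.smul h1)
  let w₀ : (ℝ × E) × C(unitInterval, E) := ((0, x₀), c x₀)
  have hG0 : G w₀ = 0 := by simp [G, w₀]
  have hn : (∞ : WithTop ℕ∞) ≠ 0 := by simp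
  have hder : fderiv ℝ G w₀ ∘L .inr ℝ (ℝ × E) C(unitInterval, E) =
      ContinuousLinearMap.id ℝ _ := by
    have h1 : HasFDerivAt (fun u => G ((0, x₀), u))
        (fderiv ℝ G w₀ ∘L .inr ℝ (ℝ × E) C(unitInterval, E)) (c x₀) :=
      ((hG.differentiable (by simp) w₀).hasFDerivAt).comp (c x₀) (hasFDerivAt_prodMk_right _ _)
    have h2 : HasFDerivAt (fun u => G ((0, x₀), u)) (ContinuousLinearMap.id ℝ _) (c x₀) := by
      simp only [G, zero_smul, sub_zero]
      exact (hasFDerivAt_id _).sub_const _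
    exact h1.unique h2
  have hinv : (fderiv ℝ G w₀ ∘L .inr ℝ (ℝ × E) C(unitInterval, E)).IsInvertible := by
    rw [hder]; exact ⟨ContinuousLinearEquiv.refl ℝ _, rfl⟩
  have hev := hG.contDiffAt.eventually_apply_implicitFunction (u := w₀) hn hinv
  have hsm := hG.contDiffAt.contDiffAt_implicitFunction (u := w₀) hn hinv
  set U := hG.contDiffAt.implicitFunction (u := w₀) hn hinv
  let ev : C(unitInterval, E) →L[ℝ] E := ContinuousMap.evalCLM ℝ (1 : unitInterval)
  refine (ev.contDiff.contDiffAt.comp _ hsm).congr_of_eventuallyEq ?_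
  filter_upwards [hev] with w hw
  obtain ⟨l, x⟩ := w
  rw [hG0] at hw
  set u := U (l, x)
  have hu : ∀ t : unitInterval, u t = x + l • primitiveFun (N u) t := fun t => by
    have h := congrArg (fun v : C(unitInterval, E) => v t) hw
    simp only [G, ContinuousMap.sub_apply, ContinuousMap.smul_apply, ContinuousMap.zero_apply,
      volterra_apply] at h
    have h' : u t - x - l • primitiveFun (N u) t = 0 := h
    rw [sub_sub, sub_eq_zero] at h'
    exact h'
  have hmem : ∀ t ∈ Set.Icc (0 : ℝ) 1, x + l • primitiveFun (N u) t =
      u (Set.projIcc 0 1 zero_le_one t) := fun t ht => by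
    rw [hu, Set.projIcc_of_mem zero_le_one ht]
  have hp : ∀ t, HasDerivAt (fun t => x + l • primitiveFun (N u) t)
      (l • N u (Set.projIcc 0 1 zero_le_one t)) t := fun t =>
    ((hasDerivAt_primitiveFun (N u) t).const_smul l).const_add x
  have hΦ : ∀ t : ℝ, HasDerivAt (fun t => Φ (t * l, x)) (l • f (Φ (t * l, x))) t := fun t => by
    have := (hd (t * l) x).scomp t ((hasDerivAt_id t).mul_const l)
    simpa [Function.comp_def] using this
  -- The implicit function solves the same rescaled equation as `t ↦ Φ (t l, x)`, so the two
  -- coincide; evaluation at `1` recovers `Φ (l, x)`.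
  have huniq := ODE_solution_unique (v := fun _ y => l • f y) (K := ‖l‖₊ * K) (a := 0) (b := 1)
    (f := fun t => Φ (t * l, x)) (g := fun t => x + l • primitiveFun (N u) t)
    (fun _ => LipschitzWith.of_dist_le_mul fun y z => by
      rw [dist_smul₀, NNReal.coe_mul, mul_assoc]
      exact mul_le_mul_of_nonneg_left (hL.dist_le_mul y z) (norm_nonneg _))
    (fun t _ => (hΦ t).continuousAt.continuousWithinAt)
    (fun t _ => (hΦ t).hasDerivWithinAt)
    (fun t _ => (hp t).continuousAt.continuousWithinAt)
    (fun t ht => by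
      have h := (hp t).hasDerivWithinAt (s := Set.Ici t)
      have h2 : x + l • primitiveFun (N u) t = u (Set.projIcc 0 1 zero_le_one t) :=
        hmem t ⟨ht.1, ht.2.le⟩
      simp only [h2]
      exact h)
    (by simp [h0, primitiveFun])
  have h1 := huniq (Set.right_mem_Icc.2 zero_le_one)
  simp only [one_mul] at h1
  rw [h1]
  change _ = u 1
  rw [hu]; rfl

/-- Because the field is bounded by `C`, Picard–Lindelöf works on all of `[-T, T]` with a ball of
radius `C T`; uniqueness makes the solutions for different `T` agree. -/
theorem exists_global_solution {f : E → E} {K : NNReal} (hL : LipschitzWith K f) {C : ℝ}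
    (hC : ∀ x, ‖f x‖ ≤ C) (x : E) :
    ∃ γ : ℝ → E, γ 0 = x ∧ ∀ t, HasDerivAt γ (f (γ t)) t := by
  have hC0 : 0 ≤ C := (norm_nonneg _).trans (hC x)
  lift C to NNReal using hC0
  have key : ∀ T : ℝ, 0 < T → ∃ γ : ℝ → E, γ 0 = x ∧
      ∀ t ∈ Set.Ioo (-T) T, HasDerivAt γ (f (γ t)) t := fun T hT => by
    have hpl : IsPicardLindelof (fun _ => f) (tmin := -T) (tmax := T)
        ⟨0, by constructor <;> linarith⟩ x (C * T.toNNReal) 0 C K :=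
      IsPicardLindelof.of_time_independent (fun y _ => hC y) hL.lipschitzOnWith (by
        simp [hT.le])
    obtain ⟨γ, h1, h2⟩ := hpl.exists_eq_forall_mem_Icc_hasDerivWithinAt₀
    exact ⟨γ, h1, fun t ht => (h2 t (Set.Ioo_subset_Icc_self ht)).hasDerivAt
      (Icc_mem_nhds ht.1 ht.2)⟩
  choose! γ hγ0 hγ using key
  have huniq : ∀ T T', 0 < T → T ≤ T' → Set.EqOn (γ T) (γ T') (Set.Ioo (-T) T) := fun T T' h h' =>
    ODE_solution_unique_of_mem_Ioo (v := fun _ => f) (s := fun _ => Set.univ) (K := K) (t₀ := 0)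
      (fun _ _ => hL.lipschitzOnWith) ⟨by linarith, h⟩
      (fun t ht => ⟨hγ T h t ht, trivial⟩)
      (fun t ht => ⟨hγ T' (h.trans_le h') t ⟨by linarith [ht.1], by linarith [ht.2]⟩, trivial⟩)
      (by rw [hγ0 T h, hγ0 T' (h.trans_le h')])
  -- The interval used depends on `t`; differentiability at `t` is seen by comparison with the
  -- single solution on radius `|t| + 2`.
  refine ⟨fun t => γ (|t| + 1) t, hγ0 _ (by positivity), fun t => ?_⟩
  have ht : t ∈ Set.Ioo (-(|t| + 2)) (|t| + 2) :=
    ⟨by linarith [neg_abs_le t], by linarith [le_abs_self t]⟩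
  have h1 : (fun t => γ (|t| + 1) t) =ᶠ[𝓝 t] γ (|t| + 2) := by
    filter_upwards [Metric.ball_mem_nhds t one_pos] with τ hτ
    rw [Real.ball_eq_Ioo] at hτ
    refine huniq _ _ (by positivity) ?_ ⟨by linarith [neg_abs_le τ], by linarith [le_abs_self τ]⟩
    have : |τ| ≤ |t| + 1 := by
      have := abs_sub_abs_le_abs_sub τ t
      have h2 : |τ - t| < 1 := by rw [abs_lt]; constructor <;> linarith [hτ.1, hτ.2]
      linarith
    linarith
  have h2 := (hγ (|t| + 2) (by positivity) t ht).congr_of_eventuallyEq h1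
  rwa [← h1.eq_of_nhds] at h2

/-- A smooth compactly supported vector field has a smooth global flow. -/
theorem exists_contDiff_flow [FiniteDimensional ℝ E] {f : E → E} (hf : ContDiff ℝ ∞ f)
    (hs : HasCompactSupport f) :
    ∃ Φ : ℝ × E → E, ContDiff ℝ ∞ Φ ∧ (∀ x, Φ (0, x) = x) ∧
      (∀ t x, HasDerivAt (fun t => Φ (t, x)) (f (Φ (t, x))) t) ∧
      (∀ s t x, Φ (s + t, x) = Φ (s, Φ (t, x))) ∧ ∃ K : NNReal, LipschitzWith K f := by
  obtain ⟨K, hL⟩ := hf.lipschitzWith_of_hasCompactSupport hs (by simp)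
  obtain ⟨C, hC⟩ := hs.exists_bound_of_continuous hf.continuous
  choose γ hγ0 hγ using exists_global_solution hL hC
  let Φ : ℝ × E → E := fun w => γ w.2 w.1
  have h0 : ∀ x, Φ (0, x) = x := hγ0
  have hd : ∀ t x, HasDerivAt (fun t => Φ (t, x)) (f (Φ (t, x))) t := fun t x => hγ x t
  have hadd : ∀ s t x, Φ (s + t, x) = Φ (s, Φ (t, x)) := fun s t x => by
    have h := ODE_solution_unique_univ (v := fun _ => f) (s := fun _ => Set.univ) (K := K)
      (f := fun s => Φ (s + t, x)) (g := fun s => Φ (s, Φ (t, x))) (t₀ := 0)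
      (fun _ => hL.lipschitzOnWith)
      (fun s => ⟨(hd (s + t) x).comp_add_const s t, trivial⟩) (fun s => ⟨hd s _, trivial⟩)
      (by simp [h0])
    exact congrFun h s
  refine ⟨Φ, ?_, h0, hd, hadd, K, hL⟩
  -- A finite order is fixed because only then is `ContDiffAt` an open condition on the point.
  refine contDiff_infty.2 fun n => contDiff_iff_contDiffAt.2 ?_
  rintro ⟨t, x⟩
  have hloc : ∀ y, ∀ᶠ z in 𝓝 ((0 : ℝ), y), ContDiffAt ℝ n Φ z := fun y =>
    ((contDiffAt_flow_zero hf hL h0 hd y).of_le (by exact_mod_cast le_top)).eventually (by simp)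
  let S : Set ℝ := {t | ContDiffAt ℝ n Φ (t, x)}
  -- Smoothness spreads along the orbit: `Φ (t, ·) = Φ (t - t', Φ (t', ·))`, and for `t, t'` close
  -- to `τ` the outer flow runs for a time near zero, where it is already smooth. This makes `S`
  -- both open and closed.
  have hcl : ∀ τ, ∃ V ∈ 𝓝 τ, ∀ t' ∈ V, t' ∈ S → V ⊆ S := fun τ => by
    have hcont : Tendsto (fun w : ℝ × ℝ => (w.1 - w.2, Φ (w.2, x))) (𝓝 (τ, τ))
        (𝓝 (0, Φ (τ, x))) := by
      have hc : ContinuousAt (fun t => Φ (t, x)) τ := (hd τ x).continuousAt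
      have h1 : ContinuousAt (fun w : ℝ × ℝ => (w.1 - w.2, Φ (w.2, x))) (τ, τ) :=
        (by fun_prop : ContinuousAt (fun w : ℝ × ℝ => w.1 - w.2) (τ, τ)).prodMk
          (hc.comp_of_eq (by fun_prop : ContinuousAt (fun w : ℝ × ℝ => w.2) (τ, τ)) rfl)
      simpa [ContinuousAt] using h1
    have h2 := hcont.eventually (hloc (Φ (τ, x)))
    rw [nhds_prod_eq] at h2
    obtain ⟨V, hV, h3⟩ := (eventually_prod_self_iff'.1 h2)
    refine ⟨V, hV, fun t' ht' htS t ht => ?_⟩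
    have h4 := h3 t ht t' ht'
    have h5 : Φ = fun w => Φ (w.1 - t', Φ (t', w.2)) := by
      funext w
      rw [← hadd, sub_add_cancel]
    change ContDiffAt ℝ n Φ (t, x)
    rw [h5]
    have h6 : ContDiffAt ℝ n (fun w : ℝ × E => (w.1 - t', Φ (t', w.2))) (t, x) := by
      refine ContDiffAt.prodMk (by fun_prop) ?_
      have h7 : ContDiffAt ℝ n Φ (t', x) := htS
      exact h7.comp (t, x) (by fun_prop : ContDiffAt ℝ n (fun w : ℝ × E => (t', w.2)) (t, x))
    exact ContDiffAt.comp (t, x) (g := Φ) h4 h6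
  have hclopen : IsClopen S := by
    refine ⟨⟨isOpen_iff_mem_nhds.2 fun τ hτ => ?_⟩, isOpen_iff_mem_nhds.2 fun τ hτ => ?_⟩
    · obtain ⟨V, hV, h⟩ := hcl τ
      refine mem_of_superset hV fun t' ht' htS => hτ (h t' ht' htS (mem_of_mem_nhds hV))
    · obtain ⟨V, hV, h⟩ := hcl τ
      exact mem_of_superset hV (h τ (mem_of_mem_nhds hV) hτ)
  have hne : S.Nonempty := ⟨0, (hloc x).self_of_nhds⟩
  have : t ∈ S := by rw [hclopen.eq_univ hne]; trivial
  exact this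

end Flow


/-! ### Geometry of the level curves and blow-up of the center -/

section Center

/-- The hypotheses on the limiting Hamiltonian `H₀`. -/
structure IsCenter (E₀ : ℝ) (U : Set (ℝ × ℝ)) (H₀ : ℝ × ℝ → ℝ) : Prop where
  E₀_pos : 0 < E₀
  isOpen_U : IsOpen U
  zero_mem_U : (0, 0) ∈ U
  smooth : ContDiff ℝ ∞ H₀
  center : (fun p : ℝ × ℝ => H₀ p - (p.1 ^ 2 + p.2 ^ 2) / 2) =O[𝓝 (0, 0)]
    (fun p : ℝ × ℝ => Real.sqrt (p.1 ^ 2 + p.2 ^ 2) ^ 3)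
  closed_levels : ∀ E ∈ Set.Ioc 0 E₀, IsClosedCurve {p | p ∈ U ∧ H₀ p = E}
  regular_levels : ∀ p ∈ U, H₀ p ∈ Set.Ioc 0 E₀ → ¬ (partialX H₀ p = 0 ∧ partialY H₀ p = 0)

theorem partialX_eq_fderiv {h : ℝ × ℝ → ℝ} {p : ℝ × ℝ} (hd : DifferentiableAt ℝ h p) :
    partialX h p = fderiv ℝ h p (1, 0) :=
  (hd.hasFDerivAt.comp_hasDerivAt p.1
    ((hasDerivAt_id p.1).prodMk (hasDerivAt_const p.1 p.2))).deriv

theorem partialY_eq_fderiv {h : ℝ × ℝ → ℝ} {p : ℝ × ℝ} (hd : DifferentiableAt ℝ h p) :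
    partialY h p = fderiv ℝ h p (0, 1) :=
  (hd.hasFDerivAt.comp_hasDerivAt p.2
    ((hasDerivAt_const p.2 p.1).prodMk (hasDerivAt_id p.2))).deriv

theorem fderiv_apply_eq_partial {h : ℝ × ℝ → ℝ} {p : ℝ × ℝ} (hd : DifferentiableAt ℝ h p)
    (v : ℝ × ℝ) : fderiv ℝ h p v = partialX h p * v.1 + partialY h p * v.2 := by
  rw [partialX_eq_fderiv hd, partialY_eq_fderiv hd]
  have : v = v.1 • ((1 : ℝ), (0 : ℝ)) + v.2 • ((0 : ℝ), (1 : ℝ)) := by ext <;> simp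
  conv_lhs => rw [this]
  rw [map_add, map_smul, map_smul, smul_eq_mul, smul_eq_mul]
  ring

theorem contDiff_partialX {h : ℝ × ℝ → ℝ} (hh : ContDiff ℝ ∞ h) : ContDiff ℝ ∞ (partialX h) := by
  have : partialX h = fun p => fderiv ℝ h p (1, 0) :=
    funext fun p => partialX_eq_fderiv (hh.differentiable (by simp) p)
  rw [this]
  exact (hh.fderiv_right (m := ∞) (by simp)).clm_apply contDiff_const

theorem contDiff_partialY {h : ℝ × ℝ → ℝ} (hh : ContDiff ℝ ∞ h) : ContDiff ℝ ∞ (partialY h) := by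
  have : partialY h = fun p => fderiv ℝ h p (0, 1) :=
    funext fun p => partialY_eq_fderiv (hh.differentiable (by simp) p)
  rw [this]
  exact (hh.fderiv_right (m := ∞) (by simp)).clm_apply contDiff_const

theorem IsClosedCurve.isCompact {S : Set (ℝ × ℝ)} (h : IsClosedCurve S) : IsCompact S := by
  obtain ⟨γ, hγ, -, rfl⟩ := h
  exact isCompact_range hγ

theorem IsClosedCurve.isConnected {S : Set (ℝ × ℝ)} (h : IsClosedCurve S) : IsConnected S := by
  obtain ⟨γ, hγ, -, rfl⟩ := h
  have h1 : Function.Surjective (fun t : ℝ => Circle.exp t) := fun z => by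
    obtain ⟨t, ht⟩ := Circle.exp_surjective z
    exact ⟨t, ht⟩
  have h2 := isConnected_range (hγ.comp Circle.exp.continuous)
  rwa [Set.range_comp, h1.range_eq, Set.image_univ] at h2

namespace IsCenter

variable {E₀ : ℝ} {U : Set (ℝ × ℝ)} {H₀ : ℝ × ℝ → ℝ}

theorem differentiable (hc : IsCenter E₀ U H₀) : Differentiable ℝ H₀ :=
  hc.smooth.differentiable (by simp)

theorem continuous (hc : IsCenter E₀ U H₀) : Continuous H₀ := hc.smooth.continuous

/-- Near the center `H₀` is comparable with `x² + y²`. -/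
theorem exists_radius (hc : IsCenter E₀ U H₀) : ∃ r > 0, ∀ p : ℝ × ℝ, p.1 ^ 2 + p.2 ^ 2 ≤ r ^ 2 →
    p ∈ U ∧ (p.1 ^ 2 + p.2 ^ 2) / 4 ≤ H₀ p ∧ H₀ p ≤ p.1 ^ 2 + p.2 ^ 2 := by
  obtain ⟨C, hC0, hC⟩ := hc.center.exists_pos
  rw [Asymptotics.IsBigOWith] at hC
  have h1 := hC.and (hc.isOpen_U.mem_nhds hc.zero_mem_U)
  obtain ⟨δ, hδ, h2⟩ := Metric.eventually_nhds_iff.1 h1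
  refine ⟨min (δ / 2) (1 / (4 * C)), by positivity, fun p hp => ?_⟩
  set r := min (δ / 2) (1 / (4 * C))
  have hr : 0 < r := by positivity
  set n := p.1 ^ 2 + p.2 ^ 2 with hn
  have hn0 : 0 ≤ n := by positivity
  have hsq : Real.sqrt n ≤ r := Real.sqrt_le_iff.2 ⟨hr.le, hp⟩
  have hd : dist p (0, 0) < δ := by
    have h3 : |p.1| ≤ r := abs_le_of_sq_le_sq (by nlinarith [sq_nonneg p.2]) hr.le
    have h4 : |p.2| ≤ r := abs_le_of_sq_le_sq (by nlinarith [sq_nonneg p.1]) hr.le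
    have h5 : r ≤ δ / 2 := min_le_left _ _
    rw [Prod.dist_eq, max_lt_iff, Real.dist_eq, Real.dist_eq, sub_zero, sub_zero]
    constructor <;> linarith
  obtain ⟨h3, h4⟩ := h2 hd
  refine ⟨h4, ?_⟩
  rw [Real.norm_eq_abs, Real.norm_of_nonneg (by positivity), abs_le] at h3
  have h5 : C * Real.sqrt n ≤ 1 / 4 := by
    have : C * Real.sqrt n ≤ C * (1 / (4 * C)) := by
      gcongr; exact hsq.trans (min_le_right _ _)
    refine this.trans (le_of_eq ?_)
    field_simp
  have h6 : C * Real.sqrt n ^ 3 ≤ n / 4 := by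
    have : C * Real.sqrt n ^ 3 = (C * Real.sqrt n) * n := by
      rw [pow_succ' _ 2, Real.sq_sqrt hn0]; ring
    rw [this]
    nlinarith
  constructor <;> linarith [h3.1, h3.2]

theorem map_zero (hc : IsCenter E₀ U H₀) : H₀ (0, 0) = 0 := by
  obtain ⟨r, -, h⟩ := hc.exists_radius
  have := (h (0, 0) (by simp; positivity)).2
  simp only [ne_eq, OfNat.ofNat_ne_zero, not_false_eq_true, zero_pow, add_zero, zero_div] at this
  exact le_antisymm this.2 this.1

theorem fderiv_ne_zero (hc : IsCenter E₀ U H₀) {p : ℝ × ℝ} (hp : p ∈ U)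
    (hE : H₀ p ∈ Set.Ioc 0 E₀) : fderiv ℝ H₀ p ≠ 0 := fun h => by
  apply hc.regular_levels p hp hE
  rw [partialX_eq_fderiv (hc.differentiable p), partialY_eq_fderiv (hc.differentiable p), h]
  simp

theorem map_nhds_eq (hc : IsCenter E₀ U H₀) {p : ℝ × ℝ} (h : fderiv ℝ H₀ p ≠ 0) :
    map H₀ (𝓝 p) = 𝓝 (H₀ p) := by
  have h1 : HasStrictFDerivAt H₀ (fderiv ℝ H₀ p) p :=
    hc.smooth.contDiffAt.hasStrictFDerivAt (by simp)
  refine h1.map_nhds_eq_of_surj ?_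
  exact LinearMap.range_eq_top.2 (LinearMap.surjective (f := (fderiv ℝ H₀ p : ℝ × ℝ →ₗ[ℝ] ℝ))
    fun h' => h (ContinuousLinearMap.coe_injective h'))

/-- Level curves stay in a neighbourhood of a given one. -/
theorem eventually_level_subset (hc : IsCenter E₀ U H₀) {E : ℝ} (hE : E ∈ Set.Ioc 0 E₀)
    {V : Set (ℝ × ℝ)} (hV : IsOpen V) (hEV : {p | p ∈ U ∧ H₀ p = E} ⊆ V) :
    ∀ᶠ E' in 𝓝 E, E' ∈ Set.Ioc 0 E₀ → {p | p ∈ U ∧ H₀ p = E'} ⊆ V := by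
  obtain ⟨V', hV'o, hEV', hV'V, hV'c⟩ := exists_open_between_and_isCompact_closure
    (hc.closed_levels E hE).isCompact (hV.inter hc.isOpen_U) (fun p hp => ⟨hEV hp, hp.1⟩)
  have hfr : IsCompact (frontier V') := hV'c.of_isClosed_subset isClosed_frontier
    frontier_subset_closure
  -- The frontier of `V'` is compact and misses the level `E`, hence also all nearby levels.
  have h1 : ∀ᶠ E' in 𝓝 E, E' ∉ H₀ '' frontier V' := by
    refine (hfr.image hc.continuous).isClosed.isOpen_compl.mem_nhds ?_
    rintro ⟨p, hp, hpE⟩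
    rw [hV'o.frontier_eq] at hp
    exact hp.2 (hEV' ⟨(hV'V hp.1).2, hpE⟩)
  obtain ⟨p₀, hp₀⟩ := (hc.closed_levels E hE).isConnected.nonempty
  have h2 : ∀ᶠ E' in 𝓝 E, E' ∈ H₀ '' V' := by
    have h3 := hc.map_nhds_eq (hc.fderiv_ne_zero hp₀.1 (by rw [hp₀.2]; exact hE))
    rw [hp₀.2] at h3
    rw [← h3]
    exact image_mem_map (hV'o.mem_nhds (hEV' hp₀))
  filter_upwards [h1, h2] with E' h1 h2 hE'
  obtain ⟨p, hp, hpE⟩ := h2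
  -- A nearby level meets `V'`, because `H₀` is open at a regular point, and avoids the frontier;
  -- being connected, it lies inside.
  have h4 : {p | p ∈ U ∧ H₀ p = E'} ⊆ V' := by
    refine (hc.closed_levels E' hE').isConnected.isPreconnected.subset_left_of_subset_union
      (v := (closure V')ᶜ) hV'o isClosed_closure.isOpen_compl ?_ ?_ ?_
    · exact Set.disjoint_compl_right_iff_subset.2 subset_closure
    · intro q hq
      by_contra hcon
      rw [Set.mem_union, not_or, Set.mem_compl_iff, not_not] at hcon
      exact h1 ⟨q, by rw [hV'o.frontier_eq]; exact ⟨hcon.2, hcon.1⟩, hq.2⟩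
    · exact ⟨p, ⟨(hV'V (subset_closure hp)).2, hpE⟩, hp⟩
  exact fun q hq => (hV'V (subset_closure (h4 hq))).1

/-- Low level curves lie close to the center. -/
theorem exists_small_levels (hc : IsCenter E₀ U H₀) : ∃ E₁ > 0, ∀ p ∈ U, H₀ p ∈ Set.Ioc 0 E₀ →
    H₀ p < E₁ → p.1 ^ 2 + p.2 ^ 2 ≤ 4 * H₀ p := by
  obtain ⟨r, hr, h⟩ := hc.exists_radius
  refine ⟨r ^ 2 / 4, by positivity, fun p hp hE hlt => ?_⟩
  set E := H₀ p
  have hcont : Continuous fun p : ℝ × ℝ => p.1 ^ 2 + p.2 ^ 2 := by fun_prop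
  -- On the circle of radius `r` one has `H₀ ≥ r²/4 > E`, so the connected level curve cannot cross
  -- it. It does have a point inside, found on the `x`-axis by the intermediate value theorem.
  have hsub : {q | q ∈ U ∧ H₀ q = E} ⊆ {q : ℝ × ℝ | q.1 ^ 2 + q.2 ^ 2 < r ^ 2} := by
    refine (hc.closed_levels E hE).isConnected.isPreconnected.subset_left_of_subset_union
      (v := {q : ℝ × ℝ | r ^ 2 < q.1 ^ 2 + q.2 ^ 2})
      (isOpen_lt hcont continuous_const) (isOpen_lt continuous_const hcont) ?_ ?_ ?_
    · rw [Set.disjoint_left]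
      intro q h1 h2
      simp only [Set.mem_ofPred_eq] at h1 h2
      linarith
    · intro q hq
      rcases lt_trichotomy (q.1 ^ 2 + q.2 ^ 2) (r ^ 2) with h1 | h1 | h1
      · exact Or.inl h1
      · have h2 := (h q h1.le).2.1
        rw [h1, hq.2] at h2
        linarith
      · exact Or.inr h1
    · have hiv := intermediate_value_Icc hr.le (f := fun x => H₀ (x, 0))
        ((hc.continuous.comp (by fun_prop : Continuous fun x : ℝ => (x, (0 : ℝ)))).continuousOn)
      have h1 := (h (r, 0) (by simp)).2.1
      simp only [ne_eq, OfNat.ofNat_ne_zero, not_false_eq_true, zero_pow, add_zero] at h1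
      obtain ⟨x, hx, hxE⟩ := hiv (show E ∈ Set.Icc _ _ from
        ⟨by rw [hc.map_zero]; exact hE.1.le, by linarith⟩)
      have hx2 : (x, (0 : ℝ)).1 ^ 2 + (x, (0 : ℝ)).2 ^ 2 ≤ r ^ 2 := by
        simp only [ne_eq, OfNat.ofNat_ne_zero, not_false_eq_true, zero_pow, add_zero]
        exact pow_le_pow_left₀ hx.1 hx.2 2
      refine ⟨(x, 0), ⟨(h _ hx2).1, hxE⟩, lt_of_le_of_ne hx2 fun h3 => ?_⟩
      have h4 := (h _ hx2).2.1
      rw [h3] at h4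
      simp only at hxE
      linarith
  have h1 : p.1 ^ 2 + p.2 ^ 2 < r ^ 2 := hsub ⟨hp, rfl⟩
  have := (h p h1.le).2.1
  linarith

/-- As `U` is merely open, closedness is not automatic. Each level has a relatively compact
neighborhood with closure in `U` that also contains the nearby levels, and finitely many of these
cover the range of energies. -/
theorem isCompact_shell (hc : IsCenter E₀ U H₀) {e : ℝ} (he : 0 < e) :
    IsCompact {p | p ∈ U ∧ H₀ p ∈ Set.Icc e E₀} := by
  have h1 : ∀ E ∈ Set.Icc e E₀, ∃ V : Set (ℝ × ℝ), closure V ⊆ U ∧ IsCompact (closure V) ∧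
      ∀ᶠ E' in 𝓝 E, E' ∈ Set.Ioc 0 E₀ → {p | p ∈ U ∧ H₀ p = E'} ⊆ V := fun E hE => by
    have hE' : E ∈ Set.Ioc 0 E₀ := ⟨he.trans_le hE.1, hE.2⟩
    obtain ⟨V, hVo, hEV, hVU, hVc⟩ := exists_open_between_and_isCompact_closure
      (hc.closed_levels E hE').isCompact hc.isOpen_U (fun p hp => hp.1)
    exact ⟨V, hVU, hVc, hc.eventually_level_subset hE' hVo hEV⟩
  choose! V hVU hVc hV using h1
  obtain ⟨t, ht, hcov⟩ := (isCompact_Icc (a := e) (b := E₀)).elim_nhds_subcover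
    (fun E => {E' | E' ∈ Set.Ioc 0 E₀ → {p | p ∈ U ∧ H₀ p = E'} ⊆ V E}) hV
  have hK : IsCompact (⋃ E ∈ t, closure (V E)) :=
    t.finite_toSet.isCompact_biUnion fun E hE => hVc E (ht E hE)
  have heq : {p | p ∈ U ∧ H₀ p ∈ Set.Icc e E₀} =
      (⋃ E ∈ t, closure (V E)) ∩ H₀ ⁻¹' Set.Icc e E₀ := by
    ext p
    constructor
    · rintro ⟨hp, hE⟩
      obtain ⟨E, hEt, h2⟩ := Set.mem_iUnion₂.1 (hcov hE)
      exact ⟨Set.mem_iUnion₂.2 ⟨E, hEt,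
        subset_closure (h2 ⟨he.trans_le hE.1, hE.2⟩ ⟨hp, rfl⟩)⟩, hE⟩
    · rintro ⟨hp, hE⟩
      obtain ⟨E, hEt, h2⟩ := Set.mem_iUnion₂.1 hp
      exact ⟨hVU E (ht E hEt) h2, hE⟩
  rw [heq]
  exact hK.inter_right (isClosed_Icc.preimage hc.continuous)

/-- Supplies the radius outside which the Hamiltonian field may be cut off. Low levels are close to
the center, the others lie in a compact shell. -/
theorem exists_bound (hc : IsCenter E₀ U H₀) : ∃ R > 0, ∀ p ∈ U, H₀ p ∈ Set.Ioc 0 E₀ →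
    ‖p‖ < R := by
  obtain ⟨E₁, hE₁, h⟩ := hc.exists_small_levels
  obtain ⟨C, hC⟩ := (hc.isCompact_shell hE₁).isBounded.exists_norm_le
  refine ⟨max (C + 1) (4 * E₁ + 2), lt_max_of_lt_right (by positivity), fun p hp hE => ?_⟩
  rcases lt_or_ge (H₀ p) E₁ with h1 | h1
  · have h2 := h p hp hE h1
    refine lt_max_of_lt_right ?_
    rw [Prod.norm_def, max_lt_iff, Real.norm_eq_abs, Real.norm_eq_abs, abs_lt, abs_lt]
    refine ⟨⟨?_, ?_⟩, ?_, ?_⟩ <;> nlinarith [sq_nonneg (p.1 - 1), sq_nonneg (p.1 + 1),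
      sq_nonneg (p.2 - 1), sq_nonneg (p.2 + 1), sq_nonneg p.1, sq_nonneg p.2]
  · exact lt_max_of_lt_left ((hC p ⟨hp, h1, hE.2⟩).trans_lt (by linarith))

/-- Blow-up of `H₀` at the center: `H₀ (s v) = s² K (v, s)`. -/
theorem exists_blowup (hc : IsCenter E₀ U H₀) : ∃ K : (ℝ × ℝ) × ℝ → ℝ, ContDiff ℝ ∞ K ∧
    (∀ v s, H₀ (s • v) = s ^ 2 * K (v, s)) ∧ (∀ v, K (v, 0) = (v.1 ^ 2 + v.2 ^ 2) / 2) ∧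
    (∀ v s w, fderiv ℝ H₀ (s • v) w = s * fderiv ℝ K (v, s) (w, 0)) ∧
    ∀ v w, fderiv ℝ K (v, 0) (w, 0) = v.1 * w.1 + v.2 * w.2 := by
  let Q : (ℝ × ℝ) × ℝ → ℝ := fun z => H₀ (z.2 • z.1)
  have hQ : ContDiff ℝ ∞ Q := hc.smooth.comp (contDiff_snd.smul contDiff_fst)
  have hQ0 : ∀ v, Q (v, 0) = 0 := fun v => by
    simp only [Q, zero_smul]; exact hc.map_zero
  have hA := contDiff_hadamardQuot hQ
  have hK := contDiff_hadamardQuot hA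
  -- The cubic error at the center gives the limit of `H₀ (s v) / s²`. It forces the first Hadamard
  -- quotient to vanish at `s = 0`, which permits a second division, and it identifies the second
  -- quotient there.
  have hlim : ∀ v : ℝ × ℝ, Tendsto (fun s => Q (v, s) / s ^ 2) (𝓝[≠] 0)
      (𝓝 ((v.1 ^ 2 + v.2 ^ 2) / 2)) := fun v => by
    obtain ⟨C, hC⟩ := hc.center.bound
    have h1 : Tendsto (fun s : ℝ => s • v) (𝓝[≠] 0) (𝓝 (0, 0)) := by
      have : Continuous fun s : ℝ => s • v := by fun_prop
      rw [← Prod.zero_eq_mk]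
      simpa using (this.tendsto 0).mono_left nhdsWithin_le_nhds
    rw [tendsto_iff_norm_sub_tendsto_zero]
    have h2 : Tendsto (fun s : ℝ => C * (|s| * Real.sqrt (v.1 ^ 2 + v.2 ^ 2) ^ 3)) (𝓝[≠] 0)
        (𝓝 0) := by
      have : Continuous fun s : ℝ => C * (|s| * Real.sqrt (v.1 ^ 2 + v.2 ^ 2) ^ 3) := by fun_prop
      simpa using (this.tendsto 0).mono_left nhdsWithin_le_nhds
    refine squeeze_zero' (Eventually.of_forall fun s => norm_nonneg _) ?_ h2
    filter_upwards [h1.eventually hC, self_mem_nhdsWithin] with s hs hs0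
    have hs0 : s ≠ 0 := hs0
    have h3 : (s • v).1 ^ 2 + (s • v).2 ^ 2 = s ^ 2 * (v.1 ^ 2 + v.2 ^ 2) := by
      simp only [Prod.smul_fst, Prod.smul_snd, smul_eq_mul]; ring
    rw [h3, Real.sqrt_mul (sq_nonneg s), Real.sqrt_sq_eq_abs, Real.norm_eq_abs,
      Real.norm_of_nonneg (by positivity)] at hs
    have h4 : Q (v, s) / s ^ 2 - (v.1 ^ 2 + v.2 ^ 2) / 2 =
        (H₀ (s • v) - s ^ 2 * (v.1 ^ 2 + v.2 ^ 2) / 2) / s ^ 2 := by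
      simp only [Q]; field_simp
    rw [h4, Real.norm_eq_abs, abs_div, abs_of_nonneg (sq_nonneg s), div_le_iff₀ (by positivity)]
    refine hs.trans (le_of_eq ?_)
    rw [← sq_abs s]; ring
  have hA0 : ∀ v, hadamardQuot Q (v, 0) = 0 := fun v => by
    have h1 : Tendsto (fun s => hadamardQuot Q (v, s)) (𝓝[≠] 0) (𝓝 (hadamardQuot Q (v, 0))) :=
      ((hA.continuous.comp (Continuous.prodMk_right v)).tendsto 0).mono_left nhdsWithin_le_nhds
    have h2 : Tendsto (fun s : ℝ => s * (Q (v, s) / s ^ 2)) (𝓝[≠] 0) (𝓝 0) := by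
      have h3 : Tendsto (fun s : ℝ => s) (𝓝[≠] 0) (𝓝 0) :=
        tendsto_id.mono_left nhdsWithin_le_nhds
      simpa using h3.mul (hlim v)
    refine tendsto_nhds_unique (h1.congr' ?_) h2
    filter_upwards [self_mem_nhdsWithin] with s hs
    have hs : s ≠ 0 := hs
    rw [eq_add_hadamardQuot hQ v s, hQ0, smul_eq_mul]
    field_simp
    ring
  have hQK : ∀ v s, Q (v, s) = s ^ 2 * hadamardQuot (hadamardQuot Q) (v, s) := fun v s => by
    rw [eq_add_hadamardQuot hQ v s, hQ0, eq_add_hadamardQuot hA v s, hA0]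
    simp only [smul_eq_mul]; ring
  have hK0 : ∀ v : ℝ × ℝ, hadamardQuot (hadamardQuot Q) (v, 0) = (v.1 ^ 2 + v.2 ^ 2) / 2 :=
    fun v => by
    have h1 : Tendsto (fun s => hadamardQuot (hadamardQuot Q) (v, s)) (𝓝[≠] 0)
        (𝓝 (hadamardQuot (hadamardQuot Q) (v, 0))) :=
      ((hK.continuous.comp (Continuous.prodMk_right v)).tendsto 0).mono_left nhdsWithin_le_nhds
    refine tendsto_nhds_unique (h1.congr' ?_) (hlim v)
    filter_upwards [self_mem_nhdsWithin] with s hs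
    have hs : s ≠ 0 := hs
    rw [hQK]
    field_simp
  set K := hadamardQuot (hadamardQuot Q)
  have hdK : Differentiable ℝ K := hK.differentiable (by simp)
  have hpar : ∀ (v w : ℝ × ℝ) (s : ℝ), HasDerivAt (fun τ : ℝ => K (v + τ • w, s))
      (fderiv ℝ K (v, s) (w, 0)) 0 := fun v w s => by
    have h1 : HasFDerivAt K (fderiv ℝ K (v, s)) (v + (0 : ℝ) • w, s) := by
      simpa using (hdK (v, s)).hasFDerivAt
    have h2 : HasDerivAt (fun τ : ℝ => (v + τ • w, s)) (w, 0) 0 := by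
      have h3 := ((hasDerivAt_id (0 : ℝ)).smul_const w).const_add v
      rw [one_smul] at h3
      exact h3.prodMk (hasDerivAt_const _ _)
    exact h1.comp_hasDerivAt 0 h2
  have hne : ∀ v s w, s ≠ 0 → fderiv ℝ H₀ (s • v) w = s * fderiv ℝ K (v, s) (w, 0) :=
    fun v s w hs => by
    have h1 : HasDerivAt (fun τ : ℝ => H₀ (s • (v + τ • w))) (fderiv ℝ H₀ (s • v) (s • w)) 0 := by
      have h2 : HasFDerivAt H₀ (fderiv ℝ H₀ (s • v)) (s • (v + (0 : ℝ) • w)) := by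
        simpa using (hc.differentiable (s • v)).hasFDerivAt
      have h3 := (((hasDerivAt_id (0 : ℝ)).smul_const w).const_add v).const_smul s
      rw [one_smul] at h3
      exact h2.comp_hasDerivAt 0 h3
    have h2 : HasDerivAt (fun τ : ℝ => H₀ (s • (v + τ • w)))
        (s ^ 2 * fderiv ℝ K (v, s) (w, 0)) 0 := by
      have h3 := (hpar v w s).const_mul (s ^ 2)
      refine h3.congr_of_eventuallyEq (Eventually.of_forall fun τ => ?_)
      exact hQK _ _
    have h3 := h1.unique h2
    rw [map_smul, smul_eq_mul] at h3
    apply mul_left_cancel₀ hs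
    rw [h3]; ring
  refine ⟨K, hK, hQK, hK0, fun v s w => ?_, fun v w => ?_⟩
  -- At `s = 0` the formula follows from the case `s ≠ 0` by continuity of both sides.
  · rcases eq_or_ne s 0 with rfl | hs
    · have hc1 : Continuous fun s : ℝ => fderiv ℝ H₀ (s • v) w :=
        ((hc.smooth.continuous_fderiv (by simp)).comp (by fun_prop)).clm_apply continuous_const
      have hc2 : Continuous fun s : ℝ => s * fderiv ℝ K (v, s) (w, 0) :=
        continuous_id.mul (((hK.continuous_fderiv (by simp)).comp
          (Continuous.prodMk_right v)).clm_apply continuous_const)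
      have h1 := (hc1.tendsto 0).mono_left (nhdsWithin_le_nhds (s := {0}ᶜ))
      have h2 := (hc2.tendsto 0).mono_left (nhdsWithin_le_nhds (s := {0}ᶜ))
      refine tendsto_nhds_unique (h1.congr' ?_) h2
      filter_upwards [self_mem_nhdsWithin] with s hs
      exact hne v s w hs
    · exact hne v s w hs
  · refine (hpar v w 0).unique ?_
    have h1 : (fun τ : ℝ => K (v + τ • w, 0)) =
        fun τ => ((v.1 + τ * w.1) ^ 2 + (v.2 + τ * w.2) ^ 2) / 2 := funext fun τ => hK0 _
    rw [h1]
    have h2 : ∀ a b : ℝ, HasDerivAt (fun τ : ℝ => (a + τ * b) ^ 2) (2 * a * b) 0 := fun a b => by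
      have := (((hasDerivAt_id (0 : ℝ)).mul_const b).const_add a).fun_pow 2
      simpa using this
    have h3 := ((h2 v.1 w.1).fun_add (h2 v.2 w.2)).div_const 2
    rwa [show (2 * v.1 * w.1 + 2 * v.2 * w.2) / 2 = v.1 * w.1 + v.2 * w.2 by ring] at h3

end IsCenter
end Center

/-! ### The cut-off Hamiltonian flow, flow boxes and minimal periods -/

section HamiltonianFlow

/-- The Hamiltonian vector field `(∂_y H₀, -∂_x H₀)`. -/
def hamField (H₀ : ℝ × ℝ → ℝ) (p : ℝ × ℝ) : ℝ × ℝ := (partialY H₀ p, -partialX H₀ p)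

/-- `Φ` is a global flow that preserves `H₀` and is the Hamiltonian flow in the ball of
radius `R`. -/
structure IsHamFlow (H₀ : ℝ × ℝ → ℝ) (R : ℝ) (Φ : ℝ × (ℝ × ℝ) → ℝ × ℝ) : Prop where
  smooth : ContDiff ℝ ∞ Φ
  map_zero : ∀ p, Φ (0, p) = p
  map_add : ∀ s t p, Φ (s + t, p) = Φ (s, Φ (t, p))
  energy : ∀ t p, H₀ (Φ (t, p)) = H₀ p
  origin : fderiv ℝ H₀ 0 = 0 → ∀ t, Φ (t, 0) = 0
  hasDerivAt : ∀ t p, ‖Φ (t, p)‖ < R → HasDerivAt (fun t => Φ (t, p)) (hamField H₀ (Φ (t, p))) t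

/-- The field is multiplied by a bump function equal to `1` on the ball of radius `R`. A scalar
multiple of the Hamiltonian field is still tangent to the levels, so energy is conserved everywhere,
also where the cut-off acts. -/
theorem exists_hamFlow {H₀ : ℝ × ℝ → ℝ} (hH : ContDiff ℝ ∞ H₀) {R : ℝ} (hR : 0 < R) :
    ∃ Φ, IsHamFlow H₀ R Φ := by
  let χ : ContDiffBump (0 : ℝ × ℝ) := ⟨R, R + 1, hR, by linarith⟩
  have hd : Differentiable ℝ H₀ := hH.differentiable (by simp)
  have hf : ContDiff ℝ ∞ fun p => χ p • hamField H₀ p :=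
    χ.contDiff.smul ((contDiff_partialY hH).prodMk (contDiff_partialX hH).neg)
  obtain ⟨Φ, hΦ, h0, hder, hadd, K, hL⟩ := exists_contDiff_flow hf
    (χ.hasCompactSupport.smul_right)
  have hE : ∀ t p, H₀ (Φ (t, p)) = H₀ p := fun t p => by
    have h1 : ∀ t, HasDerivAt (fun t => H₀ (Φ (t, p))) 0 t := fun t => by
      have h2 := (hd (Φ (t, p))).hasFDerivAt.comp_hasDerivAt t (hder t p)
      rw [fderiv_apply_eq_partial (hd _)] at h2
      have h3 : partialX H₀ (Φ (t, p)) * (χ (Φ (t, p)) • hamField H₀ (Φ (t, p))).1 +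
          partialY H₀ (Φ (t, p)) * (χ (Φ (t, p)) • hamField H₀ (Φ (t, p))).2 = 0 := by
        simp only [hamField, Prod.smul_fst, Prod.smul_snd, smul_eq_mul]; ring
      rwa [h3] at h2
    have h2 := is_const_of_deriv_eq_zero (fun t => (h1 t).differentiableAt)
      (fun t => (h1 t).deriv) t 0
    simp only [h0] at h2
    exact h2
  refine ⟨Φ, hΦ, h0, hadd, hE, fun hz t => ?_, fun t p hp => ?_⟩
  · have hz' : hamField H₀ 0 = 0 := by
      rw [hamField, partialX_eq_fderiv (hd _), partialY_eq_fderiv (hd _), hz]; simp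
    have h := ODE_solution_unique_univ (v := fun _ p => χ p • hamField H₀ p)
      (s := fun _ => Set.univ) (K := K)
      (f := fun t => Φ (t, 0)) (g := fun _ => (0 : ℝ × ℝ)) (t₀ := 0)
      (fun _ => hL.lipschitzOnWith) (fun s => ⟨hder s 0, trivial⟩)
      (fun s => ⟨by rw [hz', smul_zero]; exact hasDerivAt_const _ _, trivial⟩) (h0 0)
    exact congrFun h t
  · have h1 := hder t p
    rw [χ.one_of_mem_closedBall (by simpa using hp.le), one_smul] at h1
    exact h1

/-- The linear automorphism of the plane with columns `u`, `v`. -/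
theorem exists_equiv_of_det_ne_zero (u v : ℝ × ℝ) (h : u.1 * v.2 - v.1 * u.2 ≠ 0) :
    ∃ L : (ℝ × ℝ) ≃L[ℝ] ℝ × ℝ, ∀ a b, L (a, b) = a • u + b • v := by
  set d := u.1 * v.2 - v.1 * u.2 with hd
  let f : (ℝ × ℝ) →L[ℝ] ℝ × ℝ :=
    (ContinuousLinearMap.fst ℝ ℝ ℝ).smulRight u + (ContinuousLinearMap.snd ℝ ℝ ℝ).smulRight v
  let g : (ℝ × ℝ) →L[ℝ] ℝ × ℝ :=
    (ContinuousLinearMap.fst ℝ ℝ ℝ).smulRight (v.2 / d, -u.2 / d) +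
      (ContinuousLinearMap.snd ℝ ℝ ℝ).smulRight (-v.1 / d, u.1 / d)
  refine ⟨ContinuousLinearEquiv.equivOfInverse f g (fun x => ?_) (fun x => ?_), fun a b => rfl⟩
  · ext <;> simp [f, g] <;> field_simp <;> rw [hd] <;> ring
  · ext <;> simp [f, g] <;> field_simp <;> rw [hd] <;> ring

namespace IsHamFlow

variable {H₀ : ℝ × ℝ → ℝ} {R : ℝ} {Φ : ℝ × (ℝ × ℝ) → ℝ × ℝ}

theorem neg_apply (hΦ : IsHamFlow H₀ R Φ) (t : ℝ) (p : ℝ × ℝ) : Φ (-t, Φ (t, p)) = p := by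
  rw [← hΦ.map_add, neg_add_cancel, hΦ.map_zero]

/-- Flow box around a regular point: a time function, smooth near `p`. -/
theorem exists_flowBox (hΦ : IsHamFlow H₀ R Φ) (hH : ContDiff ℝ ∞ H₀) {p : ℝ × ℝ}
    (hpR : ‖p‖ < R) (hp : fderiv ℝ H₀ p ≠ 0) :
    ∃ T : ℝ × ℝ → ℝ, ContDiffAt ℝ ∞ T p ∧ T p = 0 ∧
      (∀ᶠ z : (ℝ × ℝ) × (ℝ × ℝ) in 𝓝 (p, p), H₀ z.1 = H₀ z.2 → z.2 = Φ (T z.2 - T z.1, z.1)) ∧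
      ∀ᶠ z : ℝ × (ℝ × ℝ) in 𝓝 (0, p), T (Φ z) = T z.2 + z.1 := by
  have hd : Differentiable ℝ H₀ := hH.differentiable (by simp)
  set a := partialX H₀ p with ha
  set b := partialY H₀ p with hb
  have hab : a ^ 2 + b ^ 2 ≠ 0 := fun h => by
    have h1 : a = 0 := by nlinarith [sq_nonneg a, sq_nonneg b]
    have h2 : b = 0 := by nlinarith [sq_nonneg a, sq_nonneg b]
    apply hp
    ext <;> simp [fderiv_apply_eq_partial (hd p), ← ha, ← hb, h1, h2]
  -- Flow-box coordinates: start on the segment through `p` in the gradient direction and flow. At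
  -- the origin the columns of the derivative are the Hamiltonian field and the gradient, with
  -- determinant `a² + b²`. The time function is the first component of the local inverse.
  let Z : ℝ × ℝ → ℝ × ℝ := fun w => Φ (w.1, p + w.2 • (a, b))
  have hZ : ContDiff ℝ ∞ Z := hΦ.smooth.comp (by fun_prop)
  have hZ0 : Z (0, 0) = p := by simp [Z, hΦ.map_zero]
  obtain ⟨L, hL⟩ := exists_equiv_of_det_ne_zero (hamField H₀ p) (a, b) (by
    simp only [hamField, ← ha, ← hb]
    intro h; apply hab; linarith)
  have hdZ : fderiv ℝ Z (0, 0) = L := by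
    have h1 : HasDerivAt (fun t => Z (t, 0)) (fderiv ℝ Z (0, 0) (1, 0)) 0 :=
      ((hZ.differentiable (by simp) _).hasFDerivAt).comp_hasDerivAt 0
        ((hasDerivAt_id (0 : ℝ)).prodMk (hasDerivAt_const _ _))
    have h2 : HasDerivAt (fun t => Z (t, 0)) (hamField H₀ p) 0 := by
      have := hΦ.hasDerivAt 0 p (by rwa [hΦ.map_zero])
      rw [hΦ.map_zero] at this
      have h9 : (fun t => Z (t, 0)) = fun t => Φ (t, p) := funext fun t => by
        change Φ (t, p + (0 : ℝ) • (a, b)) = _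
        rw [zero_smul, add_zero]
      rwa [h9]
    have h3 : HasDerivAt (fun l => Z (0, l)) (fderiv ℝ Z (0, 0) (0, 1)) 0 :=
      ((hZ.differentiable (by simp) _).hasFDerivAt).comp_hasDerivAt 0
        ((hasDerivAt_const _ _).prodMk (hasDerivAt_id (0 : ℝ)))
    have h4 : HasDerivAt (fun l => Z (0, l)) (a, b) 0 := by
      simp only [Z, hΦ.map_zero]
      have := ((hasDerivAt_id (0 : ℝ)).smul_const (a, b)).const_add p
      rwa [one_smul] at this
    have h5 := h1.unique h2
    have h6 := h3.unique h4
    refine ContinuousLinearMap.ext fun w => ?_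
    have h7 : w = w.1 • ((1 : ℝ), (0 : ℝ)) + w.2 • ((0 : ℝ), (1 : ℝ)) := by ext <;> simp
    have h8 := hL w.1 w.2
    rw [ContinuousLinearEquiv.coe_coe]
    conv_lhs => rw [h7]
    rw [_root_.map_add, map_smul, map_smul, h5, h6]
    exact h8.symm
  have hZ' : HasFDerivAt Z (L : (ℝ × ℝ) →L[ℝ] ℝ × ℝ) (0, 0) := by
    rw [← hdZ]; exact (hZ.differentiable (by simp) _).hasFDerivAt
  have hn : (∞ : WithTop ℕ∞) ≠ 0 := by simp
  have hs : HasStrictFDerivAt Z (L : (ℝ × ℝ) →L[ℝ] ℝ × ℝ) (0, 0) :=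
    hZ.contDiffAt.hasStrictFDerivAt' hZ' hn
  let W : ℝ × ℝ → ℝ × ℝ := hZ.contDiffAt.localInverse hZ' hn
  have hW : ContDiffAt ℝ ∞ W p := by
    have := hZ.contDiffAt.to_localInverse hZ' hn
    rwa [hZ0] at this
  have hWp : W p = (0, 0) := by
    have := hZ.contDiffAt.localInverse_apply_image hZ' hn
    rwa [hZ0] at this
  have hleft : ∀ᶠ w in 𝓝 ((0 : ℝ), (0 : ℝ)), W (Z w) = w := hs.eventually_left_inverse
  have hright : ∀ᶠ q in 𝓝 p, Z (W q) = q := by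
    have := hs.eventually_right_inverse
    rwa [hZ0] at this
  -- Energy has nonzero derivative along the gradient segment, so near `p` two points of equal
  -- energy start from the same point of the segment and differ only by flow time.
  have hinj : ∀ᶠ l : ℝ × ℝ in 𝓝 (0, 0),
      H₀ (p + l.1 • (a, b)) = H₀ (p + l.2 • (a, b)) → l.1 = l.2 := by
    let η : ℝ → ℝ := fun l => H₀ (p + l • (a, b))
    have hη : ContDiff ℝ ∞ η := hH.comp (by fun_prop)
    have h1 : HasStrictDerivAt η (deriv η 0) 0 := hη.contDiffAt.hasStrictDerivAt hn
    have h2 : HasDerivAt η (a ^ 2 + b ^ 2) 0 := by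
      have h3 : HasFDerivAt H₀ (fderiv ℝ H₀ p) (p + (0 : ℝ) • (a, b)) := by
        simpa using (hd p).hasFDerivAt
      have h4 := ((hasDerivAt_id (0 : ℝ)).smul_const (a, b)).const_add p
      have h5 := h3.comp_hasDerivAt 0 h4
      rw [one_smul, fderiv_apply_eq_partial (hd p)] at h5
      have h6 : a ^ 2 + b ^ 2 = a * a + b * b := by ring
      rw [h6]
      exact h5
    have h6 : HasStrictFDerivAt η (ContinuousLinearEquiv.unitsEquivAut ℝ
        (Units.mk0 (a ^ 2 + b ^ 2) hab) : ℝ →L[ℝ] ℝ) 0 := by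
      rw [h2.deriv] at h1
      exact h1.hasStrictFDerivAt_equiv hab
    have h7 := h6.eventually_left_inverse
    rw [nhds_prod_eq]
    filter_upwards [h7.prod_mk h7] with l hl h
    rw [← hl.1, ← hl.2]
    exact congrArg _ h
  refine ⟨fun q => (W q).1, contDiff_fst.contDiffAt.comp p hW, by simp [hWp], ?_, ?_⟩
  · have h1 : Tendsto (fun z : (ℝ × ℝ) × (ℝ × ℝ) => ((W z.1).2, (W z.2).2)) (𝓝 (p, p))
        (𝓝 (0, 0)) := by
      have h2 : ContinuousAt (fun z : (ℝ × ℝ) × (ℝ × ℝ) => W z.1) (p, p) :=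
        hW.continuousAt.comp_of_eq (by fun_prop) rfl
      have h3 : ContinuousAt (fun z : (ℝ × ℝ) × (ℝ × ℝ) => W z.2) (p, p) :=
        hW.continuousAt.comp_of_eq (by fun_prop) rfl
      simpa [ContinuousAt, hWp] using h2.snd.prodMk h3.snd
    have h3 : ∀ᶠ z : (ℝ × ℝ) × (ℝ × ℝ) in 𝓝 (p, p), Z (W z.1) = z.1 ∧ Z (W z.2) = z.2 := by
      rw [nhds_prod_eq]; exact hright.prod_mk hright
    filter_upwards [h1.eventually hinj, h3] with z h4 h5 h6
    have h7 : (W z.1).2 = (W z.2).2 := by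
      apply h4
      have h8 := hΦ.energy (W z.1).1 (p + (W z.1).2 • (a, b))
      have h9 := hΦ.energy (W z.2).1 (p + (W z.2).2 • (a, b))
      rw [← h8, ← h9]
      exact (congrArg H₀ h5.1).trans (h6.trans (congrArg H₀ h5.2).symm)
    conv_lhs => rw [← h5.2]
    conv_rhs => rw [← h5.1]
    simp only [Z, ← hΦ.map_add, h7]
    congr 2
    have h8 := h5.1
    simp only [Z, h7] at h8
    rw [h8]; ring
  · have hc : Tendsto (fun z : ℝ × (ℝ × ℝ) => (z.1 + (W z.2).1, (W z.2).2)) (𝓝 (0, p))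
        (𝓝 (0, 0)) := by
      have h1 : ContinuousAt (fun z : ℝ × (ℝ × ℝ) => W z.2) (0, p) :=
        hW.continuousAt.comp_of_eq (by fun_prop) rfl
      have h2 : ContinuousAt (fun z : ℝ × (ℝ × ℝ) => (z.1 + (W z.2).1, (W z.2).2)) (0, p) :=
        (continuousAt_fst.add h1.fst).prodMk h1.snd
      simpa [ContinuousAt, hWp] using h2
    have hr : ∀ᶠ z : ℝ × (ℝ × ℝ) in 𝓝 (0, p), Z (W z.2) = z.2 :=
      (continuous_snd.tendsto ((0 : ℝ), p)).eventually hright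
    filter_upwards [hc.eventually hleft, hr] with z h1 h2
    have h3 : Φ z = Z (z.1 + (W z.2).1, (W z.2).2) := by
      simp only [Z, hΦ.map_add]
      simp only [Z] at h2
      rw [h2]
    rw [h3, h1, add_comm]

/-- `T` is the minimal period of the orbit of `p`. -/
def _root_.AsympHam.IsMinPeriod (Φ : ℝ × (ℝ × ℝ) → ℝ × ℝ) (p : ℝ × ℝ) (T : ℝ) : Prop :=
  0 < T ∧ Φ (T, p) = p ∧ ∀ t ∈ Set.Ioo 0 T, Φ (t, p) ≠ p

end IsHamFlow

theorem IsMinPeriod.unique {Φ : ℝ × (ℝ × ℝ) → ℝ × ℝ} {p : ℝ × ℝ} {T T' : ℝ}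
    (h : IsMinPeriod Φ p T) (h' : IsMinPeriod Φ p T') : T = T' := by
  rcases lt_trichotomy T T' with h1 | h1 | h1
  · exact absurd h.2.1 (h'.2.2 T ⟨h.1, h1⟩)
  · exact h1
  · exact absurd h'.2.1 (h.2.2 T' ⟨h'.1, h1⟩)

/-- A return time which is minimal at a point remains minimal nearby. -/
theorem eventually_minimal_return {X Y : Type} [TopologicalSpace X] [TopologicalSpace Y]
    [T2Space Y] {Ξ : ℝ × X → Y} (hΞ : Continuous Ξ) {x₀ : X} {T : ℝ}
    (hsmall : ∀ᶠ z : ℝ × X in 𝓝 (0, x₀), Ξ z = Ξ (0, z.2) → z.1 = 0)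
    (hmin : ∀ t ∈ Set.Ioo 0 T, Ξ (t, x₀) ≠ Ξ (0, x₀)) {τ : X → ℝ} (hτ : ContinuousAt τ x₀)
    (hτ0 : τ x₀ = T) :
    ∀ᶠ x in 𝓝 x₀, (∀ t, Ξ (t, x) = Ξ (0, x) → Ξ (τ x - t, x) = Ξ (0, x)) →
      ∀ t ∈ Set.Ioo 0 (τ x), Ξ (t, x) ≠ Ξ (0, x) := by
  rw [nhds_prod_eq] at hsmall
  obtain ⟨pa, hpa, pb, hpb, hs⟩ := eventually_prod_iff.1 hsmall
  obtain ⟨η, hη, hηp⟩ := Metric.eventually_nhds_iff.1 hpa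
  have hcpt : IsCompact (Set.Icc (η / 2) (T - η / 2)) := isCompact_Icc
  have hopen : IsOpen {z : ℝ × X | Ξ z ≠ Ξ (0, z.2)} :=
    isOpen_ne_fun hΞ (hΞ.comp (by fun_prop))
  -- Returns near time `0` are excluded by `hsmall`. Times from `η / 2` to `T - η / 2` form a
  -- compact interval without returns at `x₀`, and the tube lemma extends this to nearby points.
  have hmid : ∀ᶠ x in 𝓝 x₀, ∀ t ∈ Set.Icc (η / 2) (T - η / 2), Ξ (t, x) ≠ Ξ (0, x) := by
    obtain ⟨u, v, -, hv, hu, hxv, huv⟩ := generalized_tube_lemma hcpt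
      (isCompact_singleton (x := x₀)) hopen (by
        rintro ⟨t, x⟩ ⟨ht, rfl⟩
        exact hmin t ⟨by linarith [ht.1], by linarith [ht.2]⟩)
    filter_upwards [hv.mem_nhds (hxv rfl)] with x hx t ht
    exact huv (Set.mk_mem_prod (hu ht) hx)
  have hτ1 : ∀ᶠ x in 𝓝 x₀, τ x < T + η / 2 := by
    refine hτ.eventually (gt_mem_nhds ?_)
    rw [hτ0]; linarith
  filter_upwards [hmid, hτ1, hpb] with x h1 h2 h3 hrev t ht heq
  have hno : ∀ t, 0 < t → t < η → Ξ (t, x) ≠ Ξ (0, x) := fun t ht0 htη h => by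
    have := hs (hηp (by rw [Real.dist_eq, sub_zero, abs_of_pos ht0]; exact htη)) h3 h
    simp only at this
    linarith
  rcases lt_or_ge t (η / 2) with h4 | h4
  · exact hno t ht.1 (by linarith) heq
  · rcases le_or_gt t (T - η / 2) with h5 | h5
    · exact h1 t ⟨h4, h5⟩ heq
    -- A return shortly before `τ x` would give, by subtraction, a return shortly after `0`.
    · exact hno (τ x - t) (by linarith [ht.2]) (by linarith) (hrev t heq)

namespace IsHamFlow

variable {H₀ : ℝ × ℝ → ℝ} {R : ℝ} {Φ : ℝ × (ℝ × ℝ) → ℝ × ℝ}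

theorem return_sub (hΦ : IsHamFlow H₀ R Φ) {p : ℝ × ℝ} {T t : ℝ} (hT : Φ (T, p) = p)
    (ht : Φ (t, p) = p) : Φ (T - t, p) = p := by
  have : Φ (T - t, Φ (t, p)) = p := by rw [← hΦ.map_add, sub_add_cancel, hT]
  rwa [ht] at this

theorem eventually_no_small_return (hΦ : IsHamFlow H₀ R Φ) (hH : ContDiff ℝ ∞ H₀) {p : ℝ × ℝ}
    (hpR : ‖p‖ < R) (hp : fderiv ℝ H₀ p ≠ 0) :
    ∀ᶠ z : ℝ × (ℝ × ℝ) in 𝓝 (0, p), Φ z = z.2 → z.1 = 0 := by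
  obtain ⟨T, -, -, -, h⟩ := hΦ.exists_flowBox hH hpR hp
  filter_upwards [h] with z h1 h2
  rw [h2] at h1
  linarith

/-- The minimal period is a smooth function near a regular periodic point. -/
theorem exists_period_near (hΦ : IsHamFlow H₀ R Φ) (hH : ContDiff ℝ ∞ H₀) {p : ℝ × ℝ}
    (hpR : ‖p‖ < R) (hp : fderiv ℝ H₀ p ≠ 0) {T₀ : ℝ} (hT : IsMinPeriod Φ p T₀) :
    ∃ τ : ℝ × ℝ → ℝ, ContDiffAt ℝ ∞ τ p ∧ ∀ᶠ q in 𝓝 p, IsMinPeriod Φ q (τ q) := by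
  obtain ⟨T, hTs, hTp, h1, h2⟩ := hΦ.exists_flowBox hH hpR hp
  let ρ : ℝ × ℝ → ℝ × ℝ := fun q => Φ (T₀, q)
  have hρ : ContDiff ℝ ∞ ρ := hΦ.smooth.comp (by fun_prop)
  have hρp : ρ p = p := hT.2.1
  -- After time `T₀` the point `q` is back near `p` on its own level, displaced along the flow by `T
  -- (ρ q) - T q`; subtracting this delay closes the orbit exactly.
  let τ : ℝ × ℝ → ℝ := fun q => T₀ - (T (ρ q) - T q)
  have hτ : ContDiffAt ℝ ∞ τ p := by
    refine contDiffAt_const.sub (ContDiffAt.sub ?_ hTs)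
    refine ContDiffAt.comp p (g := T) ?_ hρ.contDiffAt
    rwa [hρp]
  have hτp : τ p = T₀ := by simp [τ, hρp]
  have hret : ∀ᶠ q in 𝓝 p, Φ (τ q, q) = q := by
    have hc : Tendsto (fun q => (q, ρ q)) (𝓝 p) (𝓝 (p, p)) := by
      have : ContinuousAt (fun q => (q, ρ q)) p := continuousAt_id.prodMk hρ.continuous.continuousAt
      simpa [ContinuousAt, hρp] using this
    filter_upwards [hc.eventually h1] with q hq
    have h3 := hq (hΦ.energy T₀ q).symm
    have h4 : Φ (τ q, q) = Φ (-(T (ρ q) - T q), ρ q) := by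
      rw [← hΦ.map_add]; congr 2; simp only [τ]; ring
    rw [h4]
    exact (congrArg (fun z => Φ (-(T (ρ q) - T q), z)) h3).trans (hΦ.neg_apply _ _)
  have hpos : ∀ᶠ q in 𝓝 p, 0 < τ q :=
    hτ.continuousAt.eventually (lt_mem_nhds (by rw [hτp]; exact hT.1))
  have hmin := eventually_minimal_return (Ξ := Φ) hΦ.smooth.continuous (x₀ := p) (T := T₀)
    (by simpa only [hΦ.map_zero] using hΦ.eventually_no_small_return hH hpR hp)
    (by simpa only [hΦ.map_zero] using hT.2.2) hτ.continuousAt hτp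
  refine ⟨τ, hτ, ?_⟩
  filter_upwards [hret, hpos, hmin] with q h3 h4 h5
  simp only [hΦ.map_zero] at h5
  exact ⟨h4, h3, h5 fun t ht => hΦ.return_sub h3 ht⟩

theorem return_iff (hΦ : IsHamFlow H₀ R Φ) {p : ℝ × ℝ} {T t : ℝ} (hT : IsMinPeriod Φ p T) :
    Φ (t, p) = p ↔ ∃ n : ℤ, t = n * T := by
  have hnat : ∀ n : ℕ, Φ (n * T, p) = p := fun n => by
    induction n with
    | zero => simp [hΦ.map_zero]
    | succ n ih => rw [Nat.cast_succ, add_mul, one_mul, hΦ.map_add, hT.2.1, ih]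
  have hint : ∀ n : ℤ, Φ (n * T, p) = p := fun n => by
    obtain ⟨m, rfl | rfl⟩ := n.eq_nat_or_neg
    · exact_mod_cast hnat m
    · have := hΦ.return_sub (hΦ.map_zero p) (hnat m)
      rw [Int.cast_neg, neg_mul]
      simpa using this
  constructor
  · intro h
    refine ⟨⌊t / T⌋, ?_⟩
    have h1 := hΦ.return_sub h (hint ⌊t / T⌋)
    by_contra hne
    have h2 : (⌊t / T⌋ : ℝ) * T ≤ t := (le_div_iff₀ hT.1).1 (Int.floor_le _)
    have h3 : t < (⌊t / T⌋ + 1) * T := (div_lt_iff₀ hT.1).1 (Int.lt_floor_add_one _)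
    refine hT.2.2 _ ⟨?_, ?_⟩ h1
    · exact sub_pos.2 (lt_of_le_of_ne h2 (Ne.symm hne))
    · linarith
  · rintro ⟨n, rfl⟩
    exact hint n

/-- Recurrence in a compact orbit-closed set of regular points gives a minimal period. -/
theorem exists_isMinPeriod (hΦ : IsHamFlow H₀ R Φ) (hH : ContDiff ℝ ∞ H₀) {S : Set (ℝ × ℝ)}
    (hS : IsCompact S) (hreg : ∀ p ∈ S, ‖p‖ < R ∧ fderiv ℝ H₀ p ≠ 0)
    (hinv : ∀ p ∈ S, ∀ t, Φ (t, p) ∈ S) {p : ℝ × ℝ} (hp : p ∈ S) :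
    ∃ T, IsMinPeriod Φ p T := by
  have hper : ∃ t, 0 < t ∧ Φ (t, p) = p := by
    -- Two late terms of a convergent subsequence of `Φ (n, p)` lie in one flow box on the same
    -- level. They differ by a flow time below `1/2` in absolute value, whereas their indices differ
    -- by at least `1`, so a positive time is left over as a period.
    obtain ⟨q, hq, φ, hφ, hlim⟩ := hS.tendsto_subseq (x := fun n : ℕ => Φ ((n : ℝ), p))
      fun n => hinv p hp n
    obtain ⟨T, hTs, hTq, h1, -⟩ := hΦ.exists_flowBox hH (hreg q hq).1 (hreg q hq).2
    have h2 : ∀ᶠ z in 𝓝 q, |T z| < 1 / 4 := by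
      have := hTs.continuousAt.abs
      rw [ContinuousAt, hTq, abs_zero] at this
      exact this.eventually (gt_mem_nhds (by norm_num))
    have h3 : ∀ᶠ w : ℕ × ℕ in atTop ×ˢ atTop,
        Φ ((φ w.2 : ℝ), p) = Φ (T (Φ ((φ w.2 : ℝ), p)) - T (Φ ((φ w.1 : ℝ), p)),
          Φ ((φ w.1 : ℝ), p)) ∧ |T (Φ ((φ w.1 : ℝ), p))| < 1 / 4 ∧
          |T (Φ ((φ w.2 : ℝ), p))| < 1 / 4 := by
      have h4 := (hlim.prodMap hlim)
      rw [← nhds_prod_eq] at h4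
      have h5 := hlim.eventually h2
      filter_upwards [h4.eventually h1, h5.prod_mk h5] with w h6 h7
      exact ⟨h6 (by simp [hΦ.energy]), h7⟩
    rw [prod_atTop_atTop_eq] at h3
    obtain ⟨⟨n, m⟩, hN⟩ := eventually_atTop.1 h3
    obtain ⟨h4, h5, h6⟩ := hN (max n m, max n m + 1)
      ⟨le_max_left _ _, (le_max_right _ _).trans (Nat.le_succ _)⟩
    set N := max n m
    simp only at h4 h5 h6
    set a := T (Φ ((φ N : ℝ), p))
    set b := T (Φ ((φ (N + 1) : ℝ), p))
    have h7 : (φ N : ℝ) + 1 ≤ φ (N + 1) := by exact_mod_cast hφ (Nat.lt_succ_self N)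
    rw [abs_lt] at h5 h6
    refine ⟨φ (N + 1) - (b - a) - φ N, by linarith [h5.1, h6.2], ?_⟩
    rw [← hΦ.map_add] at h4
    have h8 := congrArg (fun z => Φ (-((b - a) + φ N), z)) h4
    simp only [hΦ.neg_apply] at h8
    rw [← hΦ.map_add] at h8
    conv_rhs => rw [← h8]
    congr 2; ring
  obtain ⟨t₁, ht₁, hret₁⟩ := hper
  let P : Set ℝ := {t | 0 < t ∧ Φ (t, p) = p}
  have hbdd : BddBelow P := ⟨0, fun t ht => ht.1.le⟩
  have hsm := hΦ.eventually_no_small_return hH (hreg p hp).1 (hreg p hp).2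
  -- The flow box bounds the periods away from zero, so the set of positive periods is closed and
  -- contains its infimum.
  obtain ⟨η, hη, hηs⟩ : ∃ η > 0, ∀ t ∈ P, η ≤ t := by
    have h1 : ∀ᶠ t in 𝓝 (0 : ℝ), Φ (t, p) = p → t = 0 := by
      have h2 : Tendsto (fun t : ℝ => (t, p)) (𝓝 0) (𝓝 (0, p)) :=
        (by fun_prop : Continuous fun t : ℝ => (t, p)).tendsto 0
      exact h2.eventually hsm
    obtain ⟨η, hη, h2⟩ := Metric.eventually_nhds_iff.1 h1
    refine ⟨η, hη, fun t ht => ?_⟩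
    by_contra hlt
    have := h2 (y := t) (by rw [Real.dist_eq, sub_zero, abs_of_pos ht.1]; exact not_le.1 hlt) ht.2
    exact ht.1.ne' this
  have hcl : IsClosed (P) := by
    have : P = {t | η ≤ t ∧ Φ (t, p) = p} := by
      ext t
      exact ⟨fun h => ⟨hηs t h, h.2⟩, fun h => ⟨hη.trans_le h.1, h.2⟩⟩
    rw [this]
    exact (isClosed_le continuous_const continuous_id).inter
      (isClosed_eq (hΦ.smooth.continuous.comp (by fun_prop)) continuous_const)
  have hmem : sInf P ∈ P := hcl.csInf_mem ⟨t₁, ht₁, hret₁⟩ hbdd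
  refine ⟨sInf P, hmem.1, hmem.2, fun t ht h => ?_⟩
  exact absurd (csInf_le hbdd (show t ∈ P from ⟨ht.1, h⟩)) (not_le.2 ht.2)

end IsHamFlow
end HamiltonianFlow

/-! ### Level curves as periodic orbits; the period near the center -/

section Orbits

namespace IsCenter

variable {E₀ : ℝ} {U : Set (ℝ × ℝ)} {H₀ : ℝ × ℝ → ℝ} {R : ℝ} {Φ : ℝ × (ℝ × ℝ) → ℝ × ℝ}

theorem fderiv_zero (hc : IsCenter E₀ U H₀) : fderiv ℝ H₀ 0 = 0 := by
  obtain ⟨K, -, -, -, h, -⟩ := hc.exists_blowup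
  ext
  · simpa using h 0 0 (1, 0)
  · simpa using h 0 0 (0, 1)

/-- The times spent in `U` form an open set because `U` is open, and a closed set because they are
the times spent on the compact level curve inside `U`. -/
theorem flow_mem (hc : IsCenter E₀ U H₀) (hΦ : IsHamFlow H₀ R Φ) {p : ℝ × ℝ} (hp : p ∈ U)
    (hE : H₀ p ∈ Set.Ioc 0 E₀) (t : ℝ) : Φ (t, p) ∈ U := by
  have hcont : Continuous fun t => Φ (t, p) := hΦ.smooth.continuous.comp (by fun_prop)
  have hclopen : IsClopen {t | Φ (t, p) ∈ U} := by
    refine ⟨?_, hc.isOpen_U.preimage hcont⟩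
    have : {t | Φ (t, p) ∈ U} = (fun t => Φ (t, p)) ⁻¹' {q | q ∈ U ∧ H₀ q = H₀ p} := by
      ext t
      exact ⟨fun h => ⟨h, hΦ.energy t p⟩, fun h => h.1⟩
    rw [this]
    exact (hc.closed_levels _ hE).isCompact.isClosed.preimage hcont
  have := hclopen.eq_univ ⟨0, by simpa [hΦ.map_zero] using hp⟩
  have h2 : t ∈ {t | Φ (t, p) ∈ U} := by rw [this]; trivial
  exact h2

/-- The flow is transitive on each level curve. -/
theorem exists_flow_eq (hc : IsCenter E₀ U H₀) (hΦ : IsHamFlow H₀ R Φ)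
    (hR : ∀ p ∈ U, H₀ p ∈ Set.Ioc 0 E₀ → ‖p‖ < R) {p q : ℝ × ℝ} (hp : p ∈ U) (hq : q ∈ U)
    (hE : H₀ p ∈ Set.Ioc 0 E₀) (hpq : H₀ p = H₀ q) : ∃ t, q = Φ (t, p) := by
  have hconn := (hc.closed_levels _ hE).isConnected.isPreconnected
  -- By the flow box, points of the level close to `x` are on the orbit of `x`; connectedness of the
  -- level then leaves a single orbit.
  refine hconn.induction₂ (fun p q => ∃ t, q = Φ (t, p)) ?_ ?_ ?_ ⟨hp, rfl⟩ ⟨hq, hpq.symm⟩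
  · rintro x ⟨hx, hxE⟩
    have hxE' : H₀ x ∈ Set.Ioc 0 E₀ := by rw [hxE]; exact hE
    obtain ⟨T, -, -, h, -⟩ := hΦ.exists_flowBox hc.smooth (hR x hx hxE')
      (hc.fderiv_ne_zero hx hxE')
    have h1 : Tendsto (fun y => (x, y)) (𝓝 x) (𝓝 (x, x)) :=
      (by fun_prop : Continuous fun y : ℝ × ℝ => (x, y)).tendsto x
    filter_upwards [(h1.eventually h).filter_mono nhdsWithin_le_nhds, self_mem_nhdsWithin]
      with y hy hyS
    exact ⟨_, hy (by rw [hxE, hyS.2])⟩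
  · rintro x y z _ _ _ ⟨s, rfl⟩ ⟨t, rfl⟩
    exact ⟨t + s, (hΦ.map_add _ _ _).symm⟩
  · rintro x y _ _ ⟨s, rfl⟩
    exact ⟨-s, (hΦ.neg_apply s x).symm⟩

theorem exists_isMinPeriod (hc : IsCenter E₀ U H₀) (hΦ : IsHamFlow H₀ R Φ)
    (hR : ∀ p ∈ U, H₀ p ∈ Set.Ioc 0 E₀ → ‖p‖ < R) {p : ℝ × ℝ} (hp : p ∈ U)
    (hE : H₀ p ∈ Set.Ioc 0 E₀) : ∃ T, IsMinPeriod Φ p T := by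
  refine hΦ.exists_isMinPeriod hc.smooth (hc.closed_levels _ hE).isCompact ?_ ?_ ⟨hp, rfl⟩
  · rintro q ⟨hq, hqE⟩
    have hq' : H₀ q ∈ Set.Ioc 0 E₀ := by rw [hqE]; exact hE
    exact ⟨hR q hq hq', hc.fderiv_ne_zero hq hq'⟩
  · rintro q ⟨hq, hqE⟩ t
    have hq' : H₀ q ∈ Set.Ioc 0 E₀ := by rw [hqE]; exact hE
    exact ⟨hc.flow_mem hΦ hq hq' t, by rw [hΦ.energy, hqE]⟩

end IsCenter

/-- Local uniqueness in the implicit function theorem, along a known branch of zeros. -/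
theorem eventually_eq_of_implicit {f : ℝ × ℝ → ℝ} (hf : ContDiff ℝ ∞ f) {x₀ y₀ : ℝ}
    (hne : fderiv ℝ f (x₀, y₀) (0, 1) ≠ 0) (h0 : ∀ x, f (x, y₀) = 0) :
    ∀ᶠ z : ℝ × ℝ in 𝓝 (x₀, y₀), f z = 0 → z.2 = y₀ := by
  have hn : (∞ : WithTop ℕ∞) ≠ 0 := by simp
  have hinv : (fderiv ℝ f (x₀, y₀) ∘L .inr ℝ ℝ ℝ).IsInvertible :=
    isInvertible_of_apply_one_ne_zero hne
  have h1 := hf.contDiffAt.eventually_apply_eq_iff_implicitFunction (u := (x₀, y₀)) hn hinv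
  have h2 : Tendsto (fun z : ℝ × ℝ => (z.1, y₀)) (𝓝 (x₀, y₀)) (𝓝 (x₀, y₀)) :=
    (by fun_prop : Continuous fun z : ℝ × ℝ => (z.1, y₀)).tendsto (x₀, y₀)
  filter_upwards [h1, h2.eventually h1] with z h3 h4 h5
  rw [← h3.1 (h5.trans (h0 _).symm)]
  exact h4.1 ((h0 _).trans (h0 _).symm)

namespace IsCenter

variable {E₀ : ℝ} {U : Set (ℝ × ℝ)} {H₀ : ℝ × ℝ → ℝ} {R : ℝ} {Φ : ℝ × (ℝ × ℝ) → ℝ × ℝ}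

/-- The flow blown up at the center: `Φ (t, (u, 0)) = u Ψ (t, u)`. -/
theorem exists_flow_blowup (hc : IsCenter E₀ U H₀) (hΦ : IsHamFlow H₀ R Φ) (hR : 0 < R) :
    ∃ Ψ : ℝ × ℝ → ℝ × ℝ, ContDiff ℝ ∞ Ψ ∧ (∀ t u, Φ (t, (u, 0)) = u • Ψ (t, u)) ∧
      (∀ u, Ψ (0, u) = (1, 0)) ∧ (∀ t, Ψ (t, 0) = (Real.cos t, -Real.sin t)) ∧
      ∀ t, HasDerivAt (fun t => Ψ (t, 0)) (-Real.sin t, -Real.cos t) t := by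
  obtain ⟨K, hK, -, -, hK1, hK2⟩ := hc.exists_blowup
  -- The origin is a rest point, so the flow of `(u, 0)` vanishes at `u = 0` and can be divided by
  -- `u`.
  let Q : ℝ × ℝ → ℝ × ℝ := fun z => Φ (z.1, (z.2, 0))
  have hQ : ContDiff ℝ ∞ Q := hΦ.smooth.comp (by fun_prop)
  have hQ0 : ∀ t, Q (t, 0) = 0 := fun t => hΦ.origin hc.fderiv_zero t
  set Ψ := hadamardQuot Q with hΨdef
  have hΨ : ContDiff ℝ ∞ Ψ := contDiff_hadamardQuot hQ
  have hQΨ : ∀ t u, Q (t, u) = u • Ψ (t, u) := fun t u => by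
    rw [eq_add_hadamardQuot hQ t u, hQ0, zero_add]
  have hdense : Dense ({0}ᶜ : Set ℝ) := dense_compl_singleton 0
  have hΨ1 : ∀ u, Ψ (0, u) = (1, 0) := by
    have h1 : Continuous fun u => Ψ (0, u) := hΨ.continuous.comp (by fun_prop)
    have h2 : (fun u => Ψ (0, u)) = fun _ => ((1 : ℝ), (0 : ℝ)) := by
      refine h1.ext_on hdense continuous_const fun u hu => ?_
      have hu : u ≠ 0 := hu
      have h3 := hQΨ 0 u
      simp only [Q, hΦ.map_zero] at h3
      have h4 := congrArg (fun z => u⁻¹ • z) h3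
      simp only [smul_smul, inv_mul_cancel₀ hu, one_smul] at h4
      simp only
      rw [← h4]
      simp [hu]
    exact congrFun h2
  have hder : ∀ t u, HasDerivAt (fun t => Ψ (t, u)) (fderiv ℝ Ψ (t, u) (1, 0)) t := fun t u =>
    ((hΨ.differentiable (by simp) _).hasFDerivAt).comp_hasDerivAt t
      ((hasDerivAt_id t).prodMk (hasDerivAt_const _ _))
  -- For `u ≠ 0` the factor `u` cancels from Hamilton's equations through `hK1`; as `u → 0` they
  -- become the linear rotation equations.
  have hfield : ∀ t, fderiv ℝ Ψ (t, 0) (1, 0) = ((Ψ (t, 0)).2, -(Ψ (t, 0)).1) := fun t => by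
    have hcK : Continuous (fderiv ℝ K) := hK.continuous_fderiv (by simp)
    have hcΨ : Continuous fun u => Ψ (t, u) := hΨ.continuous.comp (by fun_prop)
    have hc1 : Continuous fun u : ℝ => fderiv ℝ Ψ (t, u) (1, 0) :=
      ((hΨ.continuous_fderiv (by simp)).comp (by fun_prop)).clm_apply continuous_const
    have hc2 : Continuous fun u : ℝ => (fderiv ℝ K (Ψ (t, u), u) ((0, 1), 0),
        -fderiv ℝ K (Ψ (t, u), u) ((1, 0), 0)) := by
      have h3 : Continuous fun u : ℝ => fderiv ℝ K (Ψ (t, u), u) :=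
        hcK.comp (hcΨ.prodMk continuous_id)
      exact (h3.clm_apply continuous_const).prodMk (h3.clm_apply continuous_const).neg
    have h1 := (hc1.tendsto 0).mono_left (nhdsWithin_le_nhds (s := {0}ᶜ))
    have h2 := (hc2.tendsto 0).mono_left (nhdsWithin_le_nhds (s := {0}ᶜ))
    have h3 : ((Ψ (t, 0)).2, -(Ψ (t, 0)).1) = (fderiv ℝ K (Ψ (t, 0), 0) ((0, 1), 0),
        -fderiv ℝ K (Ψ (t, 0), 0) ((1, 0), 0)) := by
      rw [hK2, hK2]; simp
    rw [h3]
    refine tendsto_nhds_unique (h1.congr' ?_) h2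
    have hsmall : ∀ᶠ u in 𝓝 (0 : ℝ), ‖Q (t, u)‖ < R := by
      have h4 : Continuous fun u => ‖Q (t, u)‖ := (hQ.continuous.comp (by fun_prop)).norm
      exact (h4.tendsto 0).eventually (gt_mem_nhds (by simpa [hQ0] using hR))
    filter_upwards [hsmall.filter_mono nhdsWithin_le_nhds, self_mem_nhdsWithin] with u hu hu0
    have hu0 : u ≠ 0 := hu0
    have h4 : HasDerivAt (fun t => Q (t, u)) (u • fderiv ℝ Ψ (t, u) (1, 0)) t := by
      simp only [hQΨ]
      exact (hder t u).const_smul u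
    have h5 := h4.unique (hΦ.hasDerivAt t (u, 0) hu)
    have h6 : Φ (t, (u, 0)) = u • Ψ (t, u) := hQΨ t u
    rw [hamField, h6, partialX_eq_fderiv (hc.differentiable _),
      partialY_eq_fderiv (hc.differentiable _), hK1, hK1] at h5
    have h7 := congrArg (fun z => u⁻¹ • z) h5
    simp only [smul_smul, inv_mul_cancel₀ hu0, one_smul] at h7
    rw [h7]
    ext <;> simp [hu0]
  have hrot : ∀ t, Ψ (t, 0) = (Real.cos t, -Real.sin t) := by
    let L : (ℝ × ℝ) →L[ℝ] ℝ × ℝ :=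
      (ContinuousLinearMap.snd ℝ ℝ ℝ).prod (-ContinuousLinearMap.fst ℝ ℝ ℝ)
    have h := ODE_solution_unique_univ (v := fun _ p => L p) (s := fun _ => Set.univ)
      (K := ‖L‖₊) (f := fun t => Ψ (t, 0)) (g := fun t => (Real.cos t, -Real.sin t)) (t₀ := 0)
      (fun _ => L.lipschitz.lipschitzOnWith)
      (fun t => ⟨by
        have := hder t 0
        rw [hfield] at this
        exact this, trivial⟩)
      (fun t => ⟨(Real.hasDerivAt_cos t).prodMk (Real.hasDerivAt_sin t).neg, trivial⟩)
      (by simp [hΨ1])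
    exact congrFun h
  refine ⟨Ψ, hΨ, hQΨ, hΨ1, hrot, fun t => ?_⟩
  have := hder t 0
  rw [hfield, hrot] at this
  exact this

/-- Near the center the minimal period along the `x`-axis is smooth and tends to `2π`. -/
theorem exists_period_axis (hc : IsCenter E₀ U H₀) (hΦ : IsHamFlow H₀ R Φ) (hR : 0 < R) :
    ∃ τ : ℝ → ℝ, ContDiffAt ℝ ∞ τ 0 ∧ τ 0 = 2 * Real.pi ∧
      ∀ᶠ u in 𝓝 0, u ≠ 0 → IsMinPeriod Φ (u, 0) (τ u) := by
  obtain ⟨K, hK, hHK, hK0, -, hK2⟩ := hc.exists_blowup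
  obtain ⟨Ψ, hΨ, hΦΨ, hΨ1, hrot, hΨd⟩ := hc.exists_flow_blowup hΦ hR
  have hn : (∞ : WithTop ℕ∞) ≠ 0 := by simp
  -- Zeros of `f` are crossings of the `x`-axis. At `u = 0` one has `f = -sin t`, so the crossing
  -- near `2π` is nondegenerate and its time is a smooth implicit function of `u`.
  let f : ℝ × ℝ → ℝ := fun z => (Ψ (z.2, z.1)).2
  have hf : ContDiff ℝ ∞ f := contDiff_snd.comp (hΨ.comp (contDiff_snd.prodMk contDiff_fst))
  have hfd : ∀ t, fderiv ℝ f (0, t) (0, 1) = -Real.cos t := fun t =>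
    (hasDerivAt_snd (hf.differentiable (by simp)) 0 t).unique (hΨd t).snd
  have hsmall : ∀ᶠ z : ℝ × ℝ in 𝓝 (0, 0), f z = 0 → z.2 = 0 :=
    eventually_eq_of_implicit hf (by rw [hfd]; simp) (fun u => by simp [f, hΨ1])
  -- Conservation of energy after division by `u²`. Near `a = 1` its only solution is `a = 1`, so an
  -- axis crossing near the starting point is an exact return.
  let g : ℝ × ℝ → ℝ := fun z => K ((z.2, 0), z.1) - K ((1, 0), z.1)
  have hg : ContDiff ℝ ∞ g := by
    have h1 : ContDiff ℝ ∞ fun z : ℝ × ℝ => K ((z.2, 0), z.1) := hK.comp (by fun_prop)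
    have h2 : ContDiff ℝ ∞ fun z : ℝ × ℝ => K ((1, 0), z.1) := hK.comp (by fun_prop)
    exact h1.sub h2
  have hgd : fderiv ℝ g (0, 1) (0, 1) ≠ 0 := by
    have h1 : HasDerivAt (fun a => g (0, a)) 1 1 := by
      have h2 : (fun a => g (0, a)) = fun a => (a ^ 2 - 1) / 2 := funext fun a => by
        simp only [g, hK0]; ring
      rw [h2]
      have := ((hasDerivAt_pow 2 (1 : ℝ)).sub_const 1).div_const 2
      norm_num at this
      exact this
    rw [(hasDerivAt_snd (hg.differentiable (by simp)) 0 1).unique h1]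
    exact one_ne_zero
  have hone : ∀ᶠ z : ℝ × ℝ in 𝓝 (0, 1), g z = 0 → z.2 = 1 :=
    eventually_eq_of_implicit hg hgd (fun u => by simp [g])
  have hinv : (fderiv ℝ f (0, 2 * Real.pi) ∘L .inr ℝ ℝ ℝ).IsInvertible :=
    isInvertible_of_apply_one_ne_zero (by
      change fderiv ℝ f (0, 2 * Real.pi) (0, 1) ≠ 0
      rw [hfd]; simp)
  have hev := hf.contDiffAt.eventually_apply_implicitFunction (u := (0, 2 * Real.pi)) hn hinv
  have hsm := hf.contDiffAt.contDiffAt_implicitFunction (u := (0, 2 * Real.pi)) hn hinv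
  have hτ0 := hf.contDiffAt.implicitFunction_apply_self (u := (0, 2 * Real.pi)) hn hinv
  set τ := hf.contDiffAt.implicitFunction (u := (0, 2 * Real.pi)) hn hinv
  simp only at hτ0 hsm hev
  have hΨτ : ContinuousAt (fun u => Ψ (τ u, u)) 0 := by
    have h1 : ContinuousAt (fun u => (τ u, u)) 0 := hsm.continuousAt.prodMk continuousAt_id
    exact (hΨ.continuous.continuousAt).comp h1
  have hret : ∀ᶠ u in 𝓝 0, u ≠ 0 → Ψ (τ u, u) = (1, 0) := by
    have h1 : Tendsto (fun u => (u, (Ψ (τ u, u)).1)) (𝓝 0) (𝓝 (0, 1)) := by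
      have h2 : ContinuousAt (fun u => (u, (Ψ (τ u, u)).1)) 0 := continuousAt_id.prodMk hΨτ.fst
      simpa [ContinuousAt, hτ0, hrot] using h2
    filter_upwards [hev, h1.eventually hone] with u h2 h3 hu
    have h4 : (Ψ (τ u, u)).2 = 0 := by
      have : f (0, 2 * Real.pi) = 0 := by simp [f, hrot]
      rw [this] at h2
      exact h2
    have h5 : Ψ (τ u, u) = ((Ψ (τ u, u)).1, 0) := by rw [← h4]
    have h6 := hΦ.energy (τ u) (u, 0)
    rw [hΦΨ, hHK, show ((u, 0) : ℝ × ℝ) = u • ((1 : ℝ), (0 : ℝ)) by simp, hHK] at h6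
    have h7 := mul_left_cancel₀ (pow_ne_zero 2 hu) h6
    have h8 : (Ψ (τ u, u)).1 = 1 := by
      apply h3
      simp only [g]
      rw [← h5, h7, sub_self]
    rw [h5, h8]
  have hpos : ∀ᶠ u in 𝓝 0, 0 < τ u :=
    hsm.continuousAt.eventually (lt_mem_nhds (by rw [hτ0]; positivity))
  have hmin := eventually_minimal_return (Ξ := Ψ) hΨ.continuous (x₀ := (0 : ℝ))
    (T := 2 * Real.pi) (by
      have h1 : Tendsto (fun z : ℝ × ℝ => (z.2, z.1)) (𝓝 (0, 0)) (𝓝 (0, 0)) :=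
        (by fun_prop : Continuous fun z : ℝ × ℝ => (z.2, z.1)).tendsto (0, 0)
      filter_upwards [h1.eventually hsmall] with z h2 h3
      apply h2
      simp only [f]
      rw [h3, hΨ1])
    (fun t ht h => by
      rw [hrot, hrot, Real.cos_zero] at h
      have h1 := (Real.cos_eq_one_iff_of_lt_of_lt (by linarith [ht.1, Real.pi_pos]) ht.2).1
        (congrArg Prod.fst h)
      exact ht.1.ne' h1)
    hsm.continuousAt hτ0
  refine ⟨τ, hsm, hτ0, ?_⟩
  filter_upwards [hret, hpos, hmin] with u h1 h2 h3 hu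
  have hiff : ∀ t, Φ (t, (u, 0)) = (u, 0) ↔ Ψ (t, u) = Ψ (0, u) := fun t => by
    have h4 : ((u, 0) : ℝ × ℝ) = u • Ψ (0, u) := by rw [← hΦΨ, hΦ.map_zero]
    conv_lhs => rw [hΦΨ]; rhs; rw [h4]
    exact smul_right_injective _ hu |>.eq_iff
  have h5 : Φ (τ u, (u, 0)) = (u, 0) := (hiff _).2 (by rw [h1 hu, hΨ1])
  refine ⟨h2, h5, fun t ht h => ?_⟩
  exact h3 (fun t ht' => (hiff _).1 (hΦ.return_sub h5 ((hiff t).2 ht'))) t ht ((hiff t).1 h)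

end IsCenter
end Orbits

/-! ### A transversal curve through all levels -/

section Section

theorem exists_inverse_of_deriv_pos {f : ℝ → ℝ} {D : Set ℝ} (hD : IsOpen D) (hconv : Convex ℝ D)
    (hf : ∀ u ∈ D, ContDiffAt ℝ ∞ f u) (hpos : ∀ u ∈ D, 0 < deriv f u) :
    StrictMonoOn f D ∧ IsOpen (f '' D) ∧ ∃ g : ℝ → ℝ, (∀ u ∈ D, g (f u) = u) ∧
      ∀ u ∈ D, ContDiffAt ℝ ∞ g (f u) := by
  have hn : (∞ : WithTop ℕ∞) ≠ 0 := by simp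
  have hmono : StrictMonoOn f D := strictMonoOn_of_deriv_pos hconv
    (fun u hu => (hf u hu).continuousAt.continuousWithinAt)
    (fun u hu => hpos u (interior_subset hu))
  have hstrict : ∀ u ∈ D, HasStrictDerivAt f (deriv f u) u := fun u hu =>
    (hf u hu).hasStrictDerivAt hn
  refine ⟨hmono, ?_, Function.invFunOn f D, fun u hu => hmono.injOn.leftInvOn_invFunOn hu,
    fun u hu => ?_⟩
  · rw [isOpen_iff_mem_nhds]
    rintro _ ⟨u, hu, rfl⟩
    rw [← (hstrict u hu).map_nhds_eq (hpos u hu).ne']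
    exact image_mem_map (hD.mem_nhds hu)
  · have h1 : HasFDerivAt f (ContinuousLinearEquiv.unitsEquivAut ℝ
        (Units.mk0 (deriv f u) (hpos u hu).ne') : ℝ →L[ℝ] ℝ) u :=
      ((hstrict u hu).hasStrictFDerivAt_equiv (hpos u hu).ne').hasFDerivAt
    have h2 := (hf u hu).to_localInverse h1 hn
    have h3 : HasStrictFDerivAt f (ContinuousLinearEquiv.unitsEquivAut ℝ
        (Units.mk0 (deriv f u) (hpos u hu).ne') : ℝ →L[ℝ] ℝ) u :=
      (hf u hu).hasStrictFDerivAt' h1 hn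
    have h4 := h3.eventually_right_inverse
    have h5 := h3.localInverse_tendsto.eventually (hD.mem_nhds hu)
    refine h2.congr_of_eventuallyEq ?_
    filter_upwards [h4, h5] with s h6 h7
    have h8 : Function.invFunOn f D (f (h3.localInverse f _ u s)) = h3.localInverse f _ u s :=
      hmono.injOn.leftInvOn_invFunOn h7
    rw [h6] at h8
    exact h8

namespace IsCenter

variable {E₀ : ℝ} {U : Set (ℝ × ℝ)} {H₀ : ℝ × ℝ → ℝ} {R : ℝ}

/-- The signed square root of `2 H₀` along the `x`-axis. -/
theorem exists_axis_root (hc : IsCenter E₀ U H₀) : ∃ a > 0, ∃ σ : ℝ → ℝ, σ 0 = 0 ∧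
    ∀ u, |u| < a → ContDiffAt ℝ ∞ σ u ∧ 0 < deriv σ u ∧ H₀ (u, 0) = σ u ^ 2 / 2 ∧
      (u, 0) ∈ U ∧ H₀ (u, 0) < E₀ := by
  obtain ⟨K, hK, hHK, hK0, -, -⟩ := hc.exists_blowup
  let k : ℝ → ℝ := fun u => K ((1, 0), u)
  have hk : ContDiff ℝ ∞ k := hK.comp (by fun_prop)
  have hk0 : k 0 = 1 / 2 := by simp [k, hK0]
  have hH : ∀ u, H₀ (u, 0) = u ^ 2 * k u := fun u => by rw [← hHK]; simp
  -- On the axis `H₀ = u² k(u)` with `k 0 = 1/2`, so this is a smooth square root of `2H₀` with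
  -- slope `1` at the center.
  let σ : ℝ → ℝ := fun u => u * Real.sqrt (2 * k u)
  have hσs : ∀ u, 0 < k u → ContDiffAt ℝ ∞ σ u := fun u hu =>
    contDiffAt_id.mul ((contDiffAt_const.mul hk.contDiffAt).sqrt (by positivity))
  have h1 : ∀ᶠ u in 𝓝 0, 0 < k u :=
    (hk.continuous.tendsto 0).eventually (lt_mem_nhds (by rw [hk0]; norm_num))
  have hσd : deriv σ 0 = 1 := by
    have hd : HasDerivAt (fun u => Real.sqrt (2 * k u)) _ 0 :=
      (((hk.differentiable (by simp) 0).hasDerivAt.const_mul 2).sqrt (by rw [hk0]; norm_num))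
    have := ((hasDerivAt_id (0 : ℝ)).mul hd).deriv
    have h2 : deriv σ 0 = 1 * Real.sqrt (2 * k 0) + id 0 * _ := this
    rw [h2, hk0]
    norm_num
  have h2 : ∀ᶠ u in 𝓝 0, 0 < deriv σ u := by
    have hs : ContDiffAt ℝ 1 σ 0 := (hσs 0 (by rw [hk0]; norm_num)).of_le (by simp)
    have hcd : ContinuousAt (deriv σ) 0 :=
      (hs.derivWithin (m := 0) (by simp)).continuousAt
    exact hcd.eventually (lt_mem_nhds (by rw [hσd]; norm_num))
  have hcax : Continuous fun u : ℝ => ((u, 0) : ℝ × ℝ) := by fun_prop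
  have h3 : ∀ᶠ u : ℝ in 𝓝 0, (u, (0 : ℝ)) ∈ U :=
    (hcax.tendsto 0).eventually (hc.isOpen_U.mem_nhds hc.zero_mem_U)
  have h4 : ∀ᶠ u : ℝ in 𝓝 0, H₀ (u, 0) < E₀ :=
    ((hc.continuous.comp hcax).tendsto 0).eventually
      (gt_mem_nhds (by simpa [hc.map_zero] using hc.E₀_pos))
  obtain ⟨a, ha, h⟩ := Metric.eventually_nhds_iff.1 (h1.and (h2.and (h3.and h4)))
  refine ⟨a, ha, σ, by simp [σ], fun u hu => ?_⟩
  obtain ⟨h5, h6, h7, h8⟩ := h (y := u) (by rwa [Real.dist_eq, sub_zero])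
  refine ⟨hσs u h5, h6, ?_, h7, h8⟩
  rw [hH]
  simp only [σ]
  rw [mul_pow, Real.sq_sqrt (by positivity)]
  ring

/-- A curve leaving the center along the `x`-axis and climbing to the level `E₀`. -/
theorem exists_climbing_curve (hc : IsCenter E₀ U H₀)
    (hR : ∀ p ∈ U, H₀ p ∈ Set.Ioc 0 E₀ → ‖p‖ < R) {x₀ : ℝ} (hx₀U : (x₀, 0) ∈ U)
    (hx₀E : 0 < H₀ (x₀, 0)) (hx₀E' : H₀ (x₀, 0) < E₀) (hpos : 0 < partialX H₀ (x₀, 0)) :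
    ∃ γ : ℝ → ℝ × ℝ, ContDiff ℝ ∞ γ ∧ (∀ᶠ t in 𝓝 0, γ t = (x₀ + t, 0)) ∧ ∃ t₁ > 0, ∃ δ > 0,
      H₀ (γ t₁) = E₀ ∧ (∀ t ∈ Set.Icc 0 t₁, γ t ∈ U ∧ H₀ (γ t) ∈ Set.Ioc 0 E₀) ∧
      ∀ t ∈ Set.Ico 0 (t₁ + δ), 0 < deriv (fun t => H₀ (γ t)) t := by
  have hx₀R : ‖((x₀, 0) : ℝ × ℝ)‖ < R := hR _ hx₀U ⟨hx₀E, hx₀E'.le⟩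
  have hRpos : 0 < R := (norm_nonneg _).trans_lt hx₀R
  have hdX := contDiff_partialX hc.smooth
  have hdY := contDiff_partialY hc.smooth
  obtain ⟨ρ, hρ, hρp⟩ := Metric.eventually_nhds_iff.1
    ((hdX.continuous.tendsto (x₀, 0)).eventually (lt_mem_nhds hpos))
  let χ : ContDiffBump ((x₀, 0) : ℝ × ℝ) := ⟨ρ / 2, ρ, by positivity, by linarith⟩
  let B : ContDiffBump (0 : ℝ × ℝ) := ⟨R, R + 1, hRpos, by linarith⟩
  -- The gradient of `H₀`, blended near `(x₀, 0)` with the constant field `(1, 0)`, so that the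
  -- curve continues the `x`-axis smoothly. In the blending region `∂_x H₀ > 0`, hence energy
  -- increases along every combination.
  let f : ℝ × ℝ → ℝ × ℝ := fun p =>
    B p • ((1 - χ p) • (partialX H₀ p, partialY H₀ p) + χ p • ((1 : ℝ), (0 : ℝ)))
  have hf : ContDiff ℝ ∞ f :=
    B.contDiff.smul (((contDiff_const.sub χ.contDiff).smul (hdX.prodMk hdY)).add
      (χ.contDiff.smul contDiff_const))
  obtain ⟨Φ, hΦ, hΦ0, hder, -, L, hL⟩ := exists_contDiff_flow hf B.hasCompactSupport.smul_right
  have hB : ∀ p, ‖p‖ < R → B p = 1 := fun p hp =>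
    B.one_of_mem_closedBall (by simpa using hp.le)
  let γ : ℝ → ℝ × ℝ := fun t => Φ (t, (x₀, 0))
  have hγ : ContDiff ℝ ∞ γ := hΦ.comp (by fun_prop)
  let W : ℝ × ℝ → ℝ := fun p => fderiv ℝ H₀ p (f p)
  have hWc : Continuous W :=
    (hc.smooth.continuous_fderiv (by simp)).clm_apply hf.continuous
  have hW : ∀ p ∈ U, H₀ p ∈ Set.Ioc 0 E₀ → 0 < W p := fun p hp hE => by
    have h1 := hc.fderiv_ne_zero hp hE
    have h2 : W p = (1 - χ p) * (partialX H₀ p ^ 2 + partialY H₀ p ^ 2)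
        + χ p * partialX H₀ p := by
      simp only [W, f, hB p (hR p hp hE), one_smul]
      rw [fderiv_apply_eq_partial (hc.differentiable p)]
      simp only [Prod.fst_add, Prod.snd_add, Prod.smul_fst, Prod.smul_snd, smul_eq_mul]
      ring
    rw [h2]
    have h3 := χ.le_one (x := p)
    rcases (χ.nonneg' p).eq_or_lt with h4 | h4
    · rw [← h4, sub_zero, one_mul, zero_mul, add_zero]
      rcases not_and_or.1 (hc.regular_levels p hp hE) with h5 | h5 <;> positivity
    · have h5 : p ∈ Metric.ball ((x₀, 0) : ℝ × ℝ) ρ := by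
        rw [← χ.support_eq]; exact h4.ne'
      have h6 := hρp h5
      have : 0 ≤ (1 - χ p) * (partialX H₀ p ^ 2 + partialY H₀ p ^ 2) :=
        mul_nonneg (by linarith) (by positivity)
      have := mul_pos h4 h6
      linarith
  let η : ℝ → ℝ := fun t => H₀ (γ t)
  have hηd : ∀ t, HasDerivAt η (W (γ t)) t := fun t =>
    (hc.differentiable (γ t)).hasFDerivAt.comp_hasDerivAt t (hder t (x₀, 0))
  have hηc : Continuous η := hc.continuous.comp hγ.continuous
  have hγ0 : γ 0 = (x₀, 0) := hΦ0 _
  set e := H₀ (x₀, 0) with he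
  let A : Set (ℝ × ℝ) := {p | p ∈ U ∧ H₀ p ∈ Set.Icc e E₀}
  have hA : IsCompact A := hc.isCompact_shell hx₀E
  have hAI : ∀ p ∈ A, H₀ p ∈ Set.Ioc 0 E₀ := fun p hp => ⟨hx₀E.trans_le hp.2.1, hp.2.2⟩
  -- Continuous induction: while the energy is below `E₀` it increases and the curve cannot leave
  -- the compact shell `A`, in particular not `U`.
  have hind : ∀ b, (∀ t ∈ Set.Ico 0 b, η t < E₀) → Set.Icc 0 b ⊆ {t | γ t ∈ A} := by
    intro b hb
    refine IsClosed.Icc_subset_of_forall_mem_nhdsWithin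
      ((hA.isClosed.preimage hγ.continuous).inter isClosed_Icc) ?_ ?_
    · change γ 0 ∈ A
      rw [hγ0]
      exact ⟨hx₀U, le_rfl, hx₀E'.le⟩
    · rintro t ⟨ht, htb⟩
      have h1 : 0 < W (γ t) := hW _ ht.1 (hAI _ ht)
      have h2 : ∀ᶠ τ in 𝓝[>] t, η t < η τ := by
        have h3 := (hasDerivAt_iff_tendsto_slope.1 (hηd t)).eventually (lt_mem_nhds h1)
        have h4 : 𝓝[>] t ≤ 𝓝[≠] t := nhdsWithin_mono _ fun x hx => ne_of_gt hx
        filter_upwards [h3.filter_mono h4, self_mem_nhdsWithin] with τ h5 h6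
        rw [slope_def_field] at h5
        have h6 : t < τ := h6
        have := (div_pos_iff_of_pos_right (sub_pos.2 h6)).1 h5
        linarith
      have h3 : ∀ᶠ τ in 𝓝 t, γ τ ∈ U ∧ η τ < E₀ :=
        ((hγ.continuous.tendsto t).eventually (hc.isOpen_U.mem_nhds ht.1)).and
          ((hηc.tendsto t).eventually (gt_mem_nhds (hb t htb)))
      filter_upwards [h2, h3.filter_mono nhdsWithin_le_nhds] with τ h4 h5
      exact ⟨h5.1, (ht.2.1.trans h4.le), h5.2.le⟩
  -- Otherwise the curve would stay in `A` for ever. There the growth rate of the energy has a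
  -- positive minimum `W p`, so `E₀` is exceeded by time `E₀ / W p`.
  have hreach : ∃ t, 0 ≤ t ∧ E₀ ≤ η t := by
    by_contra! hcon
    have h1 : ∀ t, 0 ≤ t → γ t ∈ A := fun t ht =>
      hind t (fun τ hτ => hcon τ hτ.1) ⟨ht, le_rfl⟩
    obtain ⟨p, hpA, hpmin⟩ := hA.exists_isMinOn ⟨γ 0, h1 0 le_rfl⟩ hWc.continuousOn
    have hm : 0 < W p := hW p hpA.1 (hAI p hpA)
    have h2 : ∀ t, 0 ≤ t → W p * t ≤ η t - η 0 := fun t ht => by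
      have := (convex_Icc 0 t).mul_sub_le_image_sub_of_le_deriv (f := η) (C := W p)
        hηc.continuousOn (fun x _ => (hηd x).differentiableAt.differentiableWithinAt)
        (fun x hx => by
          rw [(hηd x).deriv]
          exact hpmin (h1 x (interior_subset hx).1)) 0 ⟨le_rfl, ht⟩ t ⟨ht, le_rfl⟩ ht
      rwa [sub_zero] at this
    have h3 := h2 (E₀ / W p) (div_nonneg hc.E₀_pos.le hm.le)
    rw [mul_div_cancel₀ _ hm.ne'] at h3
    have h4 := hcon (E₀ / W p) (div_nonneg hc.E₀_pos.le hm.le)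
    have h5 : η 0 = e := by simp only [η, hγ0]; rfl
    linarith
  let P : Set ℝ := {t | 0 ≤ t ∧ E₀ ≤ η t}
  have hPc : IsClosed P :=
    (isClosed_le continuous_const continuous_id).inter (isClosed_le continuous_const hηc)
  have hPb : BddBelow P := ⟨0, fun t ht => ht.1⟩
  have hmem : sInf P ∈ P := hPc.csInf_mem hreach hPb
  set t₁ := sInf P with ht₁
  have hbefore : ∀ t ∈ Set.Ico 0 t₁, η t < E₀ := fun t ht => by
    by_contra hcon
    exact absurd (csInf_le hPb (show t ∈ P from ⟨ht.1, not_lt.1 hcon⟩)) (not_le.2 ht.2)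
  have hsub := hind t₁ hbefore
  have ht₁E : η t₁ = E₀ := le_antisymm (hsub ⟨hmem.1, le_rfl⟩).2.2 hmem.2
  have ht₁pos : 0 < t₁ := by
    rcases hmem.1.eq_or_lt with h | h
    · have h1 : η 0 = e := by simp only [η, hγ0]; rfl
      rw [← h, h1] at ht₁E
      exact absurd ht₁E hx₀E'.ne
    · exact h
  have hWpos : ∀ t ∈ Set.Icc 0 t₁, 0 < W (γ t) := fun t ht =>
    hW _ (hsub ht).1 (hAI _ (hsub ht))
  obtain ⟨δ, hδ, hδp⟩ := Metric.eventually_nhds_iff.1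
    (((hWc.comp hγ.continuous).tendsto t₁).eventually
      (lt_mem_nhds (hWpos t₁ ⟨ht₁pos.le, le_rfl⟩)))
  refine ⟨γ, hγ, ?_, t₁, ht₁pos, δ, hδ, ht₁E, fun t ht => ⟨(hsub ht).1, hAI _ (hsub ht)⟩,
    fun t ht => ?_⟩
  · obtain ⟨δ', hδ', hn⟩ := Metric.eventually_nhds_iff.1
      ((continuous_norm.tendsto ((x₀, 0) : ℝ × ℝ)).eventually (gt_mem_nhds hx₀R))
    -- Within this distance both bump functions equal `1` and the field is the constant `(1, 0)`.
    set κ := min (ρ / 2) δ' with hκ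
    have hκpos : 0 < κ := by positivity
    have huniq := ODE_solution_unique_of_mem_Ioo (v := fun _ => f) (s := fun _ => Set.univ)
      (K := L) (t₀ := 0) (a := -κ) (b := κ) (f := γ) (g := fun t => (x₀ + t, (0 : ℝ)))
      (fun _ _ => hL.lipschitzOnWith) ⟨by linarith, hκpos⟩
      (fun t _ => ⟨hder t (x₀, 0), trivial⟩)
      (fun t ht => ⟨by
        have h1 : dist ((x₀ + t, 0) : ℝ × ℝ) (x₀, 0) < κ := by
          rw [Prod.dist_eq, Real.dist_eq, Real.dist_eq]
          simp only [add_sub_cancel_left, sub_self, abs_zero]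
          exact max_lt (abs_lt.2 ht) hκpos
        have h2 : f (x₀ + t, 0) = (1, 0) := by
          simp only [f]
          rw [hB _ (hn (h1.trans_le (min_le_right _ _))), χ.one_of_mem_closedBall
            (h1.le.trans (min_le_left _ _))]
          simp
        rw [h2]
        exact ((hasDerivAt_id t).const_add x₀).prodMk (hasDerivAt_const _ _), trivial⟩)
      (by simp [hγ0])
    filter_upwards [Ioo_mem_nhds (neg_lt_zero.2 hκpos) hκpos] with t ht
    exact huniq ht
  · have : deriv η t = W (γ t) := (hηd t).deriv
    change 0 < deriv η t
    rw [this]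
    rcases le_or_gt t t₁ with h1 | h1
    · exact hWpos t ⟨ht.1, h1⟩
    · exact hδp (y := t) (by rw [Real.dist_eq, abs_of_pos (by linarith)]; linarith [ht.2])

/-- A smooth transversal `c` to all level curves, parametrized by `s = √(2E)`, straight near the
center. -/
theorem exists_transversal (hc : IsCenter E₀ U H₀)
    (hR : ∀ p ∈ U, H₀ p ∈ Set.Ioc 0 E₀ → ‖p‖ < R) :
    ∃ (D : Set ℝ) (c : ℝ → ℝ × ℝ), IsOpen D ∧ Set.Icc 0 (Real.sqrt (2 * E₀)) ⊆ D ∧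
      (∀ s ∈ D, ContDiffAt ℝ ∞ c s ∧ H₀ (c s) = s ^ 2 / 2) ∧
      (∀ s ∈ Set.Icc 0 (Real.sqrt (2 * E₀)), c s ∈ U) ∧ c 0 = 0 ∧
      ∀ᶠ s in 𝓝 0, c s ∈ U ∧ (c s).2 = 0 := by
  obtain ⟨a, ha, σ, hσ0, hσ⟩ := hc.exists_axis_root
  have hσmono : StrictMonoOn σ (Set.Ioo (-a) a) := strictMonoOn_of_deriv_pos (convex_Ioo _ _)
    (fun u hu => (hσ u (abs_lt.2 hu)).1.continuousAt.continuousWithinAt)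
    (fun u hu => (hσ u (abs_lt.2
      (show u ∈ Set.Ioo (-a) a from interior_subset hu))).2.1)
  have hσpos : ∀ u, 0 < u → u < a → 0 < σ u := fun u h0 h1 => by
    rw [← hσ0]
    exact hσmono ⟨by linarith, ha⟩ ⟨by linarith, h1⟩ h0
  set x₀ := a / 2 with hx₀
  have hx₀pos : 0 < x₀ := by positivity
  have hx₀a : |x₀| < a := by rw [abs_of_pos hx₀pos]; linarith
  obtain ⟨-, hσd, hσH, hx₀U, hx₀E'⟩ := hσ x₀ hx₀a
  have hσx₀ := hσpos x₀ hx₀pos (by linarith)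
  have hx₀E : 0 < H₀ (x₀, 0) := by rw [hσH]; positivity
  have hpX : 0 < partialX H₀ (x₀, 0) := by
    have h1 : HasDerivAt (fun u => σ u ^ 2 / 2) (σ x₀ * deriv σ x₀) x₀ := by
      have := (((hσ x₀ hx₀a).1.differentiableAt (by simp)).hasDerivAt.fun_pow 2).div_const 2
      have h1 : σ x₀ * deriv σ x₀ = ((2 : ℕ) : ℝ) * σ x₀ ^ (2 - 1) * deriv σ x₀ / 2 := by
        norm_num
        ring
      rw [h1]
      exact this
    have h2 : (fun u => H₀ (u, 0)) =ᶠ[𝓝 x₀] fun u => σ u ^ 2 / 2 := by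
      filter_upwards [Ioo_mem_nhds (abs_lt.1 hx₀a).1 (abs_lt.1 hx₀a).2] with u hu
      exact (hσ u (abs_lt.2 hu)).2.2.1
    have h3 : partialX H₀ (x₀, 0) = σ x₀ * deriv σ x₀ := (h1.congr_of_eventuallyEq h2).deriv
    rw [h3]
    positivity
  obtain ⟨γ, hγ, hγ0, t₁, ht₁, δ, hδ, hγE, hγU, hγd⟩ :=
    hc.exists_climbing_curve hR hx₀U hx₀E hx₀E' hpX
  obtain ⟨κ', hκ', hγκ'⟩ := Metric.eventually_nhds_iff.1 hγ0
  set κ := min κ' x₀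
  have hκ : 0 < κ := by positivity
  have hγκ : ∀ t, |t| < κ → γ t = (x₀ + t, 0) := fun t ht =>
    hγκ' (by rw [Real.dist_eq, sub_zero]; exact ht.trans_le (min_le_left _ _))
  let η : ℝ → ℝ := fun t => H₀ (γ t)
  have hη : ContDiff ℝ ∞ η := hc.smooth.comp hγ
  have hη0 : η 0 = H₀ (x₀, 0) := by
    simp only [η]; rw [hγκ 0 (by simpa using hκ), add_zero]
  have hηmono : StrictMonoOn η (Set.Ico 0 (t₁ + δ)) := strictMonoOn_of_deriv_pos (convex_Ico _ _)
    hη.continuous.continuousOn (fun t ht => hγd t (interior_subset ht))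
  have hηpos : ∀ t ∈ Set.Ico 0 (t₁ + δ), 0 < η t := fun t ht => by
    have := hηmono.monotoneOn ⟨le_rfl, ht.1.trans_lt ht.2⟩ ht ht.1
    linarith
  -- The axis up to `x₀`, then the climbing curve. The two formulas agree on a window of length `κ`
  -- beyond `x₀`, so the gluing is smooth. `S` is the signed `√(2H₀)` along `C`, and the transversal
  -- is `C` reparametrized by the inverse of `S`.
  let C : ℝ → ℝ × ℝ := fun u => if u < x₀ then (u, 0) else γ (u - x₀)
  let S : ℝ → ℝ := fun u => if u < x₀ then σ u else Real.sqrt (2 * η (u - x₀))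
  have hCleft : ∀ u, u < x₀ + κ → C u = (u, 0) := fun u hu => by
    simp only [C]
    split_ifs with h
    · rfl
    · rw [hγκ _ (by rw [abs_of_nonneg (by linarith)]; linarith)]
      simp
  have hSleft : ∀ u, u < x₀ + κ → S u = σ u := fun u hu => by
    simp only [S]
    split_ifs with h
    · rfl
    · have hκx : κ ≤ x₀ := min_le_right _ _
      have hua : u < a := by linarith
      simp only [η]
      rw [hγκ _ (by rw [abs_of_nonneg (by linarith)]; linarith), add_sub_cancel,
        (hσ u (by rw [abs_of_nonneg (by linarith)]; linarith)).2.2.1,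
        mul_div_cancel₀ _ two_ne_zero, Real.sqrt_sq (hσpos u (by linarith) hua).le]
  have hCright : ∀ u, x₀ ≤ u → C u = γ (u - x₀) := fun u hu => if_neg (not_lt.2 hu)
  have hSright : ∀ u, x₀ ≤ u → S u = Real.sqrt (2 * η (u - x₀)) :=
    fun u hu => if_neg (not_lt.2 hu)
  set u₁ := x₀ + (t₁ + δ) with hu₁
  let J : Set ℝ := Set.Ioo (-x₀) u₁
  have hCsm : ∀ u ∈ J, ContDiffAt ℝ ∞ C u := fun u hu => by
    rcases lt_or_ge u (x₀ + κ) with h | h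
    · have : ContDiffAt ℝ ∞ (fun u : ℝ => (u, (0 : ℝ))) u := by fun_prop
      exact this.congr_of_eventuallyEq (by
        filter_upwards [gt_mem_nhds h] with v hv using hCleft v hv)
    · have : ContDiffAt ℝ ∞ (fun u : ℝ => γ (u - x₀)) u :=
        (hγ.comp (by fun_prop : ContDiff ℝ ∞ fun u : ℝ => u - x₀)).contDiffAt
      exact this.congr_of_eventuallyEq (by
        filter_upwards [lt_mem_nhds (show x₀ < u by linarith)] with v hv using hCright v hv.le)
  have hSprop : ∀ u ∈ J, ContDiffAt ℝ ∞ S u ∧ 0 < deriv S u := fun u hu => by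
    rcases lt_or_ge u (x₀ + κ) with h | h
    · have hκx : κ ≤ x₀ := min_le_right _ _
      have h1 : S =ᶠ[𝓝 u] σ := by
        filter_upwards [gt_mem_nhds h] with v hv using hSleft v hv
      obtain ⟨h2, h3, -⟩ := hσ u (abs_lt.2 ⟨by linarith [hu.1], by linarith⟩)
      exact ⟨h2.congr_of_eventuallyEq h1, by rwa [h1.deriv_eq]⟩
    · have h1 : S =ᶠ[𝓝 u] fun u => Real.sqrt (2 * η (u - x₀)) := by
        filter_upwards [lt_mem_nhds (show x₀ < u by linarith)] with v hv using hSright v hv.le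
      have hmem : u - x₀ ∈ Set.Ico 0 (t₁ + δ) := ⟨by linarith, by linarith [hu.2]⟩
      have h2 : 0 < 2 * η (u - x₀) := mul_pos two_pos (hηpos _ hmem)
      have h3 : ContDiffAt ℝ ∞ (fun u => 2 * η (u - x₀)) u :=
        (contDiff_const.mul (hη.comp
          (by fun_prop : ContDiff ℝ ∞ fun u : ℝ => u - x₀))).contDiffAt
      refine ⟨(h3.sqrt h2.ne').congr_of_eventuallyEq h1, ?_⟩
      rw [h1.deriv_eq]
      have h4 : HasDerivAt (fun u => 2 * η (u - x₀)) (2 * deriv η (u - x₀)) u :=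
        (((hη.differentiable (by simp) (u - x₀)).hasDerivAt).comp_sub_const u x₀).const_mul 2
      rw [(h4.sqrt h2.ne').deriv]
      have h5 : 0 < deriv η (u - x₀) := hγd _ hmem
      have h6 := Real.sqrt_pos.2 h2
      positivity
  obtain ⟨hmono, hopen, g, hg, hgs⟩ := exists_inverse_of_deriv_pos (D := J) isOpen_Ioo
    (convex_Ioo _ _) (fun u hu => (hSprop u hu).1) (fun u hu => (hSprop u hu).2)
  have h0J : (0 : ℝ) ∈ J := ⟨by linarith, by linarith⟩
  have hS0 : S 0 = 0 := by rw [hSleft 0 (by linarith), hσ0]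
  have hu₀J : x₀ + t₁ ∈ J := ⟨by linarith, by linarith⟩
  have hSu₀ : S (x₀ + t₁) = Real.sqrt (2 * E₀) := by
    rw [hSright _ (by linarith), add_sub_cancel_left]
    simp only [η, hγE]
  have hconn : Set.OrdConnected (S '' J) := by
    refine IsPreconnected.ordConnected (isPreconnected_Ioo.image _ fun u hu => ?_)
    exact (hSprop u hu).1.continuousAt.continuousWithinAt
  have hIcc : Set.Icc 0 (Real.sqrt (2 * E₀)) ⊆ S '' J :=
    hconn.out ⟨0, h0J, hS0⟩ ⟨_, hu₀J, hSu₀⟩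
  have hg0 : g 0 = 0 := by have := hg 0 h0J; rwa [hS0] at this
  refine ⟨S '' J, fun s => C (g s), hopen, hIcc, ?_, ?_, ?_, ?_⟩
  · rintro _ ⟨u, hu, rfl⟩
    refine ⟨ContDiffAt.comp (S u) (g := C) (by rw [hg u hu]; exact hCsm u hu) (hgs u hu), ?_⟩
    change H₀ (C (g (S u))) = _
    rw [hg u hu]
    rcases lt_or_ge u x₀ with h | h
    · rw [hCleft u (by linarith), hSleft u (by linarith)]
      exact (hσ u (abs_lt.2 ⟨by linarith [hu.1], by linarith⟩)).2.2.1
    · have hmem : u - x₀ ∈ Set.Ico 0 (t₁ + δ) := ⟨by linarith, by linarith [hu.2]⟩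
      rw [hCright u h, hSright u h, Real.sq_sqrt (mul_pos two_pos (hηpos _ hmem)).le]
      simp only [η]; ring
  · intro s hs
    obtain ⟨u, hu, rfl⟩ := hIcc hs
    simp only [hg u hu]
    rcases lt_or_ge u x₀ with h | h
    · rw [hCleft u (by linarith)]
      exact (hσ u (abs_lt.2 ⟨by linarith [hu.1], by linarith⟩)).2.2.2.1
    · rw [hCright u h]
      have : u ≤ x₀ + t₁ := by
        rw [← hSu₀] at hs
        exact (hmono.le_iff_le hu hu₀J).1 hs.2
      exact (hγU _ ⟨by linarith, by linarith⟩).1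
  · simp only [hg0]
    rw [hCleft 0 (by linarith)]; rfl
  · have hgc : ContinuousAt g 0 := by
      have := (hgs 0 h0J).continuousAt
      rwa [hS0] at this
    have h1 : ∀ᶠ s in 𝓝 0, g s ∈ Set.Ioo (-x₀) x₀ :=
      hgc.eventually (by rw [hg0]; exact Ioo_mem_nhds (by linarith) hx₀pos)
    filter_upwards [h1] with s hs
    rw [hCleft _ (by linarith [hs.2])]
    exact ⟨(hσ _ (abs_lt.2 ⟨by linarith [hs.1], by linarith [hs.2]⟩)).2.2.2.1, rfl⟩

end IsCenter
end Section

/-! ### Construction of the angle map in the amplitude variable -/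

section AngleMap

/-- Angle variables in terms of `s = √(2E)`: `x (s, φ)` is smooth on the whole plane and
parametrizes the level `E = s²/2` with frequency `Ω s` when `0 ≤ s ≤ √(2E₀)`. -/
structure IsAngleMap (E₀ : ℝ) (U : Set (ℝ × ℝ)) (H₀ : ℝ × ℝ → ℝ) (Ω : ℝ → ℝ)
    (x : ℝ × ℝ → ℝ × ℝ) : Prop where
  smooth : ContDiff ℝ ∞ x
  freq_smooth : ContDiff ℝ ∞ Ω
  freq_pos : ∀ s, 0 < Ω s
  freq_near : ∃ Ω₂ : ℝ → ℝ, ContDiff ℝ ∞ Ω₂ ∧ ∀ s, Ω s = 1 + s ^ 2 * Ω₂ s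
  origin : ∀ φ, x (0, φ) = 0
  periodic : ∀ s φ, x (s, φ + 2 * Real.pi) = x (s, φ)
  mem : ∀ s ∈ Set.Icc 0 (Real.sqrt (2 * E₀)), ∀ φ, x (s, φ) ∈ U
  energy : ∀ s ∈ Set.Icc 0 (Real.sqrt (2 * E₀)), ∀ᶠ s' in 𝓝 s, ∀ φ, H₀ (x (s', φ)) = s' ^ 2 / 2
  hasDerivAt : ∀ s ∈ Set.Icc 0 (Real.sqrt (2 * E₀)), ∀ φ,
    HasDerivAt (fun φ => x (s, φ)) ((Ω s)⁻¹ • hamField H₀ (x (s, φ))) φ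
  injective : ∀ s ∈ Set.Ioc 0 (Real.sqrt (2 * E₀)), ∀ s' ∈ Set.Ioc 0 (Real.sqrt (2 * E₀)),
    ∀ φ φ', x (s, φ) = x (s', φ') → s = s' ∧ ∃ n : ℤ, φ' = φ + n * (2 * Real.pi)
  surjective : ∀ p ∈ U, H₀ p ∈ Set.Ioc 0 E₀ → ∃ φ, x (Real.sqrt (2 * H₀ p), φ) = p

theorem IsMinPeriod.flow {H₀ : ℝ × ℝ → ℝ} {R : ℝ} {Φ : ℝ × (ℝ × ℝ) → ℝ × ℝ}
    (hΦ : IsHamFlow H₀ R Φ) {p : ℝ × ℝ} {T : ℝ} (h : IsMinPeriod Φ p T) (t : ℝ) :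
    IsMinPeriod Φ (Φ (t, p)) T := by
  have hcomm : ∀ τ, Φ (τ, Φ (t, p)) = Φ (t, Φ (τ, p)) := fun τ => by
    rw [← hΦ.map_add, ← hΦ.map_add, add_comm]
  refine ⟨h.1, by rw [hcomm, h.2.1], fun τ hτ h1 => h.2.2 τ hτ ?_⟩
  rw [hcomm] at h1
  have h2 := congrArg (fun z => Φ (-t, z)) h1
  simpa only [hΦ.neg_apply] using h2

/-- A smooth map of the line into a neighbourhood of `[0, b]` fixing a smaller one. -/
theorem exists_retraction {D : Set ℝ} (hD : IsOpen D) {b : ℝ} (hb : 0 < b)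
    (hsub : Set.Icc 0 b ⊆ D) : ∃ χ : ℝ → ℝ, ContDiff ℝ ∞ χ ∧ (∀ s, χ s ∈ D) ∧
      ∀ s ∈ Set.Icc 0 b, ∀ᶠ s' in 𝓝 s, χ s' = s' := by
  obtain ⟨a, ha, haD⟩ := isCompact_Icc.exists_thickening_subset_open hD hsub
  have hmemD : ∀ s, -a < s → s < b + a → s ∈ D := fun s h1 h2 => by
    apply haD
    rw [Metric.mem_thickening_iff]
    rcases lt_or_ge s 0 with h | h
    · exact ⟨0, ⟨le_rfl, hb.le⟩, by rw [Real.dist_eq, sub_zero, abs_of_neg h]; linarith⟩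
    · rcases le_or_gt s b with h' | h'
      · exact ⟨s, ⟨h, h'⟩, by simpa using ha⟩
      · exact ⟨b, ⟨hb.le, le_rfl⟩, by rw [Real.dist_eq, abs_of_pos (by linarith)]; linarith⟩
  -- The bump equals `1` on `(-a/3, b + a/3)` and lives on `(-2a/3, b + 2a/3)`. Multiplying `s` by a
  -- number in `[0, 1]` moves it towards `0`, hence keeps it in `D`.
  let B : ContDiffBump (b / 2) := ⟨b / 2 + a / 3, b / 2 + 2 * a / 3, by positivity, by linarith⟩
  refine ⟨fun s => s * B s, contDiff_id.mul B.contDiff, fun s => ?_, fun s hs => ?_⟩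
  · by_cases h : B s = 0
    · simp only [h, mul_zero]
      exact hmemD 0 (by linarith) (by linarith)
    · have h1 : s ∈ Metric.ball (b / 2) (b / 2 + 2 * a / 3) := by rw [← B.support_eq]; exact h
      rw [Real.ball_eq_Ioo] at h1
      have h2 := B.nonneg (x := s)
      have h3 := B.le_one (x := s)
      refine hmemD _ ?_ ?_ <;> rcases le_or_gt 0 s with h4 | h4 <;> nlinarith [h1.1, h1.2]
  · have h1 : s ∈ Metric.ball (b / 2) (b / 2 + a / 3) := by
      rw [Real.ball_eq_Ioo]; constructor <;> linarith [hs.1, hs.2]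
    filter_upwards [Metric.isOpen_ball.mem_nhds h1] with s' hs'
    rw [B.one_of_mem_closedBall (Metric.ball_subset_closedBall hs'), mul_one]

/-- Evenness near `0` kills the first derivative there, so one can divide by `s` twice. Applied to
the frequency this gives `1 + O(s²)`, hence `1 + O(E)`. -/
theorem exists_eq_add_sq_mul {f : ℝ → ℝ} (hf : ContDiff ℝ ∞ f)
    (heven : ∀ᶠ s in 𝓝 0, f (-s) = f s) :
    ∃ f₂ : ℝ → ℝ, ContDiff ℝ ∞ f₂ ∧ ∀ s, f s = f 0 + s ^ 2 * f₂ s := by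
  let Q : ℝ × ℝ → ℝ := fun z => f z.2
  have hQ : ContDiff ℝ ∞ Q := hf.comp contDiff_snd
  have hA := contDiff_hadamardQuot hQ
  have hder : hadamardQuot Q (0, 0) = 0 := by
    rw [hadamardQuot_zero, ← (hasDerivAt_snd (hQ.differentiable (by simp)) 0 0).deriv]
    change deriv f 0 = 0
    have h1 : deriv (fun s => f (-s)) 0 = deriv f 0 := Filter.EventuallyEq.deriv_eq heven
    rw [deriv_comp_neg, neg_zero] at h1
    linarith
  refine ⟨fun s => hadamardQuot (hadamardQuot Q) (0, s),
    (contDiff_hadamardQuot hA).comp (by fun_prop), fun s => ?_⟩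
  have h1 : f s = f 0 + s • hadamardQuot Q (0, s) := eq_add_hadamardQuot hQ 0 s
  have h2 := eq_add_hadamardQuot hA 0 s
  rw [hder] at h2
  rw [h1, h2]
  simp only [smul_eq_mul]; ring

/-- Follow the flow from the transversal point `c s` with time scaled by the minimal period.
Transitivity on levels gives surjectivity, and the description of the return times as multiples of
the minimal period gives injectivity modulo `2π`. -/
theorem IsCenter.exists_angleMap {E₀ : ℝ} {U : Set (ℝ × ℝ)} {H₀ : ℝ × ℝ → ℝ}
    (hc : IsCenter E₀ U H₀) : ∃ Ω x, IsAngleMap E₀ U H₀ Ω x := by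
  classical
  obtain ⟨R, hR0, hR⟩ := hc.exists_bound
  obtain ⟨Φ, hΦ⟩ := exists_hamFlow hc.smooth hR0
  obtain ⟨D, c, hD, hIccD, hcD, hcU, hc0, hcnear⟩ := hc.exists_transversal hR
  obtain ⟨τ₀, hτ₀s, hτ₀0, hτ₀⟩ := hc.exists_period_axis hΦ hR0
  set s₀ := Real.sqrt (2 * E₀) with hs₀
  have hs₀pos : 0 < s₀ := Real.sqrt_pos.2 (mul_pos two_pos hc.E₀_pos)
  have hEs : ∀ s ∈ Set.Ioc 0 s₀, s ^ 2 / 2 ∈ Set.Ioc 0 E₀ := fun s hs => by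
    have h1 : s ^ 2 ≤ s₀ ^ 2 := pow_le_pow_left₀ hs.1.le hs.2 2
    rw [hs₀, Real.sq_sqrt (mul_pos two_pos hc.E₀_pos).le] at h1
    exact ⟨by have := hs.1; positivity, by linarith⟩
  have hcc : ∀ s ∈ D, ContinuousAt c s := fun s hs => (hcD s hs).1.continuousAt
  have h0D : (0 : ℝ) ∈ D := hIccD ⟨le_rfl, hs₀pos.le⟩
  have hreg : ∀ s ∈ D, s ≠ 0 → fderiv ℝ H₀ (c s) ≠ 0 := fun s hs hs0 h => by
    have h1 : HasDerivAt (fun s => H₀ (c s)) (fderiv ℝ H₀ (c s) (deriv c s)) s :=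
      (hc.differentiable (c s)).hasFDerivAt.comp_hasDerivAt s
        ((hcD s hs).1.differentiableAt (by simp)).hasDerivAt
    have h2 : HasDerivAt (fun s : ℝ => s ^ 2 / 2) s s := by
      have := (hasDerivAt_pow 2 s).div_const 2
      norm_num at this
      exact this
    have h3 : (fun s => H₀ (c s)) =ᶠ[𝓝 s] fun s => s ^ 2 / 2 := by
      filter_upwards [hD.mem_nhds hs] with s' hs' using (hcD s' hs').2
    have h4 := h1.unique (h2.congr_of_eventuallyEq h3)
    rw [h] at h4
    exact hs0 (by simpa using h4.symm)
  -- At `s = 0` the orbit is a point without minimal period; `2π` is the limiting value there. The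
  -- default is otherwise harmless, since only `s ∈ D₂` is used.
  let T : ℝ → ℝ := fun s =>
    if h : s ≠ 0 ∧ ∃ T, IsMinPeriod Φ (c s) T then h.2.choose else 2 * Real.pi
  have hT : ∀ s T', s ≠ 0 → IsMinPeriod Φ (c s) T' → T s = T' := fun s T' hs hT' => by
    have h : s ≠ 0 ∧ ∃ T, IsMinPeriod Φ (c s) T := ⟨hs, T', hT'⟩
    simp only [T, dif_pos h]
    exact h.2.choose_spec.unique hT'
  have hT0 : T 0 = 2 * Real.pi := by simp [T]
  let D₂ : Set ℝ := {s | s ∈ D ∧ ‖c s‖ < R ∧ (s ≠ 0 → IsMinPeriod Φ (c s) (T s))}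
  have hnorm : ∀ s ∈ D, ‖c s‖ < R → ∀ᶠ s' in 𝓝 s, s' ∈ D ∧ ‖c s'‖ < R := fun s hs h =>
    (hD.eventually_mem hs).and ((hcc s hs).norm.eventually (gt_mem_nhds h))
  have hne : ∀ s ∈ D, s ≠ 0 → c s ≠ 0 := fun s hs h0 h => by
    have := (hcD s hs).2
    rw [h, ← Prod.mk_zero_zero, hc.map_zero] at this
    exact h0 (by nlinarith [sq_nonneg s])
  -- At `s = 0` the period is the one found along the `x`-axis, because the transversal is straight
  -- there; elsewhere it comes from a regular periodic point.
  have hloc : ∀ s ∈ D₂, D₂ ∈ 𝓝 s ∧ ContDiffAt ℝ ∞ T s := by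
    rintro s ⟨hsD, hsR, hsT⟩
    rcases eq_or_ne s 0 with rfl | hs
    · have hfst : ContDiffAt ℝ ∞ (fun s => (c s).1) 0 := (hcD 0 hsD).1.fst
      have h00 : (c 0).1 = 0 := by rw [hc0]; rfl
      have h1 : ∀ᶠ s in 𝓝 0, s ≠ 0 → IsMinPeriod Φ (c s) (τ₀ (c s).1) := by
        have h2 : Tendsto (fun s => (c s).1) (𝓝 0) (𝓝 0) := by
          have := hfst.continuousAt
          rwa [ContinuousAt, h00] at this
        filter_upwards [h2.eventually hτ₀, hcnear, hD.mem_nhds hsD] with s h3 h4 h5 h6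
        have h7 : c s = ((c s).1, 0) := by rw [← h4.2]
        have h8 : (c s).1 ≠ 0 := fun h => hne s h5 h6 (by rw [h7, h]; rfl)
        rw [h7]
        exact h3 h8
      have hTτ : ∀ᶠ s in 𝓝 0, T s = τ₀ (c s).1 := by
        filter_upwards [h1] with s h2
        rcases eq_or_ne s 0 with rfl | h3
        · rw [hT0, h00, hτ₀0]
        · exact hT s _ h3 (h2 h3)
      refine ⟨?_, ?_⟩
      · filter_upwards [hnorm 0 hsD hsR, h1, hTτ] with s h2 h3 h4
        exact ⟨h2.1, h2.2, fun h5 => by rw [h4]; exact h3 h5⟩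
      · refine ContDiffAt.congr_of_eventuallyEq ?_ hTτ
        exact ContDiffAt.comp (0 : ℝ) (g := τ₀) (by rw [h00]; exact hτ₀s) hfst
    · obtain ⟨τ, hτs, hτ⟩ := hΦ.exists_period_near hc.smooth hsR (hreg s hsD hs) (hsT hs)
      have h1 : ∀ᶠ s' in 𝓝 s, IsMinPeriod Φ (c s') (τ (c s')) := (hcc s hsD).eventually hτ
      have h2 : ∀ᶠ s' in 𝓝 s, s' ≠ 0 := isOpen_ne.mem_nhds hs
      have hTτ : ∀ᶠ s' in 𝓝 s, T s' = τ (c s') := by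
        filter_upwards [h1, h2] with s' h3 h4 using hT s' _ h4 h3
      refine ⟨?_, ?_⟩
      · filter_upwards [hnorm s hsD hsR, h1, hTτ] with s' h3 h4 h5
        exact ⟨h3.1, h3.2, fun _ => by rw [h5]; exact h4⟩
      · exact (hτs.comp s (hcD s hsD).1).congr_of_eventuallyEq hTτ
  have hD₂ : IsOpen D₂ := isOpen_iff_mem_nhds.2 fun s hs => (hloc s hs).1
  have hcE : ∀ s ∈ Set.Ioc 0 s₀, H₀ (c s) ∈ Set.Ioc 0 E₀ := fun s hs => by
    rw [(hcD s (hIccD ⟨hs.1.le, hs.2⟩)).2]; exact hEs s hs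
  have hIcc₂ : Set.Icc 0 s₀ ⊆ D₂ := fun s hs => by
    rcases hs.1.eq_or_lt with rfl | h
    · exact ⟨hIccD hs, by rw [hc0, norm_zero]; exact hR0, fun h => absurd rfl h⟩
    · refine ⟨hIccD hs, hR _ (hcU s hs) (hcE s ⟨h, hs.2⟩), fun h0 => ?_⟩
      obtain ⟨T', hT'⟩ := hc.exists_isMinPeriod hΦ hR (hcU s hs) (hcE s ⟨h, hs.2⟩)
      rw [hT s T' h0 hT']
      exact hT'
  have hTpos : ∀ s ∈ D₂, 0 < T s := fun s hs => by
    rcases eq_or_ne s 0 with rfl | h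
    · rw [hT0]; positivity
    · exact (hs.2.2 h).1
  have hTret : ∀ s ∈ D₂, Φ (T s, c s) = c s := fun s hs => by
    rcases eq_or_ne s 0 with rfl | h
    · rw [hc0]; exact hΦ.origin hc.fderiv_zero _
    · exact (hs.2.2 h).2.1
  -- `c s` and `c (-s)` have the same energy, so they lie on one orbit and share the minimal period.
  have heven : ∀ᶠ s in 𝓝 0, T (-s) = T s := by
    have h0D₂ := hIcc₂ ⟨le_rfl, hs₀pos.le⟩
    have h1 : ∀ᶠ s in 𝓝 (0 : ℝ), s ∈ D₂ ∧ c s ∈ U ∧ s ^ 2 / 2 < E₀ :=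
      (hD₂.eventually_mem h0D₂).and ((hcnear.mono fun s h => h.1).and
        (((by fun_prop : Continuous fun s : ℝ => s ^ 2 / 2).tendsto 0).eventually
          (gt_mem_nhds (by simpa using hc.E₀_pos))))
    have hneg : Tendsto (fun s : ℝ => -s) (𝓝 0) (𝓝 0) := by
      simpa using (continuous_neg (G := ℝ)).tendsto 0
    filter_upwards [h1, hneg.eventually h1] with s h2 h3
    rcases eq_or_ne s 0 with rfl | hs
    · rw [neg_zero]
    have h4 := (hcD s h2.1.1).2
    have h5 := (hcD (-s) h3.1.1).2
    obtain ⟨t, ht⟩ := hc.exists_flow_eq hΦ hR h2.2.1 h3.2.1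
      (by rw [h4]; exact ⟨by positivity, h2.2.2.le⟩) (by rw [h4, h5, neg_sq])
    have h6 := (h2.1.2.2 hs).flow hΦ t
    rw [← ht] at h6
    exact hT _ _ (neg_ne_zero.2 hs) h6
  -- Composition with `χ` makes the period and the transversal globally smooth without changing them
  -- near `[0, √(2E₀)]`.
  obtain ⟨χ, hχ, hχD, hχid⟩ := exists_retraction hD₂ hs₀pos hIcc₂
  have hχeq : ∀ s ∈ Set.Icc 0 s₀, χ s = s := fun s hs => (hχid s hs).self_of_nhds
  have h0mem : (0 : ℝ) ∈ Set.Icc 0 s₀ := ⟨le_rfl, hs₀pos.le⟩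
  have hTχ : ContDiff ℝ ∞ fun s => T (χ s) := contDiff_iff_contDiffAt.2 fun s =>
    (hloc _ (hχD s)).2.comp s hχ.contDiffAt
  have hcχ : ContDiff ℝ ∞ fun s => c (χ s) := contDiff_iff_contDiffAt.2 fun s =>
    (hcD _ (hχD s).1).1.comp s hχ.contDiffAt
  have hTχpos : ∀ s, 0 < T (χ s) := fun s => hTpos _ (hχD s)
  let Ω : ℝ → ℝ := fun s => 2 * Real.pi / T (χ s)
  let x : ℝ × ℝ → ℝ × ℝ := fun z => Φ (z.2 * (T (χ z.1) / (2 * Real.pi)), c (χ z.1))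
  have hΩs : ContDiff ℝ ∞ Ω := contDiff_const.div hTχ fun s => (hTχpos s).ne'
  have hΩ0 : Ω 0 = 1 := by
    simp only [Ω, hχeq 0 h0mem, hT0]
    exact div_self (by positivity)
  have hxmem : ∀ s ∈ Set.Icc 0 s₀, ∀ φ, x (s, φ) ∈ U := fun s hs φ => by
    simp only [x, hχeq s hs]
    rcases hs.1.eq_or_lt with rfl | h
    · rw [hc0, hΦ.origin hc.fderiv_zero]; exact hc.zero_mem_U
    · exact hc.flow_mem hΦ (hcU s hs) (hcE s ⟨h, hs.2⟩) _
  have hxE : ∀ s ∈ Set.Icc 0 s₀, ∀ᶠ s' in 𝓝 s, ∀ φ, H₀ (x (s', φ)) = s' ^ 2 / 2 := fun s hs => by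
    filter_upwards [hχid s hs, hD.mem_nhds (hIccD hs)] with s' h1 h2 φ
    simp only [x, hΦ.energy, h1]
    exact (hcD s' h2).2
  have hπ : (0 : ℝ) < 2 * Real.pi := by positivity
  refine ⟨Ω, x, ?_, hΩs, fun s => div_pos hπ (hTχpos s), ?_, fun φ => ?_, fun s φ => ?_, hxmem,
    hxE, fun s hs φ => ?_, ?_, ?_⟩
  · refine hΦ.smooth.comp (ContDiff.prodMk ?_ ?_)
    · exact contDiff_snd.mul ((hTχ.comp contDiff_fst).div_const _)
    · exact hcχ.comp contDiff_fst
  · have h1 : ∀ᶠ s in 𝓝 0, Ω (-s) = Ω s := by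
      have hneg : Tendsto (fun s : ℝ => -s) (𝓝 0) (𝓝 0) := by
        simpa using (continuous_neg (G := ℝ)).tendsto 0
      filter_upwards [heven, hχid 0 h0mem, hneg.eventually (hχid 0 h0mem)] with s h2 h3 h4
      simp only [Ω, h3, h4, h2]
    obtain ⟨Ω₂, h2, h3⟩ := exists_eq_add_sq_mul hΩs h1
    exact ⟨Ω₂, h2, fun s => by rw [h3, hΩ0]⟩
  · simp only [x, hχeq 0 h0mem, hc0]
    exact hΦ.origin hc.fderiv_zero _
  · have h1 : (φ + 2 * Real.pi) * (T (χ s) / (2 * Real.pi)) =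
        φ * (T (χ s) / (2 * Real.pi)) + T (χ s) := by field_simp
    simp only [x, h1, hΦ.map_add, hTret _ (hχD s)]
  · have h1 : ‖x (s, φ)‖ < R := by
      rcases hs.1.eq_or_lt with rfl | h
      · simp only [x, hχeq 0 hs, hc0, hΦ.origin hc.fderiv_zero, norm_zero]; exact hR0
      · refine hR _ (hxmem s hs φ) ?_
        rw [(hxE s hs).self_of_nhds φ]
        exact hEs s ⟨h, hs.2⟩
    have h2 := (hΦ.hasDerivAt _ _ h1).scomp φ
      ((hasDerivAt_id φ).mul_const (T (χ s) / (2 * Real.pi)))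
    have h3 : (Ω s)⁻¹ = 1 * (T (χ s) / (2 * Real.pi)) := by simp only [Ω, inv_div, one_mul]
    rw [h3]
    exact h2
  · intro s hs s' hs' φ φ' h
    have hsI : s ∈ Set.Icc 0 s₀ := ⟨hs.1.le, hs.2⟩
    have hsI' : s' ∈ Set.Icc 0 s₀ := ⟨hs'.1.le, hs'.2⟩
    have h1 := (hxE s hsI).self_of_nhds φ
    rw [h, (hxE s' hsI').self_of_nhds φ'] at h1
    have h2 : s = s' := by
      have h3 : s ^ 2 = s' ^ 2 := by linarith
      exact (pow_left_inj₀ hs.1.le hs'.1.le two_ne_zero).1 h3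
    subst h2
    refine ⟨rfl, ?_⟩
    simp only [x, hχeq s hsI] at h
    have hper : IsMinPeriod Φ (c s) (T s) := (hIcc₂ hsI).2.2 hs.1.ne'
    have h3 := congrArg (fun z => Φ (-(φ * (T s / (2 * Real.pi))), z)) h
    simp only [hΦ.neg_apply] at h3
    rw [← hΦ.map_add] at h3
    obtain ⟨n, hn⟩ := (hΦ.return_iff hper).1 h3.symm
    refine ⟨n, ?_⟩
    have h4 := hper.1.ne'
    field_simp at hn
    linarith
  · intro p hp hE
    have h1 : Real.sqrt (2 * H₀ p) ∈ Set.Ioc 0 s₀ :=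
      ⟨Real.sqrt_pos.2 (mul_pos two_pos hE.1), Real.sqrt_le_sqrt (by linarith [hE.2])⟩
    set s := Real.sqrt (2 * H₀ p) with hs
    have hsI : s ∈ Set.Icc 0 s₀ := ⟨h1.1.le, h1.2⟩
    have h2 : H₀ (c s) = H₀ p := by
      rw [(hcD s (hIccD hsI)).2, hs, Real.sq_sqrt (mul_pos two_pos hE.1).le]; ring
    obtain ⟨t, ht⟩ := hc.exists_flow_eq hΦ hR (hcU s hsI) hp (hcE s h1) h2
    refine ⟨t * (2 * Real.pi / T s), ?_⟩
    have h3 : t * (2 * Real.pi / T s) * (T s / (2 * Real.pi)) = t := by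
      have := (hTpos s (hIcc₂ hsI)).ne'
      field_simp
    simp only [x, hχeq s hsI, h3]
    exact ht.symm

end AngleMap

/-! ### From amplitude to energy; the angle of a curve -/

section ActionAngle

/-- The amplitude `s = √(2E)` of the level `E`. -/
def amp (E : ℝ) : ℝ := Real.sqrt (2 * E)

theorem amp_zero : amp 0 = 0 := by simp [amp]

theorem amp_sq {E : ℝ} (hE : 0 ≤ E) : amp E ^ 2 = 2 * E := Real.sq_sqrt (by positivity)

theorem amp_nonneg (E : ℝ) : 0 ≤ amp E := Real.sqrt_nonneg _

theorem amp_pos {E : ℝ} (hE : 0 < E) : 0 < amp E := Real.sqrt_pos.2 (by positivity)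

theorem amp_sq_div_two {s : ℝ} (hs : 0 ≤ s) : amp (s ^ 2 / 2) = s := by
  rw [amp, mul_div_cancel₀ _ two_ne_zero, Real.sqrt_sq hs]

theorem amp_le_amp {E E' : ℝ} (h : E ≤ E') : amp E ≤ amp E' := Real.sqrt_le_sqrt (by linarith)

theorem amp_mem_Icc {E E₀ : ℝ} (hE : E ∈ Set.Icc 0 E₀) : amp E ∈ Set.Icc 0 (amp E₀) :=
  ⟨amp_nonneg E, amp_le_amp hE.2⟩

theorem amp_mem_Ioc {E E₀ : ℝ} (hE : E ∈ Set.Ioc 0 E₀) : amp E ∈ Set.Ioc 0 (amp E₀) :=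
  ⟨amp_pos hE.1, amp_le_amp hE.2⟩

theorem continuous_amp : Continuous amp := Real.continuous_sqrt.comp (by fun_prop)

theorem contDiffAt_amp {E : ℝ} (hE : 0 < E) : ContDiffAt ℝ ∞ amp E :=
  (Real.contDiffAt_sqrt (by positivity)).comp E (contDiffAt_const.mul contDiffAt_id)

theorem hasDerivAt_amp {E : ℝ} (hE : 0 < E) : HasDerivAt amp (amp E)⁻¹ E := by
  have h := ((hasDerivAt_id E).const_mul 2).sqrt (by simpa using hE.ne')
  have h2 : (2 * 1 / (2 * Real.sqrt (2 * id E))) = (amp E)⁻¹ := by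
    rw [mul_div_mul_left _ _ two_ne_zero, one_div]; rfl
  rw [h2] at h
  exact h

theorem hasDerivAt_fst_comp {f : ℝ → ℝ × ℝ} {f' : ℝ × ℝ} {t : ℝ} (h : HasDerivAt f f' t) :
    HasDerivAt (fun t => (f t).1) f'.1 t :=
  (ContinuousLinearMap.fst ℝ ℝ ℝ).hasFDerivAt.comp_hasDerivAt t h

theorem hasDerivAt_snd_comp {f : ℝ → ℝ × ℝ} {f' : ℝ × ℝ} {t : ℝ} (h : HasDerivAt f f' t) :
    HasDerivAt (fun t => (f t).2) f'.2 t :=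
  (ContinuousLinearMap.snd ℝ ℝ ℝ).hasFDerivAt.comp_hasDerivAt t h

namespace IsAngleMap

variable {E₀ : ℝ} {U : Set (ℝ × ℝ)} {H₀ : ℝ × ℝ → ℝ} {Ω : ℝ → ℝ} {x : ℝ × ℝ → ℝ × ℝ}

theorem energy_eq (h : IsAngleMap E₀ U H₀ Ω x) {s : ℝ} (hs : s ∈ Set.Icc 0 (amp E₀)) (φ : ℝ) :
    H₀ (x (s, φ)) = s ^ 2 / 2 := (h.energy s hs).self_of_nhds φ

theorem hasFDerivAt (h : IsAngleMap E₀ U H₀ Ω x) (z : ℝ × ℝ) :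
    HasFDerivAt x (fderiv ℝ x z) z := (h.smooth.differentiable (by simp) z).hasFDerivAt

theorem fderiv_angle (h : IsAngleMap E₀ U H₀ Ω x) {s : ℝ} (hs : s ∈ Set.Icc 0 (amp E₀)) (φ : ℝ) :
    fderiv ℝ x (s, φ) (0, 1) = (Ω s)⁻¹ • hamField H₀ (x (s, φ)) :=
  (hasDerivAt_snd (h.smooth.differentiable (by simp)) s φ).unique (h.hasDerivAt s hs φ)

theorem hasDerivAt_amplitude (h : IsAngleMap E₀ U H₀ Ω x) (s φ : ℝ) :
    HasDerivAt (fun s => x (s, φ)) (fderiv ℝ x (s, φ) (1, 0)) s :=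
  (h.hasFDerivAt (s, φ)).comp_hasDerivAt s ((hasDerivAt_id s).prodMk (hasDerivAt_const s φ))

theorem partial_amplitude (h : IsAngleMap E₀ U H₀ Ω x) (hH : Differentiable ℝ H₀) {s : ℝ}
    (hs : s ∈ Set.Icc 0 (amp E₀)) (φ : ℝ) :
    partialX H₀ (x (s, φ)) * (fderiv ℝ x (s, φ) (1, 0)).1 +
      partialY H₀ (x (s, φ)) * (fderiv ℝ x (s, φ) (1, 0)).2 = s := by
  have h1 := (hH (x (s, φ))).hasFDerivAt.comp_hasDerivAt s (h.hasDerivAt_amplitude s φ)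
  rw [fderiv_apply_eq_partial (hH _)] at h1
  have h2 : HasDerivAt (fun s : ℝ => s ^ 2 / 2) s s := by
    have := ((hasDerivAt_id s).fun_pow 2).div_const 2
    simpa using this
  exact (h1.congr_of_eventuallyEq ((h.energy s hs).mono fun s' hs' => (hs' φ).symm)).unique h2

/-- By Hamilton's equations for `∂_φ x`, the determinant is `Ω⁻¹` times the `s`-derivative of `H₀ (x
(s, φ)) = s²/2`. It is nonzero for `s > 0`, which gives the local inverse. -/
theorem det_fderiv (h : IsAngleMap E₀ U H₀ Ω x) (hH : Differentiable ℝ H₀) {s : ℝ}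
    (hs : s ∈ Set.Icc 0 (amp E₀)) (φ : ℝ) :
    (fderiv ℝ x (s, φ) (0, 1)).1 * (fderiv ℝ x (s, φ) (1, 0)).2 -
      (fderiv ℝ x (s, φ) (1, 0)).1 * (fderiv ℝ x (s, φ) (0, 1)).2 = s / Ω s := by
  have h1 := h.partial_amplitude hH hs φ
  rw [h.fderiv_angle hs]
  simp only [hamField, Prod.smul_fst, Prod.smul_snd, smul_eq_mul]
  rw [div_eq_mul_inv]
  linear_combination (Ω s)⁻¹ * h1

theorem exists_local_inverse (h : IsAngleMap E₀ U H₀ Ω x) (hH : Differentiable ℝ H₀)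
    {s : ℝ} (hs : s ∈ Set.Ioc 0 (amp E₀)) (φ : ℝ) : ∃ g : ℝ × ℝ → ℝ × ℝ,
      ContDiffAt ℝ ∞ g (x (s, φ)) ∧ g (x (s, φ)) = (s, φ) ∧ (∀ᶠ z in 𝓝 (s, φ), g (x z) = z) ∧
      ∀ᶠ p in 𝓝 (x (s, φ)), x (g p) = p := by
  have hdet := h.det_fderiv hH ⟨hs.1.le, hs.2⟩ φ
  obtain ⟨L, hL⟩ := exists_equiv_of_det_ne_zero (fderiv ℝ x (s, φ) (1, 0))
    (fderiv ℝ x (s, φ) (0, 1)) (by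
      have := div_pos hs.1 (h.freq_pos s)
      intro h0
      have h1 : s / Ω s = 0 := by rw [← hdet]; linarith
      linarith)
  have hLe : (L : (ℝ × ℝ) →L[ℝ] ℝ × ℝ) = fderiv ℝ x (s, φ) := by
    refine ContinuousLinearMap.ext fun v => ?_
    obtain ⟨a, b⟩ := v
    have h1 : ((a, b) : ℝ × ℝ) = a • (1, 0) + b • (0, 1) := by simp
    change L (a, b) = _
    rw [hL]
    conv_rhs => rw [h1, map_add, map_smul, map_smul]
  have hf : HasFDerivAt x (L : (ℝ × ℝ) →L[ℝ] ℝ × ℝ) (s, φ) := by rw [hLe]; exact h.hasFDerivAt _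
  have hcd : ContDiffAt ℝ ∞ x (s, φ) := h.smooth.contDiffAt
  have hst := hcd.hasStrictFDerivAt' hf (by simp)
  exact ⟨hst.localInverse x L _, hcd.to_localInverse hf (by simp), hst.localInverse_apply_image,
    hst.eventually_left_inverse, hst.eventually_right_inverse⟩

end IsAngleMap

/-- Contract the interval to a base point `a` by `a + u (t - a)`. The resulting homotopy starts at a
constant map, which lifts, and homotopy lifting for the covering `ℝ → AddCircle T` gives the lift at
`u = 1`. -/
theorem exists_lift_addCircle {T : ℝ} {I : Set ℝ} (hI : I.OrdConnected) {θ : ℝ → AddCircle T}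
    (hθ : ContinuousOn θ I) :
    ∃ φ : ℝ → ℝ, ContinuousOn φ I ∧ ∀ t ∈ I, (φ t : AddCircle T) = θ t := by
  classical
  rcases I.eq_empty_or_nonempty with rfl | ⟨a, ha⟩
  · exact ⟨fun _ => 0, by simp, by simp⟩
  have hmem : ∀ u : unitInterval, ∀ t ∈ I, a + u * (t - a) ∈ I := fun u t ht => by
    have h1 := u.2.1
    have h2 := u.2.2
    rcases le_total a t with h | h
    · exact hI.out ha ht ⟨by nlinarith, by nlinarith⟩
    · exact hI.out ht ha ⟨by nlinarith, by nlinarith⟩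
  let H : C(unitInterval × I, AddCircle T) :=
    ⟨fun z => θ (a + z.1 * (z.2 - a)), by
      refine hθ.comp_continuous (by fun_prop) fun z => hmem _ _ z.2.2⟩
  obtain ⟨e, he⟩ := QuotientAddGroup.mk_surjective (θ a)
  let f : C(I, ℝ) := ⟨fun _ => e, continuous_const⟩
  have hcov := AddCircle.isCoveringMap_coe T
  have h0 : ∀ t : I, H (0, t) = ((f t : ℝ) : AddCircle T) := fun t => by
    change θ (a + (0 : ℝ) * (t - a)) = (e : AddCircle T)
    rw [zero_mul, add_zero]; exact he.symm
  let Γ := hcov.liftHomotopy H f h0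
  have hΓ : ∀ z, ((Γ z : ℝ) : AddCircle T) = H z := congrFun (hcov.liftHomotopy_lifts H f h0)
  refine ⟨fun t => if h : t ∈ I then Γ (1, ⟨t, h⟩) else 0, ?_, fun t ht => ?_⟩
  · rw [continuousOn_iff_continuous_domRestrict]
    have h1 : I.domRestrict (fun t => if h : t ∈ I then Γ (1, ⟨t, h⟩) else 0) =
        fun t => Γ (1, t) := by
      funext t
      simp
    rw [h1]
    fun_prop
  · simp only [dif_pos ht, hΓ]
    change θ (a + (1 : ℝ) * (t - a)) = θ t
    congr 1; ring

/-- Injectivity makes the angle well defined modulo `2π`; continuity is read off from the smooth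
local inverse of `x`. -/
theorem IsAngleMap.exists_angle {E₀ : ℝ} {U : Set (ℝ × ℝ)} {H₀ : ℝ × ℝ → ℝ} {Ω : ℝ → ℝ}
    {x : ℝ × ℝ → ℝ × ℝ} (h : IsAngleMap E₀ U H₀ Ω x) (hH : Differentiable ℝ H₀) :
    ∃ θ : ℝ × ℝ → AddCircle (2 * Real.pi), ContinuousOn θ {p | p ∈ U ∧ H₀ p ∈ Set.Ioc 0 E₀} ∧
      ∀ p ∈ U, H₀ p ∈ Set.Ioc 0 E₀ → ∀ φ : ℝ, (φ : AddCircle (2 * Real.pi)) = θ p →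
        x (amp (H₀ p), φ) = p := by
  classical
  let θ : ℝ × ℝ → AddCircle (2 * Real.pi) := fun p =>
    if hp : ∃ φ, x (amp (H₀ p), φ) = p then (hp.choose : AddCircle (2 * Real.pi)) else 0
  have hper : ∀ s, Function.Periodic (fun φ => x (s, φ)) (2 * Real.pi) := h.periodic
  have hθ : ∀ p ∈ U, H₀ p ∈ Set.Ioc 0 E₀ → ∀ φ : ℝ, x (amp (H₀ p), φ) = p →
      θ p = (φ : AddCircle (2 * Real.pi)) := fun p hp hE φ hφ => by
    have hex : ∃ φ, x (amp (H₀ p), φ) = p := ⟨φ, hφ⟩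
    simp only [θ, dif_pos hex]
    obtain ⟨-, n, hn⟩ := h.injective _ (amp_mem_Ioc hE) _ (amp_mem_Ioc hE) hex.choose φ
      (hex.choose_spec.trans hφ.symm)
    rw [hn, AddCircle.coe_add, ← zsmul_eq_mul, AddCircle.coe_zsmul, AddCircle.coe_period,
      smul_zero, add_zero]
  refine ⟨θ, fun p hp => ?_, fun p hp hE φ hφ => ?_⟩
  · obtain ⟨φ, hφ⟩ := h.surjective p hp.1 hp.2
    have hs := amp_mem_Ioc hp.2
    obtain ⟨g, hg, hgp, -, hr⟩ := h.exists_local_inverse hH hs φ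
    have hφ' : x (amp (H₀ p), φ) = p := hφ
    rw [hφ'] at hg hgp hr
    have h1 : Tendsto (fun p' => (g p').1) (𝓝 p) (𝓝 (amp (H₀ p))) := by
      have := hg.continuousAt.fst.tendsto
      rwa [hgp] at this
    have h2 := h1.eventually (h.energy _ ⟨hs.1.le, hs.2⟩)
    have h3 := h1.eventually (lt_mem_nhds hs.1)
    have h4 : (fun p' => θ p') =ᶠ[𝓝[{p | p ∈ U ∧ H₀ p ∈ Set.Ioc 0 E₀}] p]
        fun p' => ((g p').2 : AddCircle (2 * Real.pi)) := by
      filter_upwards [h2.filter_mono nhdsWithin_le_nhds, h3.filter_mono nhdsWithin_le_nhds,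
        hr.filter_mono nhdsWithin_le_nhds, self_mem_nhdsWithin] with p' h5 h6 h7 h8
      have h9 := h5 (g p').2
      rw [Prod.mk.eta, h7] at h9
      refine hθ p' h8.1 h8.2 _ ?_
      rw [h9, amp_sq_div_two h6.le, Prod.mk.eta, h7]
    have h5 : ContinuousAt (fun p' => ((g p').2 : AddCircle (2 * Real.pi))) p :=
      (AddCircle.continuous_mk' _).continuousAt.comp hg.continuousAt.snd
    exact h5.continuousWithinAt.congr_of_eventuallyEq_of_mem h4 hp
  · obtain ⟨φ', hφ'⟩ := h.surjective p hp hE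
    rw [hθ p hp hE φ' hφ', QuotientAddGroup.eq_iff_sub_mem, AddSubgroup.mem_zmultiples_iff] at hφ
    obtain ⟨n, hn⟩ := hφ
    have h1 : φ = φ' + n • (2 * Real.pi) := by linarith
    rw [h1]
    exact ((hper _).zsmul n φ').trans hφ'

/-- Substitute `s = amp E`. Since `ds/dE = 1/s`, the determinant `s / Ω` becomes the Jacobian `1 /
Ω`, and `s² = 2E` turns the even expansion of the frequency into `1 + O(E)`. -/
theorem IsAngleMap.isActionAngle {E₀ : ℝ} {U : Set (ℝ × ℝ)} {H₀ : ℝ × ℝ → ℝ} {Ω : ℝ → ℝ}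
    {x : ℝ × ℝ → ℝ × ℝ} (h : IsAngleMap E₀ U H₀ Ω x) (hH : Differentiable ℝ H₀) :
    IsActionAngle E₀ U H₀ (fun E => Ω (amp E)) (fun φ E => (x (amp E, φ)).1)
      (fun φ E => (x (amp E, φ)).2) := by
  have hsm : ContDiffOn ℝ ∞ (fun z : ℝ × ℝ => x (amp z.2, z.1))
      (Set.univ ×ˢ Set.Ioc 0 E₀) := fun z hz =>
    (h.smooth.contDiffAt.comp z (((contDiffAt_amp hz.2.1).comp z contDiffAt_snd).prodMk
      contDiffAt_fst)).contDiffWithinAt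
  have hct : Continuous (fun z : ℝ × ℝ => x (amp z.2, z.1)) :=
    h.smooth.continuous.comp ((continuous_amp.comp continuous_snd).prodMk continuous_fst)
  have hEs : ∀ E ∈ Set.Icc 0 E₀, ∀ φ, H₀ (x (amp E, φ)) = E := fun E hE φ => by
    rw [h.energy_eq (amp_mem_Icc hE), amp_sq hE.1]; ring
  have hφd : ∀ E ∈ Set.Icc 0 E₀, ∀ φ, HasDerivAt (fun φ => x (amp E, φ))
      (fderiv ℝ x (amp E, φ) (0, 1)) φ := fun E hE φ =>
    hasDerivAt_snd (h.smooth.differentiable (by simp)) _ _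
  refine
    { freq_smooth := fun E hE =>
        (h.freq_smooth.contDiffAt.comp E (contDiffAt_amp hE.1)).contDiffWithinAt
      freq_pos := fun E _ => h.freq_pos _
      freq_zero := ?_
      freq_near_zero := ?_
      X_smooth := contDiff_fst.comp_contDiffOn hsm
      Y_smooth := contDiff_snd.comp_contDiffOn hsm
      X_cont := hct.fst.continuousOn
      Y_cont := hct.snd.continuousOn
      X_zero := fun φ => by simp only [amp_zero, h.origin, Prod.fst_zero]
      Y_zero := fun φ => by simp only [amp_zero, h.origin, Prod.snd_zero]
      X_periodic := fun E _ φ => by simp only [h.periodic]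
      Y_periodic := fun E _ φ => by simp only [h.periodic]
      mem_U := fun E hE φ => h.mem _ (amp_mem_Icc hE) φ
      energy := hEs
      hamilton_X := fun E hE φ => ?_
      hamilton_Y := fun E hE φ => ?_
      jacobian := fun E hE φ => ?_
      injective := fun E hE E' hE' φ φ' h1 h2 => ?_
      surjective := fun p hp hE => h.surjective p hp hE
      lift := fun I X Y hI hX hY hXY => ?_ }
  · obtain ⟨Ω₂, -, h2⟩ := h.freq_near
    rw [amp_zero, h2]; ring
  · obtain ⟨Ω₂, h1, h2⟩ := h.freq_near
    have h3 : (fun E => Ω (amp E) - 1) =ᶠ[𝓝[>] 0] fun E => E * (2 * Ω₂ (amp E)) := by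
      filter_upwards [self_mem_nhdsWithin] with E hE
      rw [h2, amp_sq (le_of_lt hE)]; ring
    have h4 : (fun E => 2 * Ω₂ (amp E)) =O[𝓝[>] 0] (fun _ => (1 : ℝ)) :=
      ((continuous_const.mul (h1.continuous.comp continuous_amp)).continuousAt.tendsto.mono_left
        nhdsWithin_le_nhds).isBigO_one ℝ
    have h5 := (isBigO_refl (fun E : ℝ => E) (𝓝[>] 0)).mul h4
    simp only [mul_one] at h5
    exact h3.trans_isBigO h5
  · have h1 := hasDerivAt_fst_comp (hφd E ⟨hE.1.le, hE.2⟩ φ)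
    rw [h.fderiv_angle (amp_mem_Icc ⟨hE.1.le, hE.2⟩)] at h1
    rw [div_eq_inv_mul]
    exact h1
  · have h1 := hasDerivAt_snd_comp (hφd E ⟨hE.1.le, hE.2⟩ φ)
    rw [h.fderiv_angle (amp_mem_Icc ⟨hE.1.le, hE.2⟩)] at h1
    rw [div_eq_inv_mul]
    exact h1
  · have hE' : E ∈ Set.Icc 0 E₀ := ⟨hE.1.le, hE.2.le⟩
    have h1 := (h.hasDerivAt_amplitude (amp E) φ).scomp E (hasDerivAt_amp hE.1)
    have h2 : HasDerivAt (fun E => x (amp E, φ))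
      ((amp E)⁻¹ • fderiv ℝ x (amp E, φ) (1, 0)) E := h1
    rw [(hasDerivAt_fst_comp h2).deriv, (hasDerivAt_snd_comp h2).deriv,
      (hasDerivAt_fst_comp (hφd E hE' φ)).deriv, (hasDerivAt_snd_comp (hφd E hE' φ)).deriv]
    have h3 := h.det_fderiv hH (amp_mem_Icc hE') φ
    have h4 := (amp_pos hE.1).ne'
    have h5 := (h.freq_pos (amp E)).ne'
    simp only [Prod.smul_fst, Prod.smul_snd, smul_eq_mul]
    have h6 : 1 / Ω (amp E) = (amp E)⁻¹ * (amp E / Ω (amp E)) := by field_simp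
    rw [h6, ← h3]; ring
  · have h3 := h.injective _ (amp_mem_Ioc hE) _ (amp_mem_Ioc hE') φ φ' (Prod.ext h1 h2)
    refine ⟨?_, h3.2⟩
    have h4 := amp_sq hE.1.le
    rw [h3.1, amp_sq hE'.1.le] at h4
    linarith
  · obtain ⟨θ, hθ, hθx⟩ := h.exists_angle hH
    obtain ⟨φ, hφ, hφθ⟩ := exists_lift_addCircle hI
      (hθ.comp (hX.prodMk hY) fun t ht => hXY t ht)
    refine ⟨φ, hφ, fun t ht => ?_⟩
    have h1 := hθx _ (hXY t ht).1 (hXY t ht).2 (φ t) (hφθ t ht)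
    exact ⟨by rw [h1], by rw [h1]⟩

end ActionAngle

/-! ### The small parameter -/

section SmallParameter

/-- The small parameter `t^{-1/q}`. -/
def eps (q : ℕ) (t : ℝ) : ℝ := t ^ (-(1 : ℝ) / (q : ℝ))

theorem eps_pos (q : ℕ) {t : ℝ} (ht : 0 < t) : 0 < eps q t := Real.rpow_pos_of_pos ht _

theorem rpow_eq_eps_pow (q k : ℕ) {t : ℝ} (ht : 0 < t) :
    t ^ (-(k : ℝ) / (q : ℝ)) = eps q t ^ k := by
  rw [eps, ← Real.rpow_natCast, ← Real.rpow_mul ht.le]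
  congr 1; ring

theorem rpow_eq_eps_pow_succ (q M : ℕ) {t : ℝ} (ht : 0 < t) :
    t ^ (-((M : ℝ) + 1) / (q : ℝ)) = eps q t ^ (M + 1) := by
  rw [← rpow_eq_eps_pow q _ ht]; push_cast; rfl

theorem tendsto_eps {q : ℕ} (hq : 0 < q) : Tendsto (eps q) atTop (𝓝 0) := by
  have h : (0 : ℝ) < 1 / q := by positivity
  have := tendsto_rpow_neg_atTop h
  simp only [← neg_div] at this
  exact this

theorem eps_pow_self {q : ℕ} (hq : 0 < q) {t : ℝ} (ht : 0 < t) : eps q t ^ q = t⁻¹ := by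
  have hq' : (q : ℝ) ≠ 0 := by positivity
  rw [← rpow_eq_eps_pow q q ht, neg_div, div_self hq', Real.rpow_neg_one]

theorem contDiffAt_eps (q : ℕ) {t : ℝ} (ht : 0 < t) : ContDiffAt ℝ ∞ (eps q) t :=
  contDiffAt_infty.2 fun _ => Real.contDiffAt_rpow_const (Or.inl ht.ne')

/-- Since `ε^q = 1/t`, the derivative is a polynomial in `ε`. The explicit time dependence of the
transformation therefore stays within the formalism of power series in `ε`. -/
theorem hasDerivAt_eps {q : ℕ} (hq : 0 < q) {t : ℝ} (ht : 0 < t) :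
    HasDerivAt (eps q) (-(1 / (q : ℝ)) * eps q t ^ (q + 1)) t := by
  have h := Real.hasDerivAt_rpow_const (p := -(1 : ℝ) / (q : ℝ)) (Or.inl ht.ne')
  have h1 : -(1 : ℝ) / (q : ℝ) * t ^ (-(1 : ℝ) / (q : ℝ) - 1) =
      -(1 / (q : ℝ)) * eps q t ^ (q + 1) := by
    rw [pow_succ, eps_pow_self hq ht, Real.rpow_sub_one ht.ne', ← eps]
    ring
  rw [h1] at h
  exact h

end SmallParameter

/-! ### Perturbations with asymptotic series that vanish at the origin -/

section Perturbation

/-- `f` is a perturbation that preserves the origin, with the asymptotic series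
`∑ t^{-k/q} c_k` which may be differentiated once. -/
structure IsPert (q : ℕ) (f : ℝ × ℝ → ℝ → ℝ) (c : ℕ → ℝ × ℝ → ℝ) : Prop where
  smooth : ContDiffOn ℝ ∞ (fun z : (ℝ × ℝ) × ℝ => f z.1 z.2) {z | 0 < z.2}
  coeff_smooth : ∀ k, 1 ≤ k → ContDiff ℝ ∞ (c k)
  expansion : ∀ (r : ℝ) (M : ℕ), ∃ C : ℝ, ∀ᶠ t in atTop, ∀ p : ℝ × ℝ, ‖p‖ ≤ r →
    |f p t - ∑ k ∈ Finset.Icc 1 M, eps q t ^ k * c k p| ≤ C * eps q t ^ (M + 1) ∧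
    ‖fderiv ℝ (fun p => f p t - ∑ k ∈ Finset.Icc 1 M, eps q t ^ k * c k p) p‖
      ≤ C * eps q t ^ (M + 1)
  zero : ∀ t > 0, f 0 t = 0

variable {q : ℕ} {f g : ℝ × ℝ → ℝ → ℝ} {c d : ℕ → ℝ × ℝ → ℝ}

theorem contDiff_slice (h : ContDiffOn ℝ ∞ (fun z : (ℝ × ℝ) × ℝ => f z.1 z.2) {z | 0 < z.2})
    {t : ℝ} (ht : 0 < t) : ContDiff ℝ ∞ fun p => f p t :=
  contDiff_iff_contDiffAt.2 fun p =>
    (h.contDiffAt ((isOpen_lt continuous_const continuous_snd).mem_nhds ht)).comp p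
      (contDiffAt_id.prodMk contDiffAt_const)

theorem contDiff_partialSum (e : ℝ) {M : ℕ} (hc : ∀ k, 1 ≤ k → ContDiff ℝ ∞ (c k)) :
    ContDiff ℝ ∞ fun p => ∑ k ∈ Finset.Icc 1 M, e ^ k * c k p :=
  ContDiff.sum fun k hk => contDiff_const.mul (hc k (Finset.mem_Icc.1 hk).1)

theorem IsPert.contDiff_sub (h : IsPert q f c) {t : ℝ} (ht : 0 < t) (M : ℕ) :
    ContDiff ℝ ∞ fun p => f p t - ∑ k ∈ Finset.Icc 1 M, eps q t ^ k * c k p :=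
  (contDiff_slice h.smooth ht).sub (contDiff_partialSum _ h.coeff_smooth)

theorem IsPert.neg (h : IsPert q f c) : IsPert q (fun p t => -f p t) (fun k p => -c k p) where
  smooth := h.smooth.neg
  coeff_smooth k hk := (h.coeff_smooth k hk).neg
  expansion r M := by
    obtain ⟨C, hC⟩ := h.expansion r M
    refine ⟨C, hC.mono fun t ht p hp => ?_⟩
    have h1 : (fun p => -f p t - ∑ k ∈ Finset.Icc 1 M, eps q t ^ k * -c k p) =
        -fun p => f p t - ∑ k ∈ Finset.Icc 1 M, eps q t ^ k * c k p := by
      funext p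
      simp only [mul_neg, Finset.sum_neg_distrib, Pi.neg_apply]; ring
    have h2 := congrFun h1 p
    rw [h1, h2, Pi.neg_apply, abs_neg, fderiv_neg, norm_neg]
    exact ht p hp
  zero t ht := by rw [h.zero t ht, neg_zero]

theorem IsPert.add (hf : IsPert q f c) (hg : IsPert q g d) :
    IsPert q (fun p t => f p t + g p t) (fun k p => c k p + d k p) where
  smooth := hf.smooth.add hg.smooth
  coeff_smooth k hk := (hf.coeff_smooth k hk).add (hg.coeff_smooth k hk)
  expansion r M := by
    obtain ⟨C, hC⟩ := hf.expansion r M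
    obtain ⟨D, hD⟩ := hg.expansion r M
    refine ⟨C + D, ?_⟩
    filter_upwards [hC, hD, eventually_gt_atTop 0] with t h1 h2 ht p hp
    have h3 : (fun p => f p t + g p t - ∑ k ∈ Finset.Icc 1 M, eps q t ^ k * (c k p + d k p)) =
        (fun p => f p t - ∑ k ∈ Finset.Icc 1 M, eps q t ^ k * c k p) +
        fun p => g p t - ∑ k ∈ Finset.Icc 1 M, eps q t ^ k * d k p := by
      funext p
      simp only [mul_add, Finset.sum_add_distrib, Pi.add_apply]; ring
    have h4 := congrFun h3 p
    rw [h3, h4, Pi.add_apply, fderiv_add ((hf.contDiff_sub ht M).differentiable (by simp) p)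
      ((hg.contDiff_sub ht M).differentiable (by simp) p), add_mul]
    exact ⟨(abs_add_le _ _).trans (add_le_add (h1 p hp).1 (h2 p hp).1),
      (norm_add_le _ _).trans (add_le_add (h1 p hp).2 (h2 p hp).2)⟩
  zero t ht := by rw [hf.zero t ht, hg.zero t ht, add_zero]

/-- Uniqueness of asymptotic series: once the earlier coefficients vanish, dividing by `ε^k` and
letting `ε → 0` kills the `k`-th one. -/
theorem eq_zero_of_expansion_zero {V : Type*} [NormedAddCommGroup V] [NormedSpace ℝ V]
    (hq : 0 < q) {c : ℕ → V} (h : ∀ M : ℕ, ∃ C : ℝ, ∀ᶠ t in atTop,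
      ‖∑ k ∈ Finset.Icc 1 M, eps q t ^ k • c k‖ ≤ C * eps q t ^ (M + 1)) :
    ∀ k, 1 ≤ k → c k = 0 := by
  intro k
  induction k using Nat.strong_induction_on with
  | _ k ih =>
    intro hk
    obtain ⟨C, hC⟩ := h k
    have h1 : ∀ᶠ t in atTop, ‖c k‖ ≤ C * eps q t := by
      filter_upwards [hC, eventually_gt_atTop 0] with t ht h0
      have h2 : ∑ j ∈ Finset.Icc 1 k, eps q t ^ j • c j = eps q t ^ k • c k := by
        refine Finset.sum_eq_single_of_mem k (Finset.mem_Icc.2 ⟨hk, le_rfl⟩) fun j hj hne => ?_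
        have := Finset.mem_Icc.1 hj
        rw [ih j (lt_of_le_of_ne this.2 hne) this.1, smul_zero]
      have h3 := pow_pos (eps_pos q h0) k
      rw [h2, norm_smul, Real.norm_of_nonneg h3.le, pow_succ] at ht
      refine le_of_mul_le_mul_left ?_ h3
      linarith
    have h2 : Tendsto (fun t => C * eps q t) atTop (𝓝 0) := by
      simpa using (tendsto_eps hq).const_mul C
    exact norm_le_zero_iff.1 (ge_of_tendsto h2 h1)

theorem IsPert.coeff_zero (h : IsPert q f c) (hq : 0 < q) {k : ℕ} (hk : 1 ≤ k) : c k 0 = 0 := by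
  refine eq_zero_of_expansion_zero hq (c := fun k => c k 0) (fun M => ?_) k hk
  obtain ⟨C, hC⟩ := h.expansion 0 M
  refine ⟨C, ?_⟩
  filter_upwards [hC, eventually_gt_atTop 0] with t h1 ht
  have h2 := (h1 0 (by simp)).1
  rw [h.zero t ht, zero_sub, abs_neg] at h2
  simpa only [smul_eq_mul, Real.norm_eq_abs] using h2

/-- The function and all coefficients vanish at the origin, so the bound on the derivative of the
remainder yields an extra factor `‖p‖` by the mean value inequality. This factor pays for the later
division by the amplitude. -/
theorem IsPert.bound (h : IsPert q f c) (hq : 0 < q) (r : ℝ) (M : ℕ) :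
    ∃ C : ℝ, ∀ᶠ t in atTop, ∀ p : ℝ × ℝ, ‖p‖ ≤ r →
      |f p t - ∑ k ∈ Finset.Icc 1 M, eps q t ^ k * c k p| ≤ C * eps q t ^ (M + 1) * ‖p‖ := by
  obtain ⟨C, hC⟩ := h.expansion r M
  refine ⟨C, ?_⟩
  filter_upwards [hC, eventually_gt_atTop 0] with t h1 ht p hp
  have hr : 0 ≤ r := (norm_nonneg p).trans hp
  have h2 := (convex_closedBall (0 : ℝ × ℝ) r).norm_image_sub_le_of_norm_fderiv_le
    (f := fun p => f p t - ∑ k ∈ Finset.Icc 1 M, eps q t ^ k * c k p) (x := 0) (y := p)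
    (fun p _ => (h.contDiff_sub ht M).differentiable (by simp) p)
    (fun p hp => (h1 p (by simpa using hp)).2) (by simpa using hr) (by simpa using hp)
  have h3 : f 0 t - ∑ k ∈ Finset.Icc 1 M, eps q t ^ k * c k 0 = 0 := by
    rw [h.zero t ht, Finset.sum_eq_zero fun k hk => ?_, sub_zero]
    rw [h.coeff_zero hq (Finset.mem_Icc.1 hk).1, mul_zero]
  rwa [h3, sub_zero, sub_zero, Real.norm_eq_abs] at h2

theorem IsPert.of_expansion (hs : ContDiffOn ℝ ∞ (fun z : (ℝ × ℝ) × ℝ => f z.1 z.2) {z | 0 < z.2})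
    (hc : ∀ k, 1 ≤ k → ContDiff ℝ ∞ (c k)) (h : HasPowerExpansion 1 q f c)
    (h0 : ∀ t > 0, f 0 t = 0) : IsPert q f c := by
  refine ⟨hs, hc, fun r M => ?_, h0⟩
  obtain ⟨C₀, hC₀⟩ := h _ (isCompact_closedBall (0 : ℝ × ℝ) r) M 0 zero_le_one
  obtain ⟨C₁, hC₁⟩ := h _ (isCompact_closedBall (0 : ℝ × ℝ) r) M 1 le_rfl
  refine ⟨max C₀ C₁, ?_⟩
  filter_upwards [hC₀, hC₁, eventually_gt_atTop 0] with t h1 h2 ht p hp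
  have h3 := h1 p (by simpa using hp)
  have h4 := h2 p (by simpa using hp)
  rw [norm_iteratedFDeriv_zero, Real.norm_eq_abs] at h3
  rw [norm_iteratedFDeriv_one] at h4
  simp only [rpow_eq_eps_pow q _ ht, rpow_eq_eps_pow_succ q _ ht] at h3 h4
  have h5 := (pow_pos (eps_pos q ht) (M + 1)).le
  exact ⟨h3.trans (by gcongr; exact le_max_left _ _), h4.trans (by gcongr; exact le_max_right _ _)⟩

/-- The directional derivative along `e` of a perturbation of the Hamiltonian. -/
theorem IsPert.of_fderiv {e : ℝ × ℝ} (he : ‖e‖ ≤ 1)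
    (hs : ContDiffOn ℝ ∞ (fun z : (ℝ × ℝ) × ℝ => f z.1 z.2) {z | 0 < z.2})
    (hc : ∀ k, 1 ≤ k → ContDiff ℝ ∞ (c k)) (h : HasPowerExpansion 2 q f c)
    (h0 : ∀ t > 0, fderiv ℝ (fun p => f p t) 0 e = 0) :
    IsPert q (fun p t => fderiv ℝ (fun p => f p t) p e) (fun k p => fderiv ℝ (c k) p e) := by
  have hopen : IsOpen {z : (ℝ × ℝ) × ℝ | 0 < z.2} := isOpen_lt continuous_const continuous_snd
  refine ⟨?_, fun k hk => ((hc k hk).fderiv_right (m := ∞) (by simp)).clm_apply contDiff_const,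
    fun r M => ?_, h0⟩
  · have h1 : ContDiffOn ℝ ∞ (fun z : (ℝ × ℝ) × ℝ =>
        fderiv ℝ (fun z : (ℝ × ℝ) × ℝ => f z.1 z.2) z (e, 0)) {z | 0 < z.2} :=
      (hs.fderiv_of_isOpen hopen (m := ∞) (by simp)).clm_apply contDiffOn_const
    refine h1.congr fun z hz => ?_
    have h2 : HasFDerivAt (fun z : (ℝ × ℝ) × ℝ => f z.1 z.2) _ (z.1, z.2) :=
      ((hs.contDiffAt (hopen.mem_nhds hz)).differentiableAt (by simp)).hasFDerivAt
    have h3 := h2.comp (f := fun p => (p, z.2)) z.1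
      ((hasFDerivAt_id z.1).prodMk (hasFDerivAt_const z.2 z.1))
    have h4 : fderiv ℝ (fun p => f p z.2) z.1 = _ := h3.fderiv
    rw [h4]
    rfl
  · obtain ⟨C₁, hC₁⟩ := h _ (isCompact_closedBall (0 : ℝ × ℝ) r) M 1 one_le_two
    obtain ⟨C₂, hC₂⟩ := h _ (isCompact_closedBall (0 : ℝ × ℝ) r) M 2 le_rfl
    refine ⟨max C₁ C₂, ?_⟩
    filter_upwards [hC₁, hC₂, eventually_gt_atTop 0] with t h1 h2 ht p hp
    have h3 := h1 p (by simpa using hp)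
    have h4 := h2 p (by simpa using hp)
    rw [norm_iteratedFDeriv_one] at h3
    rw [← norm_iteratedFDeriv_fderiv, norm_iteratedFDeriv_one] at h4
    simp only [rpow_eq_eps_pow q _ ht, rpow_eq_eps_pow_succ q _ ht] at h3 h4
    have h5 := (pow_pos (eps_pos q ht) (M + 1)).le
    have hD : ContDiff ℝ ∞ fun p => f p t - ∑ k ∈ Finset.Icc 1 M, eps q t ^ k * c k p :=
      (contDiff_slice hs ht).sub (contDiff_partialSum _ hc)
    set D := fun p => f p t - ∑ k ∈ Finset.Icc 1 M, eps q t ^ k * c k p with hDdef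
    have h6 : (fun p => fderiv ℝ (fun p => f p t) p e -
        ∑ k ∈ Finset.Icc 1 M, eps q t ^ k * fderiv ℝ (c k) p e) = fun p => fderiv ℝ D p e := by
      funext p
      have h7 : HasFDerivAt D (fderiv ℝ (fun p => f p t) p -
          ∑ k ∈ Finset.Icc 1 M, eps q t ^ k • fderiv ℝ (c k) p) p :=
        ((contDiff_slice hs ht).differentiable (by simp) p).hasFDerivAt.fun_sub
          (HasFDerivAt.fun_sum fun k hk =>
            ((hc k (Finset.mem_Icc.1 hk).1).differentiable (by simp) p).hasFDerivAt.const_mul _)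
      rw [h7.fderiv]
      simp
    have h8 := congrFun h6 p
    rw [h6, h8]
    have h9 : HasFDerivAt (fun p => fderiv ℝ D p e)
        ((ContinuousLinearMap.apply ℝ ℝ e).comp (fderiv ℝ (fderiv ℝ D) p)) p :=
      (ContinuousLinearMap.apply ℝ ℝ e).hasFDerivAt.comp p
        (((hD.fderiv_right (m := ∞) (by simp)).differentiable (by simp) p).hasFDerivAt)
    rw [h9.fderiv]
    have h10 : ∀ L : (ℝ × ℝ) →L[ℝ] ℝ, ‖L e‖ ≤ ‖L‖ := fun L =>
      (L.le_opNorm e).trans (mul_le_of_le_one_right (norm_nonneg _) he)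
    refine ⟨((h10 _).trans h3).trans (by gcongr; exact le_max_left _ _), ?_⟩
    refine (ContinuousLinearMap.opNorm_le_bound _ (norm_nonneg _) fun v => ?_).trans
      (h4.trans (by gcongr; exact le_max_right _ _))
    exact (h10 _).trans ((fderiv ℝ (fderiv ℝ D) p).le_opNorm v)

end Perturbation

/-! ### The given system as a perturbed Hamiltonian field -/

section System

variable {q : ℕ} {E₀ : ℝ} {U : Set (ℝ × ℝ)} {H F : ℝ × ℝ → ℝ → ℝ} {H₀ : ℝ × ℝ → ℝ}
  {Hk Fk : ℕ → ℝ × ℝ → ℝ}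

theorem IsSystem.isCenter (h : IsSystem q E₀ U H F H₀ Hk Fk) : IsCenter E₀ U H₀ :=
  ⟨h.E₀_pos, h.isOpen_U, h.zero_mem_U, h.smooth_H₀, h.center, h.closed_levels, h.regular_levels⟩

/-- The perturbation of the Hamiltonian vector field of `H₀`. -/
theorem IsSystem.exists_pert (h : IsSystem q E₀ U H F H₀ Hk Fk) :
    ∃ (f₁ f₂ : ℝ × ℝ → ℝ → ℝ) (c₁ c₂ : ℕ → ℝ × ℝ → ℝ), IsPert q f₁ c₁ ∧ IsPert q f₂ c₂ ∧
      ∀ t > 0, ∀ p, (partialY (fun p => H p t) p, -partialX (fun p => H p t) p + F p t) =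
        hamField H₀ p + (f₁ p t, f₂ p t) := by
  have hs : ContDiffOn ℝ ∞ (fun z : (ℝ × ℝ) × ℝ => H z.1 z.2 - H₀ z.1) {z | 0 < z.2} :=
    h.smooth_H.sub (h.smooth_H₀.comp contDiff_fst).contDiffOn
  have hH : ∀ t > 0, Differentiable ℝ fun p => H p t := fun t ht =>
    (contDiff_slice h.smooth_H ht).differentiable (by simp)
  have hH₀ := h.isCenter.differentiable
  have hsub : ∀ t > 0, ∀ p, fderiv ℝ (fun p => H p t - H₀ p) p =
      fderiv ℝ (fun p => H p t) p - fderiv ℝ H₀ p := fun t ht p =>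
    fderiv_fun_sub (hH t ht p) (hH₀ p)
  have hzero : ∀ t > 0, fderiv ℝ (fun p => H p t - H₀ p) 0 = 0 := fun t ht => by
    rw [hsub t ht, h.isCenter.fderiv_zero, sub_zero]
    refine ContinuousLinearMap.ext fun v => ?_
    rw [fderiv_apply_eq_partial (hH t ht 0)]
    have h1 := h.partialX_H_zero t ht
    have h2 := h.partialY_H_zero t ht
    rw [Prod.mk_zero_zero] at h1 h2
    rw [h1, h2]; simp
  have h1 := IsPert.of_fderiv (e := (0, 1)) (by simp [Prod.norm_def]) hs h.smooth_Hk
    h.expansion_H fun t ht => by rw [hzero t ht]; rfl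
  have h2 := IsPert.of_fderiv (e := (1, 0)) (by simp [Prod.norm_def]) hs h.smooth_Hk
    h.expansion_H fun t ht => by rw [hzero t ht]; rfl
  have h3 := IsPert.of_expansion h.smooth_F h.smooth_Fk h.expansion_F h.F_zero
  refine ⟨_, _, _, _, h1, h2.neg.add h3, fun t ht p => ?_⟩
  simp only [hsub t ht, partialX_eq_fderiv (hH t ht p), partialY_eq_fderiv (hH t ht p), hamField,
    partialX_eq_fderiv (hH₀ p), partialY_eq_fderiv (hH₀ p), sub_apply,
    Prod.mk_add_mk]
  refine Prod.ext ?_ ?_ <;> simp only <;> ring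

end System

/-! ### Functions periodic in the angle -/

section Periodic

theorem exists_bound_of_periodic {P V : Type*} [TopologicalSpace P] [NormedAddCommGroup V] {T : ℝ}
    (hT : 0 < T) {f : P → ℝ → V} (hf : Continuous fun z : P × ℝ => f z.1 z.2)
    (hper : ∀ p, Function.Periodic (f p) T) {K : Set P} (hK : IsCompact K) :
    ∃ C, ∀ p ∈ K, ∀ φ, ‖f p φ‖ ≤ C := by
  obtain ⟨C, hC⟩ := (hK.prod (isCompact_Icc (a := 0) (b := T))).exists_bound_of_continuousOn
    hf.continuousOn
  refine ⟨C, fun p hp φ => ?_⟩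
  obtain ⟨φ', h1, h2⟩ := (hper p).exists_mem_Ico₀ hT φ
  rw [h2]
  exact hC (p, φ') ⟨hp, h1.1, h1.2.le⟩

theorem fderiv_add_of_periodic {V W : Type*} [NormedAddCommGroup V] [NormedSpace ℝ V]
    [NormedAddCommGroup W] [NormedSpace ℝ W] {f : V → W} {v : V} (h : ∀ z, f (z + v) = f z)
    (z : V) : fderiv ℝ f (z + v) = fderiv ℝ f z := by
  rw [← fderiv_comp_add_right, funext h]

/-- `f (s, φ)` is `2π`-periodic in `φ`. -/
def IsAnglePeriodic {V : Type*} (f : ℝ × ℝ → V) : Prop :=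
  ∀ s φ, f (s, φ + 2 * Real.pi) = f (s, φ)

theorem exists_eq_fst_smul {V : Type} [NormedAddCommGroup V] [NormedSpace ℝ V] [CompleteSpace V]
    {f : ℝ × ℝ → V} (hf : ContDiff ℝ ∞ f) (h0 : ∀ φ, f (0, φ) = 0) (hper : IsAnglePeriodic f) :
    ∃ g : ℝ × ℝ → V, ContDiff ℝ ∞ g ∧ IsAnglePeriodic g ∧ ∀ s φ, f (s, φ) = s • g (s, φ) := by
  let Q : ℝ × ℝ → V := fun z => f (z.2, z.1)
  have hQ : ContDiff ℝ ∞ Q := hf.comp (contDiff_snd.prodMk contDiff_fst)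
  refine ⟨fun z => hadamardQuot Q (z.2, z.1),
    (contDiff_hadamardQuot hQ).comp (contDiff_snd.prodMk contDiff_fst),
    fun s φ => hadamardQuot_add_of_periodic (fun φ s => hper s φ) _ _, fun s φ => ?_⟩
  have h1 := eq_add_hadamardQuot hQ φ s
  rwa [show Q (φ, 0) = 0 from h0 φ, zero_add] at h1

end Periodic

/-! ### The system in amplitude and angle -/

section AmplitudePerturbation

/-- A perturbation in the amplitude-angle variables `(s, φ)`, with its asymptotic series. -/
structure IsAmpPert (q : ℕ) (s₀ : ℝ) (a : ℝ × ℝ → ℝ → ℝ) (α : ℕ → ℝ × ℝ → ℝ) : Prop where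
  smooth : ContDiffOn ℝ ∞ (fun z : (ℝ × ℝ) × ℝ => a z.1 z.2) {z | 0 < z.1.1 ∧ 0 < z.2}
  periodic : ∀ t, IsAnglePeriodic fun z => a z t
  coeff_smooth : ∀ k, 1 ≤ k → ContDiff ℝ ∞ (α k)
  coeff_periodic : ∀ k, 1 ≤ k → IsAnglePeriodic (α k)
  expansion : ∀ M : ℕ, ∃ C : ℝ, ∀ᶠ t in atTop, ∀ s ∈ Set.Ioc 0 s₀, ∀ φ,
    |a (s, φ) t - ∑ k ∈ Finset.Icc 1 M, eps q t ^ k * α k (s, φ)| ≤ C * eps q t ^ (M + 1)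

variable {q : ℕ} {s₀ : ℝ} {a b : ℝ × ℝ → ℝ → ℝ} {α β : ℕ → ℝ × ℝ → ℝ}

theorem IsAmpPert.add (ha : IsAmpPert q s₀ a α) (hb : IsAmpPert q s₀ b β) :
    IsAmpPert q s₀ (fun z t => a z t + b z t) (fun k z => α k z + β k z) where
  smooth := ha.smooth.add hb.smooth
  periodic t s φ := by
    have h1 := ha.periodic t s φ
    have h2 := hb.periodic t s φ
    simp only at h1 h2 ⊢
    rw [h1, h2]
  coeff_smooth k hk := (ha.coeff_smooth k hk).add (hb.coeff_smooth k hk)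
  coeff_periodic k hk s φ := by
    simp only [ha.coeff_periodic k hk s φ, hb.coeff_periodic k hk s φ]
  expansion M := by
    obtain ⟨C, hC⟩ := ha.expansion M
    obtain ⟨D, hD⟩ := hb.expansion M
    refine ⟨C + D, ?_⟩
    filter_upwards [hC, hD] with t h1 h2 s hs φ
    have h3 : a (s, φ) t + b (s, φ) t -
        ∑ k ∈ Finset.Icc 1 M, eps q t ^ k * (α k (s, φ) + β k (s, φ)) =
        (a (s, φ) t - ∑ k ∈ Finset.Icc 1 M, eps q t ^ k * α k (s, φ)) +
        (b (s, φ) t - ∑ k ∈ Finset.Icc 1 M, eps q t ^ k * β k (s, φ)) := by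
      simp only [mul_add, Finset.sum_add_distrib]; ring
    rw [h3, add_mul]
    exact (abs_add_le _ _).trans (add_le_add (h1 s hs φ) (h2 s hs φ))

theorem IsAmpPert.mul_left (ha : IsAmpPert q s₀ a α) {m : ℝ × ℝ → ℝ} (hm : ContDiff ℝ ∞ m)
    (hper : IsAnglePeriodic m) :
    IsAmpPert q s₀ (fun z t => m z * a z t) (fun k z => m z * α k z) where
  smooth := (hm.comp contDiff_fst).contDiffOn.mul ha.smooth
  periodic t s φ := by
    have h1 := ha.periodic t s φ
    simp only at h1 ⊢
    rw [h1, hper]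
  coeff_smooth k hk := hm.mul (ha.coeff_smooth k hk)
  coeff_periodic k hk s φ := by
    simp only [ha.coeff_periodic k hk s φ, hper s φ]
  expansion M := by
    obtain ⟨C, hC⟩ := ha.expansion M
    obtain ⟨D, hD⟩ := exists_bound_of_periodic (f := fun s φ => m (s, φ)) Real.two_pi_pos
      hm.continuous hper (isCompact_Icc (a := 0) (b := s₀))
    refine ⟨D * C, ?_⟩
    filter_upwards [hC] with t h1 s hs φ
    have h3 : m (s, φ) * a (s, φ) t -
        ∑ k ∈ Finset.Icc 1 M, eps q t ^ k * (m (s, φ) * α k (s, φ)) =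
        m (s, φ) * (a (s, φ) t - ∑ k ∈ Finset.Icc 1 M, eps q t ^ k * α k (s, φ)) := by
      rw [mul_sub, Finset.mul_sum]
      congr 1
      exact Finset.sum_congr rfl fun k _ => by ring
    have h4 := hD s ⟨hs.1.le, hs.2⟩ φ
    rw [h3, abs_mul, mul_assoc]
    exact mul_le_mul h4 (h1 s hs φ) (abs_nonneg _) ((norm_nonneg _).trans h4)

/-- The coefficients vanish at the origin, so `c k (x (s, φ))` is smoothly divisible by `s`. For the
remainder, `‖x (s, φ)‖ ≤ s |D|` cancels the denominator and makes the bound uniform down to `s = 0`.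
-/
theorem IsAngleMap.exists_ampPert {E₀ : ℝ} {U : Set (ℝ × ℝ)} {H₀ : ℝ × ℝ → ℝ} {Ω : ℝ → ℝ}
    {x : ℝ × ℝ → ℝ × ℝ} (h : IsAngleMap E₀ U H₀ Ω x) (hq : 0 < q) {f : ℝ × ℝ → ℝ → ℝ}
    {c : ℕ → ℝ × ℝ → ℝ} (hf : IsPert q f c) :
    ∃ α, IsAmpPert q s₀ (fun z t => f (x z) t / z.1) α := by
  have hc : ∀ k, 1 ≤ k → ∃ g : ℝ × ℝ → ℝ, ContDiff ℝ ∞ g ∧ IsAnglePeriodic g ∧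
      ∀ s φ, c k (x (s, φ)) = s • g (s, φ) := fun k hk =>
    exists_eq_fst_smul (f := fun z => c k (x z)) ((hf.coeff_smooth k hk).comp h.smooth)
      (fun φ => by simp only [h.origin, hf.coeff_zero hq hk])
      (fun s φ => by simp only [h.periodic s φ])
  choose! α hα hαper hαeq using hc
  obtain ⟨x', hx', hx'per, hx'eq⟩ := exists_eq_fst_smul h.smooth h.origin h.periodic
  refine ⟨α, ?_, fun t s φ => ?_, hα, hαper, fun M => ?_⟩
  · have h1 : ContDiffOn ℝ ∞ (fun z : (ℝ × ℝ) × ℝ => f (x z.1) z.2) {z | 0 < z.1.1 ∧ 0 < z.2} :=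
      hf.smooth.comp (f := fun z : (ℝ × ℝ) × ℝ => (x z.1, z.2))
        ((h.smooth.comp contDiff_fst).prodMk contDiff_snd).contDiffOn fun z hz => hz.2
    exact h1.div (contDiff_fst.comp contDiff_fst).contDiffOn fun z hz => hz.1.ne'
  · simp only [h.periodic s φ]
  · obtain ⟨D, hD⟩ := exists_bound_of_periodic (f := fun s φ => x' (s, φ)) Real.two_pi_pos
      hx'.continuous hx'per (isCompact_Icc (a := 0) (b := s₀))
    obtain ⟨C, hC⟩ := hf.bound hq (|s₀| * |D|) M
    refine ⟨|C| * |D|, ?_⟩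
    filter_upwards [hC, eventually_gt_atTop 0] with t h1 ht s hs φ
    have h2 : ‖x (s, φ)‖ ≤ s * |D| := by
      rw [hx'eq, norm_smul, Real.norm_of_nonneg hs.1.le]
      exact mul_le_mul_of_nonneg_left ((hD s ⟨hs.1.le, hs.2⟩ φ).trans (le_abs_self D)) hs.1.le
    have h3 := h1 (x (s, φ)) (h2.trans (mul_le_mul_of_nonneg_right
      (hs.2.trans (le_abs_self s₀)) (abs_nonneg _)))
    have h4 : f (x (s, φ)) t / s - ∑ k ∈ Finset.Icc 1 M, eps q t ^ k * α k (s, φ) =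
        (f (x (s, φ)) t - ∑ k ∈ Finset.Icc 1 M, eps q t ^ k * c k (x (s, φ))) / s := by
      rw [sub_div, Finset.sum_div]
      congr 1
      refine Finset.sum_congr rfl fun k hk => ?_
      rw [hαeq k (Finset.mem_Icc.1 hk).1, smul_eq_mul]
      have := hs.1.ne'
      field_simp
    rw [h4, abs_div, abs_of_pos hs.1, div_le_iff₀ hs.1]
    have h5 := pow_pos (eps_pos q ht) (M + 1)
    calc _ ≤ C * eps q t ^ (M + 1) * ‖x (s, φ)‖ := h3
      _ ≤ |C| * eps q t ^ (M + 1) * (s * |D|) := by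
        gcongr
        exact le_abs_self C
      _ = _ := by ring

/-- The perturbed vector field in the amplitude-angle variables. -/
theorem IsAngleMap.exists_reduced_field {E₀ : ℝ} {U : Set (ℝ × ℝ)} {H₀ : ℝ × ℝ → ℝ} {Ω : ℝ → ℝ}
    {x : ℝ × ℝ → ℝ × ℝ} (h : IsAngleMap E₀ U H₀ Ω x) (hc : IsCenter E₀ U H₀) (hq : 0 < q)
    {f₁ f₂ : ℝ × ℝ → ℝ → ℝ} {c₁ c₂ : ℕ → ℝ × ℝ → ℝ} (h₁ : IsPert q f₁ c₁) (h₂ : IsPert q f₂ c₂) :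
    ∃ (a g : ℝ × ℝ → ℝ → ℝ) (α γ : ℕ → ℝ × ℝ → ℝ), IsAmpPert q (amp E₀) a α ∧
      IsAmpPert q (amp E₀) g γ ∧ ∀ s ∈ Set.Ioc 0 (amp E₀), ∀ φ t,
        hamField H₀ (x (s, φ)) + (f₁ (x (s, φ)) t, f₂ (x (s, φ)) t) =
          fderiv ℝ x (s, φ) (s * a (s, φ) t, Ω s + g (s, φ) t) := by
  obtain ⟨α₁, hα₁⟩ := h.exists_ampPert (s₀ := amp E₀) hq h₁
  obtain ⟨α₂, hα₂⟩ := h.exists_ampPert (s₀ := amp E₀) hq h₂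
  have hd0 : ∀ v, fderiv ℝ H₀ 0 v = 0 := fun v => by rw [hc.fderiv_zero]; rfl
  obtain ⟨K₁, hK₁, hK₁p, hK₁e⟩ := exists_eq_fst_smul (f := fun z => partialX H₀ (x z))
    ((contDiff_partialX hc.smooth).comp h.smooth)
    (fun φ => by simp only [h.origin, partialX_eq_fderiv (hc.differentiable _), hd0])
    (fun s φ => by simp only [h.periodic s φ])
  obtain ⟨K₂, hK₂, hK₂p, hK₂e⟩ := exists_eq_fst_smul (f := fun z => partialY H₀ (x z))
    ((contDiff_partialY hc.smooth).comp h.smooth)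
    (fun φ => by simp only [h.origin, partialY_eq_fderiv (hc.differentiable _), hd0])
    (fun s φ => by simp only [h.periodic s φ])
  have hxs : ContDiff ℝ ∞ fun z => fderiv ℝ x z (1, 0) :=
    (h.smooth.fderiv_right (m := ∞) (by simp)).clm_apply contDiff_const
  have hxsp : IsAnglePeriodic fun z => fderiv ℝ x z (1, 0) := fun s φ => by
    have h1 : ((s, φ + 2 * Real.pi) : ℝ × ℝ) = (s, φ) + (0, 2 * Real.pi) := by simp
    simp only [h1]
    rw [fderiv_add_of_periodic (v := (0, 2 * Real.pi)) fun z => ?_]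
    have h2 : z + (0, 2 * Real.pi) = (z.1, z.2 + 2 * Real.pi) := by ext <;> simp
    rw [h2, h.periodic]
  have hΩ : ContDiff ℝ ∞ fun z : ℝ × ℝ => Ω z.1 := h.freq_smooth.comp contDiff_fst
  -- Cramer's rule in the basis `∂_s x`, `∂_φ x` with determinant `s / Ω`. The relative amplitude
  -- rate is `(K₁ f₁ + K₂ f₂) / s`, where `∇H₀ = s (K₁, K₂)`; the angular one is `Ω (f₁ ∂_s x₂ - f₂
  -- ∂_s x₁) / s`.
  have ha := (hα₁.mul_left hK₁ hK₁p).add (hα₂.mul_left hK₂ hK₂p)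
  have hg := (hα₁.mul_left (m := fun z => Ω z.1 * (fderiv ℝ x z (1, 0)).2)
    (hΩ.mul hxs.snd) (fun s φ => by have := hxsp s φ; simp only at this ⊢; rw [this])).add
    (hα₂.mul_left (m := fun z => -(Ω z.1 * (fderiv ℝ x z (1, 0)).1))
    (hΩ.mul hxs.fst).neg (fun s φ => by have := hxsp s φ; simp only at this ⊢; rw [this]))
  refine ⟨_, _, _, _, ha, hg, fun s hs φ t => ?_⟩
  have hsI : s ∈ Set.Icc 0 (amp E₀) := ⟨hs.1.le, hs.2⟩
  have h3 := h.partial_amplitude hc.differentiable hsI φ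
  have h4 : ∀ a b : ℝ, fderiv ℝ x (s, φ) (a, b) =
      a • fderiv ℝ x (s, φ) (1, 0) + b • fderiv ℝ x (s, φ) (0, 1) := fun a b => by
    rw [← map_smul, ← map_smul, ← map_add]; simp
  have h5 := hK₁e s φ
  have h6 := hK₂e s φ
  have h7 := hs.1.ne'
  have h8 := (h.freq_pos s).ne'
  simp only [smul_eq_mul] at h5 h6
  rw [h4, h.fderiv_angle hsI]
  rw [h5, h6] at h3
  simp only [hamField, h5, h6]
  have h9 : K₁ (s, φ) * (fderiv ℝ x (s, φ) (1, 0)).1 +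
      K₂ (s, φ) * (fderiv ℝ x (s, φ) (1, 0)).2 = 1 := by
    apply mul_left_cancel₀ h7
    linear_combination h3
  generalize fderiv ℝ x (s, φ) (1, 0) = v at *
  generalize f₁ (x (s, φ)) t = w₁
  generalize f₂ (x (s, φ)) t = w₂
  refine Prod.ext ?_ ?_
  · simp only [Prod.fst_add, Prod.smul_fst, smul_eq_mul]
    field_simp
    linear_combination (-w₁) * h9
  · simp only [Prod.snd_add, Prod.smul_snd, smul_eq_mul]
    field_simp
    linear_combination (-w₂) * h9

end AmplitudePerturbation

/-! ### Partial sums in powers of the small parameter -/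

section PartialSum

/-- The partial sum `∑_{k=1}^N ε^k c_k` as a function of a point and `ε`. -/
def psum {P : Type*} (c : ℕ → P → ℝ) (N : ℕ) (z : P × ℝ) : ℝ :=
  ∑ k ∈ Finset.Icc 1 N, z.2 ^ k * c k z.1

variable {P : Type*} {c : ℕ → P → ℝ}

theorem psum_zero (z : P × ℝ) : psum c 0 z = 0 := by simp [psum]

theorem psum_succ (N : ℕ) (z : P × ℝ) :
    psum c (N + 1) z = psum c N z + z.2 ^ (N + 1) * c (N + 1) z.1 := by
  simp only [psum]
  exact Finset.sum_Icc_succ_top (by omega) _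

theorem psum_apply_zero (N : ℕ) (p : P) : psum c N (p, 0) = 0 :=
  Finset.sum_eq_zero fun k hk => by
    have := (Finset.mem_Icc.1 hk).1
    rw [zero_pow (by omega), zero_mul]

theorem contDiff_psum [NormedAddCommGroup P] [NormedSpace ℝ P]
    (hc : ∀ k, 1 ≤ k → ContDiff ℝ ∞ (c k)) (N : ℕ) : ContDiff ℝ ∞ (psum c N) :=
  ContDiff.sum fun k hk => (contDiff_snd.pow k).mul ((hc k (Finset.mem_Icc.1 hk).1).comp contDiff_fst)

theorem periodic_psum [AddGroup P] {v : P} (hc : ∀ k, 1 ≤ k → Function.Periodic (c k) v) (N : ℕ) :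
    Function.Periodic (psum c N) (v, 0) := fun z =>
  Finset.sum_congr rfl fun k hk => by
    rw [Prod.fst_add, Prod.snd_add, hc k (Finset.mem_Icc.1 hk).1, add_zero]

end PartialSum

/-! ### The averaging recursion -/

section Averaging

theorem contDiff_fderiv_apply {V W : Type*} [NormedAddCommGroup V] [NormedSpace ℝ V]
    [NormedAddCommGroup W] [NormedSpace ℝ W] {f : V → W} (hf : ContDiff ℝ ∞ f) (v : V) :
    ContDiff ℝ ∞ fun z => fderiv ℝ f z v :=
  (hf.fderiv_right (m := ∞) (by simp)).clm_apply contDiff_const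

theorem periodic_fderiv_apply {V W : Type*} [NormedAddCommGroup V] [NormedSpace ℝ V]
    [NormedAddCommGroup W] [NormedSpace ℝ W] {f : V → W} {u : V} (hf : Function.Periodic f u)
    (v : V) : Function.Periodic (fun z => fderiv ℝ f z v) u := fun z => by
  simp only [fderiv_add_of_periodic hf z]

theorem IsAnglePeriodic.periodic {V : Type*} {f : ℝ × ℝ → V} (h : IsAnglePeriodic f) :
    Function.Periodic f (0, 2 * Real.pi) := fun z => by
  have h1 : z + (0, 2 * Real.pi) = (z.1, z.2 + 2 * Real.pi) := by ext <;> simp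
  rw [h1, h]

/-- A periodic function is, up to its average, the angular derivative of a periodic function. -/
theorem exists_average {p : ℝ × ℝ → ℝ} (hp : ContDiff ℝ ∞ p)
    (hper : Function.Periodic p (0, 2 * Real.pi)) :
    ∃ (l : ℝ → ℝ) (b : ℝ × ℝ → ℝ), ContDiff ℝ ∞ l ∧ ContDiff ℝ ∞ b ∧
      Function.Periodic b (0, 2 * Real.pi) ∧ ∀ s φ, fderiv ℝ b (s, φ) (0, 1) = l s - p (s, φ) := by
  let l : ℝ → ℝ := fun s => ∫ τ in (0 : ℝ)..1, p (s, 2 * Real.pi * τ)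
  -- The primitive `∫₀^φ (l - p)`, rescaled to `[0, 1]` so that its smoothness follows from that of
  -- integrals with parameters.
  let b : ℝ × ℝ → ℝ := fun z => z.2 * ∫ τ in (0 : ℝ)..1, (l z.1 - p (z.1, z.2 * τ))
  have hl : ContDiff ℝ ∞ l := contDiff_intervalIntegral
    (f := fun w : ℝ × ℝ => p (w.1, 2 * Real.pi * w.2)) (hp.comp (by fun_prop))
  have hb : ContDiff ℝ ∞ b := contDiff_snd.mul (contDiff_intervalIntegral
    (f := fun w : (ℝ × ℝ) × ℝ => l w.1.1 - p (w.1.1, w.1.2 * w.2))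
    ((hl.comp (contDiff_fst.comp contDiff_fst)).sub (hp.comp (by fun_prop))))
  have hcont : ∀ s, Continuous fun φ => l s - p (s, φ) := fun s =>
    continuous_const.sub (hp.continuous.comp (by fun_prop))
  have hpp : ∀ s φ, p (s, φ + 2 * Real.pi) = p (s, φ) := fun s φ => by
    have := hper (s, φ)
    simpa using this
  have hbint : ∀ s φ, b (s, φ) = ∫ τ in (0 : ℝ)..φ, (l s - p (s, τ)) := fun s φ => by
    have := intervalIntegral.smul_integral_comp_mul_left (a := 0) (b := 1)
      (fun τ => l s - p (s, τ)) φ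
    rw [mul_zero, mul_one, smul_eq_mul] at this
    exact this
  have hmean : ∀ s, ∫ τ in (0 : ℝ)..2 * Real.pi, (l s - p (s, τ)) = 0 := fun s => by
    have := intervalIntegral.smul_integral_comp_mul_left (a := 0) (b := 1)
      (fun τ => p (s, τ)) (2 * Real.pi)
    rw [mul_zero, mul_one, smul_eq_mul] at this
    have hps : Continuous fun τ => p (s, τ) := hp.continuous.comp (by fun_prop)
    rw [intervalIntegral.integral_sub (f := fun _ => l s) (by simp)
      (hps.intervalIntegrable _ _), ← this, intervalIntegral.integral_const,
      smul_eq_mul, sub_zero]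
    simp only [l, sub_self]
  refine ⟨l, b, hl, hb, fun z => ?_, fun s φ => ?_⟩
  · obtain ⟨s, φ⟩ := z
    rw [Prod.mk_add_mk, add_zero, hbint, hbint, ← intervalIntegral.integral_add_adjacent_intervals
      ((hcont s).intervalIntegrable 0 φ) ((hcont s).intervalIntegrable φ (φ + 2 * Real.pi))]
    have h1 : Function.Periodic (fun φ => l s - p (s, φ)) (2 * Real.pi) := fun φ => by
      simp only [hpp]
    rw [h1.intervalIntegral_add_eq φ 0, zero_add, hmean, add_zero]
  · refine (hasDerivAt_snd (hb.differentiable (by simp)) s φ).unique ?_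
    simp only [hbint]
    exact intervalIntegral.integral_hasDerivAt_right ((hcont s).intervalIntegrable _ _)
      ((hcont s).stronglyMeasurableAtFilter _ _) (hcont s).continuousAt

/-- The defect of the averaged equation, divided by the energy: the time derivative of
`V = (s²/2) W` along the flow with relative perturbation `A`, `Γ`, minus `V L(√(2V), ε)`. -/
def avgDefect (q : ℕ) (Ω ρ : ℝ → ℝ) (A Γ W : (ℝ × ℝ) × ℝ → ℝ) (L : ℝ × ℝ → ℝ)
    (z : (ℝ × ℝ) × ℝ) : ℝ :=
  2 * A z * W z + z.1.1 * A z * fderiv ℝ W z ((1, 0), 0)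
    + (Ω z.1.1 + Γ z) * fderiv ℝ W z ((0, 1), 0)
    - 1 / (q : ℝ) * z.2 ^ (q + 1) * fderiv ℝ W z (0, 1) - W z * L (z.1.1 * ρ (W z), z.2)

/-- The approximate solution `W`, `L` of the averaged equation with an error of order `n`. -/
structure IsAveraged (q n : ℕ) (Ω ρ : ℝ → ℝ) (A Γ W : (ℝ × ℝ) × ℝ → ℝ) (L : ℝ × ℝ → ℝ) : Prop where
  smooth_W : ContDiff ℝ ∞ W
  smooth_L : ContDiff ℝ ∞ L
  periodic : Function.Periodic W ((0, 2 * Real.pi), 0)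
  W_zero : ∀ p, W (p, 0) = 1
  L_zero : ∀ u, L (u, 0) = 0
  defect : ∃ Q, ContDiff ℝ ∞ Q ∧ Function.Periodic Q ((0, 2 * Real.pi), 0) ∧
    ∀ z, avgDefect q Ω ρ A Γ W L z = z.2 ^ n * Q z

theorem fderiv_add_pow_mul {W : (ℝ × ℝ) × ℝ → ℝ} (hW : ContDiff ℝ ∞ W) {b : ℝ × ℝ → ℝ}
    (hb : ContDiff ℝ ∞ b) (n : ℕ) (z v : (ℝ × ℝ) × ℝ) :
    fderiv ℝ (fun z : (ℝ × ℝ) × ℝ => W z + z.2 ^ n * b z.1) z v =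
      fderiv ℝ W z v + (z.2 ^ n * fderiv ℝ b z.1 v.1 + n * z.2 ^ (n - 1) * b z.1 * v.2) := by
  have h1 : HasFDerivAt W (fderiv ℝ W z) z := (hW.differentiable (by simp) z).hasFDerivAt
  have h2 : HasFDerivAt b (fderiv ℝ b z.1) z.1 := (hb.differentiable (by simp) z.1).hasFDerivAt
  have h3 : HasFDerivAt (fun z : (ℝ × ℝ) × ℝ => b z.1) _ z := h2.comp z hasFDerivAt_fst
  have h4 : HasFDerivAt (fun z : (ℝ × ℝ) × ℝ => z.2 ^ n) _ z :=
    (hasFDerivAt_snd (𝕜 := ℝ) (p := z)).pow n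
  have h5 : HasFDerivAt (fun z : (ℝ × ℝ) × ℝ => W z + z.2 ^ n * b z.1) _ z := h1.add (h4.mul h3)
  rw [h5.fderiv]
  simp
  ring

/-- One order of averaging. A correction `ε^{m+1} b` of `W` and `ε^{m+1} l` of `L` changes the
defect at order `m + 1` to `Q + 2α + Ω ∂_φ b - l` at `ε = 0`. Choosing `l / Ω` as the mean over `φ`
of `(Q + 2α) / Ω` makes this solvable by a periodic `b`. -/
theorem IsAveraged.step {q m : ℕ} {Ω ρ : ℝ → ℝ} {A Γ W : (ℝ × ℝ) × ℝ → ℝ} {L : ℝ × ℝ → ℝ}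
    (h : IsAveraged q (m + 1) Ω ρ A Γ W L) (hq : 0 < q) (hΩ : ContDiff ℝ ∞ Ω)
    (hΩ0 : ∀ s, Ω s ≠ 0) (hρ : ContDiff ℝ ∞ ρ) (hρ1 : ρ 1 = 1) (hA : ContDiff ℝ ∞ A)
    (hΓ : ContDiff ℝ ∞ Γ) (hAp : Function.Periodic A ((0, 2 * Real.pi), 0))
    (hΓp : Function.Periodic Γ ((0, 2 * Real.pi), 0)) (hA0 : ∀ p, A (p, 0) = 0)
    (hΓ0 : ∀ p, Γ (p, 0) = 0) {α γ : ℝ × ℝ → ℝ} (hα : ContDiff ℝ ∞ α) (hγ : ContDiff ℝ ∞ γ)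
    (hαp : Function.Periodic α (0, 2 * Real.pi)) (hγp : Function.Periodic γ (0, 2 * Real.pi)) :
    ∃ (b : ℝ × ℝ → ℝ) (l : ℝ → ℝ), ContDiff ℝ ∞ b ∧ Function.Periodic b (0, 2 * Real.pi) ∧
      ContDiff ℝ ∞ l ∧ IsAveraged q (m + 2) Ω ρ (fun z => A z + z.2 ^ (m + 1) * α z.1)
        (fun z => Γ z + z.2 ^ (m + 1) * γ z.1) (fun z => W z + z.2 ^ (m + 1) * b z.1)
        (fun z => L z + z.2 ^ (m + 1) * l z.1) := by
  obtain ⟨Q, hQ, hQp, hQe⟩ := h.defect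
  have hQ0 : ContDiff ℝ ∞ fun p : ℝ × ℝ => Q (p, 0) := hQ.comp (by fun_prop)
  have hΩ' : ContDiff ℝ ∞ fun p : ℝ × ℝ => Ω p.1 := hΩ.comp contDiff_fst
  obtain ⟨l₁, b, hl₁, hb, hbp, hbl⟩ := exists_average
    (p := fun p => (Q (p, 0) + 2 * α p) / Ω p.1)
    ((hQ0.add (contDiff_const.mul hα)).div hΩ' fun p => hΩ0 p.1) (fun p => by
      have h1 := hQp (p, 0)
      rw [Prod.mk_add_mk, add_zero] at h1
      simp only [h1, hαp p, Prod.fst_add, add_zero])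
  let l : ℝ → ℝ := fun s => Ω s * l₁ s
  have hl : ContDiff ℝ ∞ l := hΩ.mul hl₁
  let W' : (ℝ × ℝ) × ℝ → ℝ := fun z => W z + z.2 ^ (m + 1) * b z.1
  have hb1 : ContDiff ℝ ∞ fun z : (ℝ × ℝ) × ℝ => b z.1 := hb.comp contDiff_fst
  have hε : ∀ k : ℕ, ContDiff ℝ ∞ fun z : (ℝ × ℝ) × ℝ => z.2 ^ k := fun k => contDiff_snd.pow k
  have hs : ContDiff ℝ ∞ fun z : (ℝ × ℝ) × ℝ => z.1.1 := contDiff_fst.comp contDiff_fst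
  have hW' : ContDiff ℝ ∞ W' := h.smooth_W.add ((hε _).mul hb1)
  have hb1p : Function.Periodic (fun z : (ℝ × ℝ) × ℝ => b z.1) ((0, 2 * Real.pi), 0) :=
    fun z => hbp z.1
  have hW'p : Function.Periodic W' ((0, 2 * Real.pi), 0) := fun z => by
    simp only [W', h.periodic z, hb1p z, Prod.snd_add, add_zero]
  -- The nonlinear term `W L (s ρ(W), ε)` with `W` shifted by `y.2 * b`. Hadamard's lemma in the
  -- shift isolates the factor `ε^{m+1}`, and the quotient vanishes at `ε = 0` because `L (·, 0) =
  -- 0`.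
  let K : ((ℝ × ℝ) × ℝ) × ℝ → ℝ := fun y =>
    (W y.1 + y.2 * b y.1.1) * L (y.1.1.1 * ρ (W y.1 + y.2 * b y.1.1), y.1.2)
  have hWb : ContDiff ℝ ∞ fun y : ((ℝ × ℝ) × ℝ) × ℝ => W y.1 + y.2 * b y.1.1 :=
    (h.smooth_W.comp contDiff_fst).add (contDiff_snd.mul (hb1.comp contDiff_fst))
  have hK : ContDiff ℝ ∞ K := hWb.mul (h.smooth_L.comp
    (((hs.comp contDiff_fst).mul (hρ.comp hWb)).prodMk (contDiff_snd.comp contDiff_fst)))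
  have hKp : ∀ z η, K (z + ((0, 2 * Real.pi), 0), η) = K (z, η) := fun z η => by
    have h1 := hbp z.1
    have h2 := h.periodic z
    have h3 : (z + ((0, 2 * Real.pi), 0)).1 = z.1 + (0, 2 * Real.pi) := rfl
    have h4 : (z.1 + (0, 2 * Real.pi)).1 = z.1.1 := by simp
    have h5 : (z + ((0, 2 * Real.pi), 0)).2 = z.2 := by simp
    simp only [K, h2, h3, h1, h4, h5]
  let D : (ℝ × ℝ) × ℝ → (ℝ × ℝ) × ℝ → ℝ := fun v z => fderiv ℝ W z v
  have hD : ∀ v, ContDiff ℝ ∞ (D v) := contDiff_fderiv_apply h.smooth_W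
  have hDp : ∀ v, Function.Periodic (D v) ((0, 2 * Real.pi), 0) := periodic_fderiv_apply h.periodic
  let B : ℝ × ℝ → ℝ × ℝ → ℝ := fun v z => fderiv ℝ b z v
  have hB : ∀ v, ContDiff ℝ ∞ fun z : (ℝ × ℝ) × ℝ => B v z.1 := fun v =>
    (contDiff_fderiv_apply hb v).comp contDiff_fst
  have hBp : ∀ v, Function.Periodic (B v) (0, 2 * Real.pi) := periodic_fderiv_apply hbp
  -- The new defect divided by `ε^{m+1}`. In the time-derivative term, `(m+1) ε^m ε^{q+1}` leaves
  -- `(m+1) ε^q`.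
  let Q₁ : (ℝ × ℝ) × ℝ → ℝ := fun z => Q z + 2 * (A z * b z.1 + α z.1 * W' z)
    + z.1.1 * (A z * B (1, 0) z.1 + α z.1 * (D ((1, 0), 0) z + z.2 ^ (m + 1) * B (1, 0) z.1))
    + (Ω z.1.1 + Γ z) * B (0, 1) z.1
    + γ z.1 * (D ((0, 1), 0) z + z.2 ^ (m + 1) * B (0, 1) z.1)
    - 1 / (q : ℝ) * ((m + 1) * z.2 ^ q * b z.1)
    - hadamardQuot K (z, z.2 ^ (m + 1)) - W' z * l (z.1.1 * ρ (W' z))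
  have hα1 : ContDiff ℝ ∞ fun z : (ℝ × ℝ) × ℝ => α z.1 := hα.comp contDiff_fst
  have hγ1 : ContDiff ℝ ∞ fun z : (ℝ × ℝ) × ℝ => γ z.1 := hγ.comp contDiff_fst
  have hΩ1 : ContDiff ℝ ∞ fun z : (ℝ × ℝ) × ℝ => Ω z.1.1 := hΩ.comp hs
  have hQ₁ : ContDiff ℝ ∞ Q₁ := by
    refine ContDiff.sub (ContDiff.sub (ContDiff.sub (ContDiff.add (ContDiff.add (ContDiff.add
      (ContDiff.add hQ (contDiff_const.mul ((hA.mul hb1).add (hα1.mul hW'))))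
      (hs.mul ((hA.mul (hB _)).add (hα1.mul ((hD _).add ((hε _).mul (hB _)))))))
      ((hΩ1.add hΓ).mul (hB _))) (hγ1.mul ((hD _).add ((hε _).mul (hB _)))))
      (contDiff_const.mul ((contDiff_const.mul (hε _)).mul hb1)))
      ((contDiff_hadamardQuot hK).comp (contDiff_id.prodMk (hε _))))
      (hW'.mul (hl.comp (hs.mul (hρ.comp hW'))))
  have hQ₁p : Function.Periodic Q₁ ((0, 2 * Real.pi), 0) := fun z => by
    have h3 : (z + ((0, 2 * Real.pi), 0)).1 = z.1 + (0, 2 * Real.pi) := rfl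
    have h4 : (z.1 + (0, 2 * Real.pi)).1 = z.1.1 := by simp
    have h5 : (z + ((0, 2 * Real.pi), 0)).2 = z.2 := by simp
    simp only [Q₁, hQp z, hAp z, hΓp z, hW'p z, hDp _ z, hadamardQuot_add_of_periodic hKp, h3,
      hbp z.1, hBp _ z.1, hαp z.1, hγp z.1, h4, h5]
  have hDs : ∀ p v, D (v, 0) (p, 0) = 0 := fun p v => by
    have h1 : HasFDerivAt W (fderiv ℝ W (p, 0)) (p, 0) :=
      (h.smooth_W.differentiable (by simp) _).hasFDerivAt
    have h2 : HasFDerivAt (fun p => W (p, 0)) _ p :=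
      h1.comp (f := fun p => (p, (0 : ℝ))) p ((hasFDerivAt_id p).prodMk (hasFDerivAt_const 0 p))
    have h3 : (fun p => W (p, 0)) = fun _ => 1 := funext h.W_zero
    rw [h3] at h2
    have h4 := DFunLike.congr_fun (h2.unique (hasFDerivAt_const 1 p)) v
    simpa using h4
  have hK0 : ∀ p, hadamardQuot K ((p, 0), 0) = 0 := fun p => by
    rw [hadamardQuot_zero]
    refine (hasDerivAt_snd (hK.differentiable (by simp)) (p, 0) 0).unique ?_
    have h1 : (fun η => K ((p, 0), η)) = fun _ => 0 := funext fun η => by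
      simp only [K, h.L_zero, mul_zero]
    rw [h1]
    exact hasDerivAt_const _ _
  -- The homological equation. At `ε = 0` the derivatives of `W` in `(s, φ)` vanish, so `γ` does not
  -- contribute; the time-derivative term drops out because `q > 0`.
  have hQ₁0 : ∀ p, Q₁ (p, 0) = 0 := fun p => by
    have h1 := hbl p.1 p.2
    have h2 := hΩ0 p.1
    simp only [Q₁, hA0, hΓ0, hDs, W', h.W_zero, hK0, hρ1, zero_pow (Nat.succ_ne_zero m),
      zero_pow hq.ne', B, h1, l, zero_mul, mul_zero, add_zero, zero_add, mul_one, sub_zero]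
    field_simp
    ring
  refine ⟨b, l, hb, hbp, hl, ⟨hW', h.smooth_L.add ((contDiff_snd.pow _).mul
    (hl.comp contDiff_fst)), hW'p, fun p => ?_, fun u => ?_, hadamardQuot Q₁,
    contDiff_hadamardQuot hQ₁, fun z => ?_, fun z => ?_⟩⟩
  · simp [h.W_zero]
  · simp [h.L_zero]
  · have h1 := hadamardQuot_add_of_periodic (v := (0, 2 * Real.pi)) (Q := Q₁)
      (fun p η => by have := hQ₁p (p, η); rwa [Prod.mk_add_mk, add_zero] at this) z.1 z.2
    obtain ⟨p, e⟩ := z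
    rwa [Prod.mk_add_mk, add_zero]
  · obtain ⟨p, e⟩ := z
    have h1 := eq_add_hadamardQuot hQ₁ p e
    rw [hQ₁0, zero_add, smul_eq_mul] at h1
    rw [pow_succ, mul_assoc, ← h1]
    have h2 := eq_add_hadamardQuot hK (p, e) (e ^ (m + 1))
    have h3 := hQe (p, e)
    simp only [avgDefect, fderiv_add_pow_mul h.smooth_W hb] at h3 ⊢
    simp only [K, zero_mul, add_zero, smul_eq_mul] at h2
    simp only [Q₁, W', D, B]
    have h4 : e ^ (q + 1) * e ^ (m + 1 - 1) = e ^ (m + 1) * e ^ q := by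
      rw [Nat.add_sub_cancel]; ring
    have h5 : fderiv ℝ b p (0 : ℝ × ℝ) = 0 := map_zero _
    simp only [h5, Nat.cast_add, Nat.cast_one]
    linear_combination h3 - h2 - 1 / (q : ℝ) * (m + 1) * b p * h4

/-- Each step appends one coefficient to the earlier ones without altering them, so a single pair of
sequences serves all `N`. The recursion runs over pairs carrying the proof of `IsAveraged`, starting
from `W = 1`, `L = 0` with zero defect. -/
theorem exists_averaging {q : ℕ} (hq : 0 < q) {Ω ρ : ℝ → ℝ} (hΩ : ContDiff ℝ ∞ Ω)
    (hΩ0 : ∀ s, Ω s ≠ 0) (hρ : ContDiff ℝ ∞ ρ) (hρ1 : ρ 1 = 1) {α γ : ℕ → ℝ × ℝ → ℝ}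
    (hα : ∀ k, 1 ≤ k → ContDiff ℝ ∞ (α k)) (hγ : ∀ k, 1 ≤ k → ContDiff ℝ ∞ (γ k))
    (hαp : ∀ k, 1 ≤ k → Function.Periodic (α k) (0, 2 * Real.pi))
    (hγp : ∀ k, 1 ≤ k → Function.Periodic (γ k) (0, 2 * Real.pi)) :
    ∃ (b : ℕ → ℝ × ℝ → ℝ) (l : ℕ → ℝ → ℝ), (∀ k, ContDiff ℝ ∞ (b k)) ∧
      (∀ k, Function.Periodic (b k) (0, 2 * Real.pi)) ∧ (∀ k, ContDiff ℝ ∞ (l k)) ∧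
      ∀ N, IsAveraged q (N + 1) Ω ρ (psum α N) (psum γ N) (fun z => 1 + psum b N z)
        (psum l N) := by
  let S : ℕ → Type := fun N => {w : ((ℝ × ℝ) × ℝ → ℝ) × (ℝ × ℝ → ℝ) //
    IsAveraged q (N + 1) Ω ρ (psum α N) (psum γ N) w.1 w.2}
  have hstep : ∀ N (w : S N), ∃ (y : (ℝ × ℝ → ℝ) × (ℝ → ℝ)) (w' : S (N + 1)),
      ContDiff ℝ ∞ y.1 ∧ Function.Periodic y.1 (0, 2 * Real.pi) ∧ ContDiff ℝ ∞ y.2 ∧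
      w'.1 = (fun z => w.1.1 z + z.2 ^ (N + 1) * y.1 z.1,
        fun z => w.1.2 z + z.2 ^ (N + 1) * y.2 z.1) := fun N w => by
    obtain ⟨b, l, hb, hbp, hl, hI⟩ := w.2.step hq hΩ hΩ0 hρ hρ1 (contDiff_psum hα N)
      (contDiff_psum hγ N) (periodic_psum hαp N) (periodic_psum hγp N) (psum_apply_zero N)
      (psum_apply_zero N) (hα _ N.succ_pos) (hγ _ N.succ_pos) (hαp _ N.succ_pos)
      (hγp _ N.succ_pos)
    have h1 : ∀ c : ℕ → ℝ × ℝ → ℝ, (fun z => psum c N z + z.2 ^ (N + 1) * c (N + 1) z.1) =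
        psum c (N + 1) := fun c => funext fun z => (psum_succ N z).symm
    rw [h1 α, h1 γ] at hI
    exact ⟨(b, l), ⟨_, hI⟩, hb, hbp, hl, rfl⟩
  choose y nxt hy using hstep
  have h0 : IsAveraged q (0 + 1) Ω ρ (psum α 0) (psum γ 0) (fun _ => 1) (fun _ => 0) :=
    ⟨contDiff_const, contDiff_const, fun _ => rfl, fun _ => rfl, fun _ => rfl, fun _ => 0,
      contDiff_const, fun _ => rfl, fun z => by simp [avgDefect, psum_zero]⟩
  let w : ∀ N, S N := fun N => Nat.rec ⟨(fun _ => 1, fun _ => 0), h0⟩ (fun N w => nxt N w) N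
  let b : ℕ → ℝ × ℝ → ℝ := fun k => (y (k - 1) (w (k - 1))).1
  let l : ℕ → ℝ → ℝ := fun k => (y (k - 1) (w (k - 1))).2
  have hw : ∀ N, (w N).1 = (fun z => 1 + psum b N z, psum l N) := fun N => by
    induction N with
    | zero =>
      refine Prod.ext ?_ ?_ <;> funext z <;> simp only [psum_zero, add_zero] <;> rfl
    | succ N ih =>
      have h1 := (hy N (w N)).2.2.2
      have h2 : (w (N + 1)).1 = (nxt N (w N)).1 := rfl
      rw [h2, h1, ih]
      refine Prod.ext ?_ ?_ <;> funext z <;> simp only [psum_succ, add_assoc] <;> rfl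
  refine ⟨b, l, fun k => (hy _ _).1, fun k => (hy _ _).2.1, fun k => (hy _ _).2.2.1, fun N => ?_⟩
  have h1 := (w N).2
  rw [hw N] at h1
  exact h1

end Averaging

/-! ### Inverting the transformed amplitude -/

section AmplitudeInverse

/-- The square root is composed with a smooth positive function that equals `x` for `x ≥ 1/2`. It
lets the recursion be carried out with globally smooth functions, although `√W` makes sense only
near `W = 1`. -/
theorem exists_smooth_sqrt : ∃ ρ : ℝ → ℝ, ContDiff ℝ ∞ ρ ∧
    ∀ x, 1 / 2 ≤ x → ρ x = Real.sqrt x := by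
  let m : ℝ → ℝ := fun x => 1 / 4 + Real.smoothTransition (4 * x - 1) * (x - 1 / 4)
  have hm : ContDiff ℝ ∞ m := contDiff_const.add
    ((Real.smoothTransition.contDiff.comp (by fun_prop)).mul (by fun_prop))
  have hpos : ∀ x, 0 < m x := fun x => by
    rcases le_total x (1 / 4) with h | h
    · simp only [m, Real.smoothTransition.zero_of_nonpos (by linarith : 4 * x - 1 ≤ 0)]
      norm_num
    · have := mul_nonneg (Real.smoothTransition.nonneg (4 * x - 1)) (sub_nonneg.2 h)
      simp only [m]
      linarith
  refine ⟨fun x => Real.sqrt (m x), hm.sqrt fun x => (hpos x).ne',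
    fun x hx => ?_⟩
  simp only [m, Real.smoothTransition.one_of_one_le (by linarith : 1 ≤ 4 * x - 1)]
  congr 1; ring

theorem exists_bound_amplitude {V : Type*} [NormedAddCommGroup V] {f : (ℝ × ℝ) × ℝ → V}
    (hf : Continuous f) (hper : Function.Periodic f ((0, 2 * Real.pi), 0)) (r : ℝ) :
    ∃ C, 0 < C ∧ ∀ s φ e, |s| ≤ r → |e| ≤ 1 → ‖f ((s, φ), e)‖ ≤ C := by
  obtain ⟨C, hC⟩ := exists_bound_of_periodic (P := ℝ × ℝ) (f := fun p φ => f ((p.1, φ), p.2))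
    Real.two_pi_pos (hf.comp (by fun_prop)) (fun p φ => by
      have := hper ((p.1, φ), p.2)
      simpa using this) ((isCompact_Icc (a := -r) (b := r)).prod (isCompact_Icc (a := -1) (b := 1)))
  refine ⟨max C 1, by positivity, fun s φ e hs he => (hC (s, e) ⟨?_, ?_⟩ φ).trans (le_max_left _ _)⟩
  · exact abs_le.1 hs
  · exact abs_le.1 he

/-- The map `s ↦ s √W` is a small perturbation of the identity for small `ε`. Cutting off in `s` and
in `ε` turns it into a smooth family of increasing bijections of the whole line, whose inverse is
smooth; where the cut-offs are inactive this inverts the original map. -/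
theorem exists_amplitude_inverse {ρ : ℝ → ℝ} (hρ : ContDiff ℝ ∞ ρ)
    (hρs : ∀ x, 1 / 2 ≤ x → ρ x = Real.sqrt x) {W : (ℝ × ℝ) × ℝ → ℝ} (hW : ContDiff ℝ ∞ W)
    (hper : Function.Periodic W ((0, 2 * Real.pi), 0)) (hW0 : ∀ p, W (p, 0) = 1) {s₀ : ℝ}
    (hs₀ : 0 < s₀) :
    ∃ (S : (ℝ × ℝ) × ℝ → ℝ) (δ : ℝ), 0 < δ ∧ ContDiff ℝ ∞ S ∧
      Function.Periodic S ((0, 2 * Real.pi), 0) ∧ (∀ p, S (p, 0) = p.1) ∧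
      (∀ φ e, S ((0, φ), e) = 0) ∧ ∀ e ∈ Set.Icc 0 δ, ∀ φ,
        (∀ s ∈ Set.Icc 0 s₀, 1 / 2 ≤ W ((s, φ), e) ∧
          S ((s * Real.sqrt (W ((s, φ), e)), φ), e) = s) ∧
        ∀ u, 0 ≤ u → u ≤ s₀ * Real.sqrt (W ((s₀, φ), e)) →
          S ((u, φ), e) ∈ Set.Icc 0 s₀ ∧
            S ((u, φ), e) * Real.sqrt (W ((S ((u, φ), e), φ), e)) = u := by
  let θ : ContDiffBump (0 : ℝ) := ⟨s₀, s₀ + 1, hs₀, by linarith⟩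
  have hθ1 : ∀ s ∈ Set.Icc 0 s₀, θ s = 1 := fun s hs =>
    θ.one_of_mem_closedBall (by
      rw [Metric.mem_closedBall, Real.dist_0_eq_abs, abs_of_nonneg hs.1]
      exact hs.2)
  have hθ0 : ∀ s, s₀ + 1 ≤ |s| → θ s = 0 := fun s hs =>
    θ.zero_of_le_dist (by rw [Real.dist_0_eq_abs]; exact hs)
  let h := hadamardQuot W
  have hh : ContDiff ℝ ∞ h := contDiff_hadamardQuot hW
  have hhp : Function.Periodic h ((0, 2 * Real.pi), 0) := fun z => by
    obtain ⟨p, e⟩ := z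
    rw [Prod.mk_add_mk, add_zero]
    exact hadamardQuot_add_of_periodic (fun p η => by
      have := hper (p, η); rwa [Prod.mk_add_mk, add_zero] at this) p e
  have hWh : ∀ p e, W (p, e) = 1 + e * h (p, e) := fun p e => by
    have := eq_add_hadamardQuot hW p e
    rwa [hW0, smul_eq_mul] at this
  let n : (ℝ × ℝ) × ℝ → ℝ := fun z => θ z.1.1 * h z
  have hn : ContDiff ℝ ∞ n := (θ.contDiff.comp (contDiff_fst.comp contDiff_fst)).mul hh
  have hnp : Function.Periodic n ((0, 2 * Real.pi), 0) := fun z => by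
    simp only [n, hhp z, Prod.fst_add, add_zero]
  have hn0 : ∀ s φ e, s₀ + 1 ≤ |s| → n ((s, φ), e) = 0 := fun s φ e hs => by
    simp only [n, hθ0 s hs, zero_mul]
  have hnd : ∀ s φ e, HasDerivAt (fun s => n ((s, φ), e)) (fderiv ℝ n ((s, φ), e) ((1, 0), 0)) s :=
    fun s φ e => ((hn.differentiable (by simp) ((s, φ), e)).hasFDerivAt).comp_hasDerivAt
      (f := fun s => ((s, φ), e)) s (((hasDerivAt_id s).prodMk (hasDerivAt_const s φ)).prodMk (hasDerivAt_const s e))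
  have hnd0 : ∀ s φ e, s₀ + 1 < |s| → fderiv ℝ n ((s, φ), e) ((1, 0), 0) = 0 := fun s φ e hs => by
    refine (hnd s φ e).unique ((hasDerivAt_const s (0 : ℝ)).congr_of_eventuallyEq ?_)
    filter_upwards [continuous_abs.continuousAt.eventually (lt_mem_nhds hs)] with s' hs'
    exact hn0 s' φ e (le_of_lt hs')
  obtain ⟨C₁, hC₁, hb₁⟩ := exists_bound_amplitude hn.continuous hnp (s₀ + 1)
  obtain ⟨C₂, hC₂, hb₂⟩ := exists_bound_amplitude
    (contDiff_fderiv_apply hn ((1, 0), 0)).continuous (periodic_fderiv_apply hnp ((1, 0), 0)) (s₀ + 1)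
  have hb₁' : ∀ s φ e, |e| ≤ 1 → |n ((s, φ), e)| ≤ C₁ := fun s φ e he => by
    rcases le_total |s| (s₀ + 1) with h1 | h1
    · exact hb₁ s φ e h1 he
    · rw [hn0 s φ e h1, abs_zero]; exact hC₁.le
  have hb₂' : ∀ s φ e, |e| ≤ 1 →
      |s * fderiv ℝ n ((s, φ), e) ((1, 0), 0)| ≤ (s₀ + 1) * C₂ := fun s φ e he => by
    rcases le_or_gt |s| (s₀ + 1) with h1 | h1
    · rw [abs_mul]
      exact mul_le_mul h1 (hb₂ s φ e h1 he) (abs_nonneg _) (by linarith)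
    · rw [hnd0 s φ e h1, mul_zero, abs_zero]; positivity
  obtain ⟨D, hD⟩ := (isCompact_Icc (a := (0 : ℝ)) (b := 2)).exists_bound_of_continuousOn
    (hρ.continuous_deriv (by simp)).continuousOn
  have hD0 : 0 ≤ D := (norm_nonneg _).trans (hD 0 ⟨le_rfl, zero_le_two⟩)
  -- `δ` is chosen so that the cut-off `w` stays within `1/4` of `1`, and so that the derivative of
  -- `ρ (w)` contributes at most `1/4` against `ρ (w) ≥ 1/2`. Hence `B` is strictly increasing in
  -- its last variable.
  set C := C₁ + (s₀ + 1) * C₂ * D + 1 with hC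
  have hCpos : 1 ≤ C := by
    have : 0 ≤ (s₀ + 1) * C₂ * D := by positivity
    linarith
  have hC0 : 0 < C := by linarith
  set δ := 1 / (8 * C) with hδ
  have hδ0 : 0 < δ := by positivity
  have hδC : δ * C = 1 / 8 := by rw [hδ]; field_simp
  let χb : ContDiffBump (0 : ℝ) := ⟨δ, 2 * δ, hδ0, by linarith⟩
  -- A bounded substitute for `ε`: the identity on `[0, δ]` and at most `2δ` in absolute value
  -- everywhere.
  let χ : ℝ → ℝ := fun e => e * χb e
  have hχ : ContDiff ℝ ∞ χ := contDiff_id.mul χb.contDiff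
  have hχle : ∀ e, |χ e| ≤ 2 * δ := fun e => by
    rcases le_total (2 * δ) |e| with h1 | h1
    · have h2 : χb.rOut ≤ dist e 0 := by rw [Real.dist_0_eq_abs]; exact h1
      simp only [χ, χb.zero_of_le_dist h2, mul_zero, abs_zero]
      positivity
    · rw [abs_mul, abs_of_nonneg χb.nonneg]
      exact (mul_le_of_le_one_right (abs_nonneg e) χb.le_one).trans h1
  have hχid : ∀ e ∈ Set.Icc 0 δ, χ e = e := fun e he => by
    have h1 : e ∈ Metric.closedBall 0 χb.rIn := by
      rw [Metric.mem_closedBall, Real.dist_0_eq_abs, abs_of_nonneg he.1]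
      exact he.2
    simp only [χ, χb.one_of_mem_closedBall h1, mul_one]
  have hχ1 : ∀ e, |χ e| ≤ 1 := fun e => (hχle e).trans (by nlinarith)
  let w : ℝ → ℝ → ℝ → ℝ := fun φ e s => 1 + χ e * n ((s, φ), χ e)
  have hw : ∀ φ e s, |w φ e s - 1| ≤ 1 / 4 := fun φ e s => by
    simp only [w, add_sub_cancel_left, abs_mul]
    calc |χ e| * |n ((s, φ), χ e)| ≤ (2 * δ) * C := by
          refine mul_le_mul (hχle e) ((hb₁' s φ _ (hχ1 e)).trans ?_) (abs_nonneg _) (by positivity)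
          have : 0 ≤ (s₀ + 1) * C₂ * D := by positivity
          linarith
      _ = 1 / 4 := by linarith
  have hw1 : ∀ φ e s, 1 / 2 ≤ w φ e s := fun φ e s => by linarith [(abs_le.1 (hw φ e s)).1]
  have hw2 : ∀ φ e s, w φ e s ≤ 2 := fun φ e s => by linarith [(abs_le.1 (hw φ e s)).2]
  let B : (ℝ × ℝ) × ℝ → ℝ := fun y => y.2 * ρ (w y.1.1 y.1.2 y.2)
  have hB : ContDiff ℝ ∞ B := by
    have hχy : ContDiff ℝ ∞ fun y : (ℝ × ℝ) × ℝ => χ y.1.2 :=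
      hχ.comp (contDiff_snd.comp contDiff_fst)
    refine contDiff_snd.mul (hρ.comp (contDiff_const.add (hχy.mul (hn.comp
      ((contDiff_snd.prodMk (contDiff_fst.comp contDiff_fst)).prodMk hχy)))))
  have hBd : ∀ φ e s, HasDerivAt (fun s => B ((φ, e), s)) (ρ (w φ e s) +
      χ e * (s * fderiv ℝ n ((s, φ), χ e) ((1, 0), 0)) * deriv ρ (w φ e s)) s := fun φ e s => by
    have h1 : HasDerivAt (fun s => w φ e s) (χ e * fderiv ℝ n ((s, φ), χ e) ((1, 0), 0)) s :=
      ((hnd s φ (χ e)).const_mul _).const_add 1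
    have h2 := (hasDerivAt_id s).mul
      (((hρ.differentiable (by simp) (w φ e s)).hasDerivAt).comp s h1)
    have h3 : (1 * (ρ ∘ fun s => w φ e s) s + id s * (deriv ρ (w φ e s) *
        (χ e * fderiv ℝ n ((s, φ), χ e) ((1, 0), 0)))) = ρ (w φ e s) +
      χ e * (s * fderiv ℝ n ((s, φ), χ e) ((1, 0), 0)) * deriv ρ (w φ e s) := by
      simp only [Function.comp_apply, id]; ring
    rw [h3] at h2
    exact h2
  have hBpos : ∀ φ e s, 0 < ρ (w φ e s) +
      χ e * (s * fderiv ℝ n ((s, φ), χ e) ((1, 0), 0)) * deriv ρ (w φ e s) := fun φ e s => by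
    have h1 : 1 / 2 ≤ ρ (w φ e s) := by
      rw [hρs _ (hw1 φ e s)]
      exact Real.le_sqrt_of_sq_le (by linarith [hw1 φ e s])
    have h2 : |χ e * (s * fderiv ℝ n ((s, φ), χ e) ((1, 0), 0)) * deriv ρ (w φ e s)| ≤ 1 / 4 := by
      rw [abs_mul, abs_mul]
      calc _ ≤ (2 * δ) * ((s₀ + 1) * C₂) * D := by
            gcongr
            · exact hχle e
            · exact hb₂' s φ _ (hχ1 e)
            · exact hD _ ⟨by linarith [hw1 φ e s], hw2 φ e s⟩
        _ ≤ (2 * δ) * C := by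
            rw [mul_assoc]
            refine mul_le_mul_of_nonneg_left ?_ (by positivity)
            linarith
        _ = 1 / 4 := by linarith
    linarith [(abs_le.1 h2).1]
  have hBmono : ∀ φ e, StrictMono fun s => B ((φ, e), s) := fun φ e =>
    strictMono_of_deriv_pos fun s => by rw [(hBd φ e s).deriv]; exact hBpos φ e s
  -- Outside the support of `θ` the map is the identity, which gives surjectivity by the
  -- intermediate value theorem.
  have hBfar : ∀ φ e s, s₀ + 1 ≤ |s| → B ((φ, e), s) = s := fun φ e s hs => by
    simp only [B, w, hn0 s φ _ hs, mul_zero, add_zero]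
    rw [hρs 1 (by norm_num), Real.sqrt_one, mul_one]
  obtain ⟨S₀, hS₀, hBS, hSB⟩ := exists_contDiff_inverse hB
    (fun z => by
      obtain ⟨⟨φ, e⟩, s⟩ := z
      rw [(hasDerivAt_snd (hB.differentiable (by simp)) (φ, e) s).unique (hBd φ e s)]
      exact hBpos φ e s)
    (fun z u => by
      obtain ⟨φ, e⟩ := z
      have h1 : (0 : ℝ) < |u| + (s₀ + 1) := by positivity
      refine mem_range_of_exists_le_of_exists_ge (f := fun s => B ((φ, e), s))
        (hB.continuous.comp (by fun_prop)) ⟨-(|u| + (s₀ + 1)), ?_⟩ ⟨|u| + (s₀ + 1), ?_⟩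
      · rw [hBfar _ _ _ (by rw [abs_neg, abs_of_pos h1]; linarith [abs_nonneg u])]
        linarith [neg_abs_le u]
      · rw [hBfar _ _ _ (by rw [abs_of_pos h1]; linarith [abs_nonneg u])]
        linarith [le_abs_self u])
  have hBW : ∀ s ∈ Set.Icc 0 s₀, ∀ φ, ∀ e ∈ Set.Icc 0 δ, 1 / 2 ≤ W ((s, φ), e) ∧
      B ((φ, e), s) = s * Real.sqrt (W ((s, φ), e)) := fun s hs φ e he => by
    have h1 : w φ e s = W ((s, φ), e) := by
      simp only [w, hχid e he, n, hθ1 s hs, one_mul, hWh]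
    have h2 := hw1 φ e s
    rw [h1] at h2
    refine ⟨h2, ?_⟩
    simp only [B, h1, hρs _ h2]
  have hBzero : ∀ φ e, B ((φ, e), 0) = 0 := fun φ e => by simp [B]
  refine ⟨fun z => S₀ ((z.1.2, z.2), z.1.1), δ, hδ0, hS₀.comp (by fun_prop), fun z => ?_,
    fun p => ?_, fun φ e => ?_, fun e he φ => ⟨fun s hs => ?_, fun u hu0 hu => ?_⟩⟩
  · obtain ⟨⟨u, φ⟩, e⟩ := z
    simp only [Prod.mk_add_mk, add_zero]
    have h1 : B ((φ + 2 * Real.pi, e), S₀ ((φ, e), u)) = B ((φ, e), S₀ ((φ, e), u)) := by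
      have := hnp ((S₀ ((φ, e), u), φ), χ e)
      simp only [Prod.mk_add_mk, add_zero] at this
      simp only [B, w, this]
    rw [hBS] at h1
    conv_lhs => rw [← h1]
    rw [hSB]
  · have h1 : B ((p.2, 0), p.1) = p.1 := by
      simp only [B, w, hχid 0 ⟨le_rfl, hδ0.le⟩, zero_mul, add_zero]
      rw [hρs 1 (by norm_num), Real.sqrt_one, mul_one]
    have h2 := hSB (p.2, 0) p.1
    rwa [h1] at h2
  · have h2 := hSB (φ, e) 0
    rwa [hBzero] at h2
  · have h1 := hBW s hs φ e he
    refine ⟨h1.1, ?_⟩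
    have h2 := hSB (φ, e) s
    rwa [h1.2] at h2
  · have h1 : B ((φ, e), S₀ ((φ, e), u)) = u := hBS _ _
    have h2 : S₀ ((φ, e), u) ∈ Set.Icc 0 s₀ := by
      constructor
      · rw [← (hBmono φ e).le_iff_le]
        simp only [h1, hBzero]; exact hu0
      · rw [← (hBmono φ e).le_iff_le]
        simp only [h1, (hBW s₀ ⟨hs₀.le, le_rfl⟩ φ e he).2]; exact hu
    refine ⟨h2, ?_⟩
    have h3 := (hBW _ h2 φ e he).2
    rw [h1] at h3
    exact h3.symm

end AmplitudeInverse

/-! ### Re-expansion of series whose terms depend on the small parameter -/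

section AsymptoticSeries

variable {P : Type} [NormedAddCommGroup P] [NormedSpace ℝ P]

/-- The remainders in the re-expansion of `D₀ + ∑ ε^k D_k (·, ε)` in powers of `ε`. -/
def reexpandRem (D : ℕ → P × ℝ → ℝ) : ℕ → P × ℝ → ℝ
  | 0 => hadamardQuot (D 0)
  | M + 1 => hadamardQuot fun z => reexpandRem D M z + D (M + 1) z

/-- The coefficients in the re-expansion of `D₀ + ∑ ε^k D_k (·, ε)` in powers of `ε`. -/
def reexpandCoeff (D : ℕ → P × ℝ → ℝ) (k : ℕ) (p : P) : ℝ :=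
  reexpandRem D (k - 1) (p, 0) + D k (p, 0)

variable {D : ℕ → P × ℝ → ℝ}

theorem contDiff_reexpandRem [FiniteDimensional ℝ P] (hD : ∀ k, ContDiff ℝ ∞ (D k)) (M : ℕ) :
    ContDiff ℝ ∞ (reexpandRem D M) := by
  have := FiniteDimensional.proper ℝ P
  induction M with
  | zero => exact contDiff_hadamardQuot (hD 0)
  | succ M ih => exact contDiff_hadamardQuot (ih.add (hD _))

theorem contDiff_reexpandCoeff [FiniteDimensional ℝ P] (hD : ∀ k, ContDiff ℝ ∞ (D k)) (k : ℕ) :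
    ContDiff ℝ ∞ (reexpandCoeff D k) :=
  ((contDiff_reexpandRem hD _).add (hD k)).comp (contDiff_id.prodMk contDiff_const)

theorem periodic_hadamardQuot {Q : P × ℝ → ℝ} {v : P} (h : Function.Periodic Q (v, 0)) :
    Function.Periodic (hadamardQuot Q) (v, 0) := fun z => by
  obtain ⟨p, e⟩ := z
  rw [Prod.mk_add_mk, add_zero]
  exact hadamardQuot_add_of_periodic (fun p η => by
    have := h (p, η); rwa [Prod.mk_add_mk, add_zero] at this) p e

theorem periodic_reexpandRem {v : P} (hD : ∀ k, Function.Periodic (D k) (v, 0)) (M : ℕ) :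
    Function.Periodic (reexpandRem D M) (v, 0) := by
  induction M with
  | zero => exact periodic_hadamardQuot (hD 0)
  | succ M ih => exact periodic_hadamardQuot (ih.add (hD _))

theorem periodic_reexpandCoeff {v : P} (hD : ∀ k, Function.Periodic (D k) (v, 0)) (k : ℕ) :
    Function.Periodic (reexpandCoeff D k) v := fun p => by
  have := ((periodic_reexpandRem hD (k - 1)).add (hD k)) (p, 0)
  rw [Prod.mk_add_mk, add_zero] at this
  exact this

/-- At each order the value at `ε = 0` of the current remainder plus the next term becomes the
coefficient, and the rest is divided by `ε` and carried on. -/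
theorem reexpand [FiniteDimensional ℝ P] (hD : ∀ k, ContDiff ℝ ∞ (D k)) (h0 : ∀ p, D 0 (p, 0) = 0)
    (M : ℕ) (p : P) (e : ℝ) : D 0 (p, e) + ∑ k ∈ Finset.Icc 1 M, e ^ k * D k (p, e) =
      ∑ k ∈ Finset.Icc 1 M, e ^ k * reexpandCoeff D k p + e ^ (M + 1) * reexpandRem D M (p, e) := by
  have := FiniteDimensional.proper ℝ P
  induction M with
  | zero =>
    have h1 := eq_add_hadamardQuot (hD 0) p e
    rw [h0, zero_add, smul_eq_mul] at h1
    simpa [reexpandRem] using h1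
  | succ M ih =>
    have h1 := eq_add_hadamardQuot ((contDiff_reexpandRem hD M).add (hD (M + 1))) p e
    rw [Finset.sum_Icc_succ_top (by omega), Finset.sum_Icc_succ_top (by omega), ← add_assoc, ih]
    simp only [smul_eq_mul] at h1
    simp only [reexpandRem, reexpandCoeff, Nat.add_sub_cancel]
    linear_combination e ^ (M + 1) * h1

end AsymptoticSeries

/-! ### The near-identity transformation and its late-time regime -/

section Reduction

/-- Twice the relative rate of change of `(s²/2) W` when `s' = s A` and `φ' = Ω + Γ`. -/
def energyRate (q : ℕ) (Ω : ℝ → ℝ) (W : (ℝ × ℝ) × ℝ → ℝ) (z : (ℝ × ℝ) × ℝ) (A Γ : ℝ) : ℝ :=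
  2 * A * W z + z.1.1 * A * fderiv ℝ W z ((1, 0), 0) + (Ω z.1.1 + Γ) * fderiv ℝ W z ((0, 1), 0)
    - 1 / (q : ℝ) * z.2 ^ (q + 1) * fderiv ℝ W z (0, 1)

/-- A near-identity transformation `V = (s²/2) W` that averages the system `s' = s a`,
`φ' = Ω + g` up to order `N`, with averaged field `V L(√(2V), ε)` and amplitude inverse `S`. -/
structure IsReduction (q N : ℕ) (E₀ : ℝ) (Ω : ℝ → ℝ) (a g : ℝ × ℝ → ℝ → ℝ) (α γ : ℕ → ℝ × ℝ → ℝ)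
    (W : (ℝ × ℝ) × ℝ → ℝ) (L : ℝ × ℝ → ℝ) (Q S : (ℝ × ℝ) × ℝ → ℝ) (δ : ℝ) : Prop where
  q_pos : 0 < q
  E₀_pos : 0 < E₀
  freq_smooth : ContDiff ℝ ∞ Ω
  pert_amp : IsAmpPert q (amp E₀) a α
  pert_angle : IsAmpPert q (amp E₀) g γ
  smooth_W : ContDiff ℝ ∞ W
  periodic_W : Function.Periodic W ((0, 2 * Real.pi), 0)
  W_zero : ∀ p, W (p, 0) = 1
  smooth_L : ContDiff ℝ ∞ L
  smooth_Q : ContDiff ℝ ∞ Q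
  periodic_Q : Function.Periodic Q ((0, 2 * Real.pi), 0)
  defect : ∀ z, 1 / 2 ≤ W z → energyRate q Ω W z (psum α N z) (psum γ N z) -
    W z * L (z.1.1 * Real.sqrt (W z), z.2) = z.2 ^ (N + 1) * Q z
  δ_pos : 0 < δ
  smooth_S : ContDiff ℝ ∞ S
  periodic_S : Function.Periodic S ((0, 2 * Real.pi), 0)
  S_eps_zero : ∀ p, S (p, 0) = p.1
  S_zero : ∀ φ e, S ((0, φ), e) = 0
  inverse : ∀ e ∈ Set.Icc 0 δ, ∀ φ,
    (∀ s ∈ Set.Icc 0 (amp E₀), 1 / 2 ≤ W ((s, φ), e) ∧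
      S ((s * Real.sqrt (W ((s, φ), e)), φ), e) = s) ∧
    ∀ u, 0 ≤ u → u ≤ amp E₀ * Real.sqrt (W ((amp E₀, φ), e)) →
      S ((u, φ), e) ∈ Set.Icc 0 (amp E₀) ∧
        S ((u, φ), e) * Real.sqrt (W ((S ((u, φ), e), φ), e)) = u

/-- The point `((s, φ), ε)` with transformed energy `w` and angle `φ` at time `t`. -/
def invPoint (q : ℕ) (S : (ℝ × ℝ) × ℝ → ℝ) (w φ t : ℝ) : (ℝ × ℝ) × ℝ :=
  ((S ((amp w, φ), eps q t), φ), eps q t)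

/-- The remainder in the averaged equation for `w`. -/
def averagedRem (q : ℕ) (Ω : ℝ → ℝ) (a g : ℝ × ℝ → ℝ → ℝ) (W : (ℝ × ℝ) × ℝ → ℝ) (L : ℝ × ℝ → ℝ)
    (S : (ℝ × ℝ) × ℝ → ℝ) (w φ t : ℝ) : ℝ :=
  (invPoint q S w φ t).1.1 ^ 2 / 2 * energyRate q Ω W (invPoint q S w φ t)
    (a (invPoint q S w φ t).1 t) (g (invPoint q S w φ t).1 t) - w * L (amp w, eps q t)

/-- The perturbation of the frequency in the transformed variables. -/
def angularPert (q : ℕ) (Ω : ℝ → ℝ) (g : ℝ × ℝ → ℝ → ℝ) (S : (ℝ × ℝ) × ℝ → ℝ) (w φ t : ℝ) : ℝ :=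
  Ω (invPoint q S w φ t).1.1 - Ω (amp w) + g (invPoint q S w φ t).1 t

/-- The terms whose sum with weights `ε^k` is asymptotic to `angularPert`. -/
def angularTerm (Ω : ℝ → ℝ) (γ : ℕ → ℝ × ℝ → ℝ) (S : (ℝ × ℝ) × ℝ → ℝ) (k : ℕ)
    (z : (ℝ × ℝ) × ℝ) : ℝ :=
  if k = 0 then Ω (S z) - Ω z.1.1 else γ k (S z, z.1.2)

/-- Times at which the transformation is close to the identity with tolerance `σ`. -/
structure IsLate (q : ℕ) (E₀ : ℝ) (W : (ℝ × ℝ) × ℝ → ℝ) (δ σ t : ℝ) : Prop where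
  pos : 0 < t
  eps_le : eps q t ≤ δ
  eps_le_one : eps q t ≤ 1
  close : ∀ s ∈ Set.Icc 0 (amp E₀), ∀ φ, |W ((s, φ), eps q t) - 1| ≤ σ ∧
    |W ((s, φ), eps q t) + s / 2 * fderiv ℝ W ((s, φ), eps q t) ((1, 0), 0) - 1| ≤ σ

/-- Write `f = 1 + ε · (Hadamard quotient)` and bound the quotient using periodicity. -/
theorem exists_close_to_one {f : (ℝ × ℝ) × ℝ → ℝ} (hf : ContDiff ℝ ∞ f)
    (hper : Function.Periodic f ((0, 2 * Real.pi), 0)) (h1 : ∀ p, f (p, 0) = 1) (r : ℝ) {σ : ℝ}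
    (hσ : 0 < σ) : ∃ η > 0, ∀ s φ e, |s| ≤ r → |e| ≤ η → |f ((s, φ), e) - 1| ≤ σ := by
  obtain ⟨C, hC, hb⟩ := exists_bound_amplitude (contDiff_hadamardQuot hf).continuous
    (periodic_hadamardQuot hper) r
  refine ⟨min 1 (σ / C), by positivity, fun s φ e hs he => ?_⟩
  have h2 := eq_add_hadamardQuot hf (s, φ) e
  rw [h1, smul_eq_mul] at h2
  rw [h2, add_sub_cancel_left, abs_mul]
  calc |e| * |hadamardQuot f ((s, φ), e)| ≤ σ / C * C := by
        refine mul_le_mul (he.trans (min_le_right _ _)) ?_ (abs_nonneg _) (by positivity)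
        exact hb s φ e hs (he.trans (min_le_left _ _))
    _ = σ := by field_simp

variable {q N : ℕ} {E₀ : ℝ} {Ω : ℝ → ℝ} {a g : ℝ × ℝ → ℝ → ℝ} {α γ : ℕ → ℝ × ℝ → ℝ}
  {W : (ℝ × ℝ) × ℝ → ℝ} {L : ℝ × ℝ → ℝ} {Q S : (ℝ × ℝ) × ℝ → ℝ} {δ : ℝ} {σ t : ℝ}

theorem IsReduction.fderiv_W_eps_zero (h : IsReduction q N E₀ Ω a g α γ W L Q S δ) (p v : ℝ × ℝ) :
    fderiv ℝ W (p, 0) (v, 0) = 0 := by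
  have h1 : HasFDerivAt W (fderiv ℝ W (p, 0)) (p, 0) :=
    (h.smooth_W.differentiable (by simp) _).hasFDerivAt
  have h2 : HasFDerivAt (fun p => W (p, 0)) _ p :=
    h1.comp (f := fun p => (p, (0 : ℝ))) p ((hasFDerivAt_id p).prodMk (hasFDerivAt_const 0 p))
  have h3 : (fun p => W (p, 0)) = fun _ => 1 := funext h.W_zero
  rw [h3] at h2
  have h4 := DFunLike.congr_fun (h2.unique (hasFDerivAt_const 1 p)) v
  simpa using h4

/-- The two quantities controlled are `V / E` and `∂_E V`; both equal `1` at `ε = 0`. -/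
theorem IsReduction.eventually_late (h : IsReduction q N E₀ Ω a g α γ W L Q S δ) (hσ : 0 < σ) :
    ∀ᶠ t in atTop, IsLate q E₀ W δ σ t := by
  obtain ⟨η₁, hη₁, h1⟩ := exists_close_to_one h.smooth_W h.periodic_W h.W_zero (amp E₀) hσ
  obtain ⟨η₂, hη₂, h2⟩ := exists_close_to_one
    (f := fun z => W z + z.1.1 / 2 * fderiv ℝ W z ((1, 0), 0))
    (h.smooth_W.add (((contDiff_fst.comp contDiff_fst).div_const 2).mul
      (contDiff_fderiv_apply h.smooth_W _)))
    (fun z => by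
      simp only [h.periodic_W z, periodic_fderiv_apply h.periodic_W _ z, Prod.fst_add, add_zero])
    (fun p => by simp only [h.W_zero, h.fderiv_W_eps_zero, mul_zero, add_zero]) (amp E₀) hσ
  have h3 : ∀ c > 0, ∀ᶠ t in atTop, eps q t ≤ c := fun c hc =>
    ((tendsto_eps h.q_pos).eventually (gt_mem_nhds hc)).mono fun t ht => le_of_lt ht
  filter_upwards [eventually_gt_atTop 0, h3 δ h.δ_pos, h3 1 one_pos, h3 η₁ hη₁, h3 η₂ hη₂]
    with t h4 h5 h6 h7 h8
  refine ⟨h4, h5, h6, fun s hs φ => ?_⟩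
  have h9 : |s| ≤ amp E₀ := by rw [abs_of_nonneg hs.1]; exact hs.2
  have h10 : |eps q t| = eps q t := abs_of_pos (eps_pos q h4)
  exact ⟨h1 s φ _ h9 (by rwa [h10]), h2 s φ _ h9 (by rwa [h10])⟩

theorem IsLate.eps_mem (hl : IsLate q E₀ W δ σ t) : eps q t ∈ Set.Icc 0 δ :=
  ⟨(eps_pos q hl.pos).le, hl.eps_le⟩

end Reduction

/-! ### Inverse transformation, remainder and angular perturbation -/

section ReductionEstimates

variable {q N : ℕ} {E₀ : ℝ} {Ω : ℝ → ℝ} {a g : ℝ × ℝ → ℝ → ℝ} {α γ : ℕ → ℝ × ℝ → ℝ}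
  {W : (ℝ × ℝ) × ℝ → ℝ} {L : ℝ × ℝ → ℝ} {Q S : (ℝ × ℝ) × ℝ → ℝ} {δ : ℝ} {σ t t₀ : ℝ}

/-- For late times `W ≥ 1 - σ` at the outer amplitude, so every `w ≤ (1 - σ) E₀` is within the range
where `S` is a true inverse. -/
theorem IsReduction.invPoint_spec (h : IsReduction q N E₀ Ω a g α γ W L Q S δ)
    (hl : IsLate q E₀ W δ σ t) {w : ℝ}
    (hw : w ∈ Set.Icc 0 ((1 - σ) * E₀)) (φ : ℝ) :
    (invPoint q S w φ t).1.1 ∈ Set.Icc 0 (amp E₀) ∧ 1 / 2 ≤ W (invPoint q S w φ t) ∧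
      (invPoint q S w φ t).1.1 * Real.sqrt (W (invPoint q S w φ t)) = amp w ∧
      (invPoint q S w φ t).1.1 ^ 2 / 2 * W (invPoint q S w φ t) = w := by
  have h1 := (h.inverse _ hl.eps_mem φ).2 (amp w) (amp_nonneg w) (by
    have h2 := (abs_le.1 (hl.close (amp E₀) ⟨amp_nonneg _, le_rfl⟩ φ).1).1
    have h3 : amp w ≤ amp E₀ * Real.sqrt (1 - σ) := by
      rw [amp, amp, ← Real.sqrt_mul (by linarith [h.E₀_pos])]
      exact Real.sqrt_le_sqrt (by linarith [hw.2])
    exact h3.trans (mul_le_mul_of_nonneg_left (Real.sqrt_le_sqrt (by linarith)) (amp_nonneg _)))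
  have h2 := ((h.inverse _ hl.eps_mem φ).1 _ h1.1).1
  refine ⟨h1.1, h2, h1.2, ?_⟩
  have h3 := congrArg (fun x => x ^ 2 / 2) h1.2
  simp only [mul_pow, amp_sq hw.1] at h3
  rw [Real.sq_sqrt (by linarith)] at h3
  simp only [invPoint]
  linarith

theorem IsReduction.invPoint_energy (h : IsReduction q N E₀ Ω a g α γ W L Q S δ)
    (hl : IsLate q E₀ W δ σ t) {E : ℝ} (hE : E ∈ Set.Icc 0 E₀) (φ : ℝ) :
    invPoint q S (E * W ((amp E, φ), eps q t)) φ t = ((amp E, φ), eps q t) := by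
  have h1 := (h.inverse _ hl.eps_mem φ).1 _ (amp_mem_Icc hE)
  have h2 : amp (E * W ((amp E, φ), eps q t)) =
      amp E * Real.sqrt (W ((amp E, φ), eps q t)) := by
    rw [amp, ← mul_assoc, Real.sqrt_mul (by linarith [hE.1]), ← amp]
  rw [invPoint, h2, h1.2]

theorem IsReduction.invPoint_pos (h : IsReduction q N E₀ Ω a g α γ W L Q S δ)
    (hl : IsLate q E₀ W δ σ t) {w : ℝ}
    (hw : w ∈ Set.Ioc 0 ((1 - σ) * E₀)) (φ : ℝ) : 0 < (invPoint q S w φ t).1.1 := by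
  have h1 := h.invPoint_spec hl ⟨hw.1.le, hw.2⟩ φ
  refine lt_of_le_of_ne h1.1.1 fun h2 => ?_
  have h3 := h1.2.2.1
  rw [← h2, zero_mul] at h3
  exact (amp_pos hw.1).ne h3

theorem IsReduction.contDiffAt_invPoint (h : IsReduction q N E₀ Ω a g α γ W L Q S δ)
    {z : ℝ × ℝ × ℝ} (hw : 0 < z.1) (ht : 0 < z.2.2) :
    ContDiffAt ℝ ∞ (fun z : ℝ × ℝ × ℝ => invPoint q S z.1 z.2.1 z.2.2) z := by
  have h1 : ContDiffAt ℝ ∞ (fun z : ℝ × ℝ × ℝ => amp z.1) z :=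
    (contDiffAt_amp hw).comp z contDiffAt_fst
  have h2 : ContDiffAt ℝ ∞ (fun z : ℝ × ℝ × ℝ => z.2.1) z := contDiffAt_fst.comp z contDiffAt_snd
  have h3 : ContDiffAt ℝ ∞ (fun z : ℝ × ℝ × ℝ => eps q z.2.2) z :=
    (contDiffAt_eps q ht).comp z (contDiffAt_snd.comp z contDiffAt_snd)
  exact ((h.smooth_S.contDiffAt.comp z ((h1.prodMk h2).prodMk h3)).prodMk h2).prodMk h3

theorem IsReduction.invPoint_add (h : IsReduction q N E₀ Ω a g α γ W L Q S δ) (w φ t : ℝ) :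
    invPoint q S w (φ + 2 * Real.pi) t = invPoint q S w φ t + ((0, 2 * Real.pi), 0) := by
  have h1 := h.periodic_S ((amp w, φ), eps q t)
  simp only [Prod.mk_add_mk, add_zero] at h1
  simp only [invPoint, h1, Prod.mk_add_mk, add_zero]

theorem IsAmpPert.contDiffAt {s₀ : ℝ} (ha : IsAmpPert q s₀ a α) {z : (ℝ × ℝ) × ℝ}
    (hs : 0 < z.1.1) (ht : 0 < z.2) :
    ContDiffAt ℝ ∞ (fun z : (ℝ × ℝ) × ℝ => a z.1 z.2) z :=
  ha.smooth.contDiffAt (((isOpen_lt continuous_const (continuous_fst.comp continuous_fst)).inter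
    (isOpen_lt continuous_const continuous_snd)).mem_nhds ⟨hs, ht⟩)

theorem IsReduction.contDiffAt_pert {s₀ : ℝ} (h : IsReduction q N E₀ Ω a g α γ W L Q S δ)
    {b : ℝ × ℝ → ℝ → ℝ} {β : ℕ → ℝ × ℝ → ℝ} (hb : IsAmpPert q s₀ b β) {z : ℝ × ℝ × ℝ}
    (hw : 0 < z.1) (ht : 0 < z.2.2) (hs : 0 < (invPoint q S z.1 z.2.1 z.2.2).1.1) :
    ContDiffAt ℝ ∞ (fun z : ℝ × ℝ × ℝ => b (invPoint q S z.1 z.2.1 z.2.2).1 z.2.2) z :=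
  (hb.contDiffAt (z := ((invPoint q S z.1 z.2.1 z.2.2).1, z.2.2)) hs ht).comp
    (f := fun z : ℝ × ℝ × ℝ => ((invPoint q S z.1 z.2.1 z.2.2).1, z.2.2)) z
    ((h.contDiffAt_invPoint hw ht).fst.prodMk (contDiffAt_snd.comp z contDiffAt_snd))

theorem IsReduction.contDiffAt_averagedRem (h : IsReduction q N E₀ Ω a g α γ W L Q S δ)
    {z : ℝ × ℝ × ℝ} (hw : 0 < z.1) (ht : 0 < z.2.2)
    (hs : 0 < (invPoint q S z.1 z.2.1 z.2.2).1.1) :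
    ContDiffAt ℝ ∞ (fun z : ℝ × ℝ × ℝ => averagedRem q Ω a g W L S z.1 z.2.1 z.2.2) z := by
  have hp := h.contDiffAt_invPoint hw ht
  have hs1 := hp.fst.fst
  have hW := h.smooth_W.contDiffAt.comp z hp
  have hD : ∀ v, ContDiffAt ℝ ∞
      (fun z : ℝ × ℝ × ℝ => fderiv ℝ W (invPoint q S z.1 z.2.1 z.2.2) v) z := fun v =>
    (contDiff_fderiv_apply h.smooth_W v).contDiffAt.comp z hp
  have ha := h.contDiffAt_pert h.pert_amp hw ht hs
  have hg := h.contDiffAt_pert h.pert_angle hw ht hs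
  have hΩ := h.freq_smooth.contDiffAt.comp z hs1
  have hL : ContDiffAt ℝ ∞ (fun z : ℝ × ℝ × ℝ => L (amp z.1, eps q z.2.2)) z :=
    h.smooth_L.contDiffAt.comp z (((contDiffAt_amp hw).comp z contDiffAt_fst).prodMk
      ((contDiffAt_eps q ht).comp z (contDiffAt_snd.comp z contDiffAt_snd)))
  refine ContDiffAt.sub (((hs1.pow 2).div_const 2).mul (ContDiffAt.sub (ContDiffAt.add
    (ContDiffAt.add ((contDiffAt_const.mul ha).mul hW) ((hs1.mul ha).mul (hD _)))
    ((hΩ.add hg).mul (hD _))) ((contDiffAt_const.mul (hp.snd.pow _)).mul (hD _))))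
    (contDiffAt_fst.mul hL)

theorem energyRate_add (hW : Function.Periodic W ((0, 2 * Real.pi), 0)) (z : (ℝ × ℝ) × ℝ)
    (A Γ : ℝ) : energyRate q Ω W (z + ((0, 2 * Real.pi), 0)) A Γ = energyRate q Ω W z A Γ := by
  simp only [energyRate, hW z, periodic_fderiv_apply hW _ z, Prod.fst_add, Prod.snd_add, add_zero]

theorem IsReduction.averagedRem_periodic (h : IsReduction q N E₀ Ω a g α γ W L Q S δ)
    (w φ t : ℝ) : averagedRem q Ω a g W L S w (φ + 2 * Real.pi) t =
      averagedRem q Ω a g W L S w φ t := by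
  have h1 : ∀ p, a (p + (0, 2 * Real.pi)) t = a p t := (h.pert_amp.periodic t).periodic
  have h2 : ∀ p, g (p + (0, 2 * Real.pi)) t = g p t := (h.pert_angle.periodic t).periodic
  simp only [averagedRem, h.invPoint_add, energyRate_add h.periodic_W, Prod.fst_add, h1, h2,
    add_zero]

/-- With the partial sums in place of `a` and `g` the rate minus the averaged field is exactly the
defect `ε^{N+1} Q`. The energy rate is affine in `a` and `g`, which produces the two correction
terms. -/
theorem IsReduction.averagedRem_eq (h : IsReduction q N E₀ Ω a g α γ W L Q S δ)
    (hl : IsLate q E₀ W δ σ t) {w : ℝ}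
    (hw : w ∈ Set.Icc 0 ((1 - σ) * E₀)) (φ : ℝ) (z : (ℝ × ℝ) × ℝ) (hz : z = invPoint q S w φ t) :
    averagedRem q Ω a g W L S w φ t = z.1.1 ^ 2 / 2 * (eps q t ^ (N + 1) * Q z +
      (2 * W z + z.1.1 * fderiv ℝ W z ((1, 0), 0)) * (a z.1 t - psum α N z) +
      fderiv ℝ W z ((0, 1), 0) * (g z.1 t - psum γ N z)) := by
  obtain ⟨h1, h2, h3, h4⟩ := h.invPoint_spec hl hw φ
  have h5 : z.2 = eps q t := by rw [hz]; rfl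
  rw [← hz] at h1 h2 h3 h4
  have h6 := h.defect z h2
  rw [h3, h5] at h6
  rw [averagedRem, ← hz]
  conv_lhs => enter [2, 1]; rw [← h4]
  simp only [energyRate] at h6 ⊢
  linear_combination z.1.1 ^ 2 / 2 * h6

theorem IsReduction.isRemainder (h : IsReduction q N E₀ Ω a g α γ W L Q S δ)
    (hl : ∀ t ≥ t₀, IsLate q E₀ W δ σ t) {C₁ C₂ : ℝ}
    (ha : ∀ t ≥ t₀, ∀ s ∈ Set.Ioc 0 (amp E₀), ∀ φ,
      |a (s, φ) t - psum α N ((s, φ), eps q t)| ≤ C₁ * eps q t ^ (N + 1))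
    (hg : ∀ t ≥ t₀, ∀ s ∈ Set.Ioc 0 (amp E₀), ∀ φ,
      |g (s, φ) t - psum γ N ((s, φ), eps q t)| ≤ C₂ * eps q t ^ (N + 1)) :
    IsRemainder q N ((1 - σ) * E₀) t₀ (averagedRem q Ω a g W L S) := by
  have hpos : ∀ t ≥ t₀, 0 < t := fun t ht => (hl t ht).pos
  have hzero : ∀ φ, ∀ t ≥ t₀, averagedRem q Ω a g W L S 0 φ t = 0 := fun φ t _ => by
    simp only [averagedRem, invPoint, amp_zero, h.S_zero]
    simp
  refine ⟨fun z hz => ?_, fun w _ φ t _ => h.averagedRem_periodic w φ t, hzero, ?_⟩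
  · have ht : t₀ ≤ z.2.2 := le_of_lt hz.2.2
    exact (h.contDiffAt_averagedRem hz.1.1 (hpos _ ht)
      (h.invPoint_pos (hl _ ht) ⟨hz.1.1, hz.1.2.le⟩ _)).contDiffWithinAt
  obtain ⟨B₁, hB₁, hb₁⟩ := exists_bound_amplitude h.smooth_Q.continuous h.periodic_Q (amp E₀)
  obtain ⟨B₂, hB₂, hb₂⟩ := exists_bound_amplitude
    (f := fun z => 2 * W z + z.1.1 * fderiv ℝ W z ((1, 0), 0))
    ((contDiff_const.mul h.smooth_W).add ((contDiff_fst.comp contDiff_fst).mul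
      (contDiff_fderiv_apply h.smooth_W _))).continuous
    (fun z => by
      simp only [h.periodic_W z, periodic_fderiv_apply h.periodic_W _ z, Prod.fst_add, add_zero])
    (amp E₀)
  obtain ⟨B₃, hB₃, hb₃⟩ := exists_bound_amplitude
    (contDiff_fderiv_apply h.smooth_W ((0, 1), 0)).continuous
    (periodic_fderiv_apply h.periodic_W _) (amp E₀)
  refine ⟨amp E₀ ^ 2 / 2 * (B₁ + B₂ * |C₁| + B₃ * |C₂|), fun w hw φ t ht => ?_⟩
  have hε := pow_pos (eps_pos q (hpos t ht)) (N + 1)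
  rw [rpow_eq_eps_pow_succ q N (hpos t ht)]
  -- The bounds on `a` and `g` hold only for positive amplitude; at `w = 0` the remainder vanishes.
  rcases hw.1.eq_or_lt with rfl | hw0
  · rw [hzero φ t ht, abs_zero]; positivity
  have h1 := h.invPoint_pos (hl t ht) ⟨hw0, hw.2⟩ φ
  have h2 := (h.invPoint_spec (hl t ht) hw φ).1
  have h3 : |eps q t| ≤ 1 := by
    rw [abs_of_pos (eps_pos q (hpos t ht))]; exact (hl t ht).eps_le_one
  have h4 : |(invPoint q S w φ t).1.1| ≤ amp E₀ := by rw [abs_of_pos h1]; exact h2.2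
  have h5 := ha t ht _ ⟨h1, h2.2⟩ φ
  have h6 := hg t ht _ ⟨h1, h2.2⟩ φ
  have h7 := hb₁ _ φ _ h4 h3
  have h8 := hb₂ _ φ _ h4 h3
  have h9 := hb₃ _ φ _ h4 h3
  have h5' := h5.trans (mul_le_mul_of_nonneg_right (le_abs_self C₁) hε.le)
  have h6' := h6.trans (mul_le_mul_of_nonneg_right (le_abs_self C₂) hε.le)
  rw [h.averagedRem_eq (hl t ht) hw φ _ rfl, abs_mul, abs_of_nonneg (by positivity)]
  have h10 : (invPoint q S w φ t).1.1 ^ 2 / 2 ≤ amp E₀ ^ 2 / 2 := by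
    have := pow_le_pow_left₀ h1.le h2.2 2
    linarith
  rw [mul_assoc]
  refine mul_le_mul h10 ?_ (abs_nonneg _) (by positivity)
  refine (abs_add_le _ _).trans ((add_le_add (abs_add_le _ _) le_rfl).trans ?_)
  simp only [abs_mul, abs_of_pos hε]
  have e1 := mul_le_mul_of_nonneg_left h7 hε.le
  have e2 := mul_le_mul h8 h5' (abs_nonneg _) hB₂.le
  have e3 := mul_le_mul h9 h6' (abs_nonneg _) hB₃.le
  have e4 : (B₁ + B₂ * |C₁| + B₃ * |C₂|) * eps q t ^ (N + 1) = eps q t ^ (N + 1) * B₁ +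
    B₂ * (|C₁| * eps q t ^ (N + 1)) + B₃ * (|C₂| * eps q t ^ (N + 1)) := by ring
  rw [e4]
  exact add_le_add (add_le_add e1 e2) e3

theorem IsReduction.contDiff_angularTerm (h : IsReduction q N E₀ Ω a g α γ W L Q S δ) (k : ℕ) :
    ContDiff ℝ ∞ (angularTerm Ω γ S k) := by
  unfold angularTerm
  rcases Nat.eq_zero_or_pos k with rfl | hk
  · simp only [if_true]
    exact (h.freq_smooth.comp h.smooth_S).sub
      (h.freq_smooth.comp (contDiff_fst.comp contDiff_fst))
  · simp only [if_neg hk.ne']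
    exact (h.pert_angle.coeff_smooth k hk).comp
      (h.smooth_S.prodMk (contDiff_snd.comp contDiff_fst))

theorem IsReduction.periodic_angularTerm (h : IsReduction q N E₀ Ω a g α γ W L Q S δ) (k : ℕ) :
    Function.Periodic (angularTerm Ω γ S k) ((0, 2 * Real.pi), 0) := fun z => by
  unfold angularTerm
  rcases Nat.eq_zero_or_pos k with rfl | hk
  · simp only [if_true, h.periodic_S z, Prod.fst_add, add_zero]
  · simp only [if_neg hk.ne', h.periodic_S z, Prod.fst_add, Prod.snd_add]
    exact h.pert_angle.coeff_periodic k hk _ _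

/-- Both `Ω (S) - Ω` and the coefficients of `g` at `S` still depend on `ε` through `S`, so the
series must be re-expanded. Its remainder is bounded uniformly down to `w = 0`, since all is smooth
in `√(2w)`. -/
theorem IsReduction.isAngularPerturbation (h : IsReduction q N E₀ Ω a g α γ W L Q S δ)
    (hσ : σ ∈ Set.Ioo (0 : ℝ) 1) (hl : ∀ t ≥ t₀, IsLate q E₀ W δ σ t) :
    IsAngularPerturbation q ((1 - σ) * E₀) t₀ (angularPert q Ω g S)
      (fun k w φ => reexpandCoeff (angularTerm Ω γ S) k (amp w, φ)) where
  smooth z hz := by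
    have ht : t₀ ≤ z.2.2 := le_of_lt hz.2.2
    have hp := h.contDiffAt_invPoint hz.1.1 (hl _ ht).pos
    have hg := h.contDiffAt_pert h.pert_angle hz.1.1 (hl _ ht).pos
      (h.invPoint_pos (hl _ ht) ⟨hz.1.1, hz.1.2.le⟩ _)
    exact (((h.freq_smooth.contDiffAt.comp z hp.fst.fst).sub (h.freq_smooth.contDiffAt.comp z
      ((contDiffAt_amp hz.1.1).comp z contDiffAt_fst))).add hg).contDiffWithinAt
  periodic w _ φ t _ := by
    have h2 : ∀ p, g (p + (0, 2 * Real.pi)) t = g p t := (h.pert_angle.periodic t).periodic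
    simp only [angularPert, h.invPoint_add, Prod.fst_add, h2, add_zero]
  coeff_smooth k _ z hz := by
    have h1 := (contDiff_reexpandCoeff h.contDiff_angularTerm k).contDiffAt.comp z
      (((contDiffAt_amp hz.1.1).comp z contDiffAt_fst).prodMk contDiffAt_snd)
    exact h1.contDiffWithinAt
  coeff_periodic k _ w _ φ := by
    have h1 := periodic_reexpandCoeff h.periodic_angularTerm k (amp w, φ)
    rwa [Prod.mk_add_mk, add_zero] at h1
  expansion M := by
    obtain ⟨C, hC⟩ := h.pert_angle.expansion M
    obtain ⟨B, hB, hb⟩ := exists_bound_amplitude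
      (contDiff_reexpandRem h.contDiff_angularTerm M).continuous
      (periodic_reexpandRem h.periodic_angularTerm M) (amp E₀)
    refine ⟨C + B, ?_⟩
    filter_upwards [hC, eventually_ge_atTop t₀] with t h1 ht w hw φ
    have hlt := hl t ht
    have h2 := h.invPoint_pos hlt hw φ
    have h3 := (h.invPoint_spec hlt ⟨hw.1.le, hw.2⟩ φ).1
    have h4 := h1 _ ⟨h2, h3.2⟩ φ
    simp only [rpow_eq_eps_pow q _ hlt.pos, rpow_eq_eps_pow_succ q _ hlt.pos]
    have hw1 : w ≤ E₀ := hw.2.trans (by nlinarith [hσ.1, h.E₀_pos])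
    have hε := pow_pos (eps_pos q hlt.pos) (M + 1)
    have h5 := hb (amp w) φ (eps q t)
      (by rw [abs_of_nonneg (amp_nonneg w)]; exact amp_le_amp hw1)
      (by rw [abs_of_pos (eps_pos q hlt.pos)]; exact hlt.eps_le_one)
    -- The zeroth term vanishes at `ε = 0` because `S` is then the identity in the amplitude.
    have h6 := reexpand h.contDiff_angularTerm (fun p => by
      simp only [angularTerm, if_true, h.S_eps_zero, sub_self]) M (amp w, φ) (eps q t)
    have h7 : ∑ k ∈ Finset.Icc 1 M, eps q t ^ k * angularTerm Ω γ S k ((amp w, φ), eps q t) =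
        ∑ k ∈ Finset.Icc 1 M, eps q t ^ k * γ k ((invPoint q S w φ t).1.1, φ) :=
      Finset.sum_congr rfl fun k hk => by
        have := (Finset.mem_Icc.1 hk).1
        simp only [angularTerm, if_neg (by omega : ¬k = 0), invPoint]
    have h8 : angularTerm Ω γ S 0 ((amp w, φ), eps q t) =
        Ω (invPoint q S w φ t).1.1 - Ω (amp w) := by
      simp only [angularTerm, if_true, invPoint]
    rw [h7, h8] at h6
    have h9 : angularPert q Ω g S w φ t -
        ∑ k ∈ Finset.Icc 1 M, eps q t ^ k * reexpandCoeff (angularTerm Ω γ S) k (amp w, φ) =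
        (g ((invPoint q S w φ t).1.1, φ) t -
          ∑ k ∈ Finset.Icc 1 M, eps q t ^ k * γ k ((invPoint q S w φ t).1.1, φ)) +
        eps q t ^ (M + 1) * reexpandRem (angularTerm Ω γ S) M ((amp w, φ), eps q t) := by
      have h10 : g (invPoint q S w φ t).1 t = g ((invPoint q S w φ t).1.1, φ) t := rfl
      rw [angularPert, h10]
      linear_combination h6
    rw [h9, add_mul]
    refine (abs_add_le _ _).trans (add_le_add h4 ?_)
    rw [abs_mul, abs_of_pos hε, mul_comm]
    exact mul_le_mul_of_nonneg_right h5 hε.le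

/-- At `E = 0` the amplitude is not differentiable, but the difference quotient of `E f` is `f`
itself, which is continuous. For `E > 0` the factor `1/s` from `ds/dE` combines with `E = s²/2` to
give `s/2`. -/
theorem hasDerivAt_energy_mul {f : (ℝ × ℝ) × ℝ → ℝ} (hf : ContDiff ℝ ∞ f) {E : ℝ} (hE : 0 ≤ E)
    (φ e : ℝ) : HasDerivAt (fun E => E * f ((amp E, φ), e)) (f ((amp E, φ), e) +
      amp E / 2 * fderiv ℝ f ((amp E, φ), e) ((1, 0), 0)) E := by
  rcases hE.eq_or_lt with rfl | hE
  · rw [amp_zero, zero_div, zero_mul, add_zero, hasDerivAt_iff_tendsto_slope]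
    have h1 : Tendsto (fun E => f ((amp E, φ), e)) (𝓝[≠] 0) (𝓝 (f ((amp 0, φ), e))) := by
      refine Tendsto.mono_left (Continuous.tendsto ?_ 0) nhdsWithin_le_nhds
      have := continuous_amp
      exact hf.continuous.comp (by fun_prop)
    rw [amp_zero] at h1
    refine h1.congr' ?_
    filter_upwards [self_mem_nhdsWithin] with E hE
    have hE' : E ≠ 0 := hE
    rw [slope_def_field]
    field_simp
    ring
  · have h1 := ((hf.differentiable (by simp) ((amp E, φ), e)).hasFDerivAt).comp_hasDerivAt
      (f := fun E => ((amp E, φ), e)) E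
      (((hasDerivAt_amp hE).prodMk (hasDerivAt_const E φ)).prodMk (hasDerivAt_const E e))
    have h2 := (hasDerivAt_id E).mul h1
    have h3 : (((amp E)⁻¹, (0 : ℝ)), (0 : ℝ)) = (amp E)⁻¹ • (((1 : ℝ), (0 : ℝ)), (0 : ℝ)) := by
      simp
    have h4 : (1 * (f ∘ fun E => ((amp E, φ), e)) E + id E * fderiv ℝ f ((amp E, φ), e)
        (((amp E)⁻¹, 0), 0)) = f ((amp E, φ), e) +
      amp E / 2 * fderiv ℝ f ((amp E, φ), e) ((1, 0), 0) := by
      have h5 := (amp_pos hE).ne'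
      have h6 := amp_sq hE.le
      rw [h3, map_smul, smul_eq_mul, Function.comp_apply, id, one_mul]
      field_simp
      linear_combination (-fderiv ℝ f ((amp E, φ), e) ((1, 0), 0)) * h6
    rw [h4] at h2
    exact h2

/-- The inverse is the energy `S²/2` of the recovered amplitude. -/
theorem IsReduction.isReversible (h : IsReduction q N E₀ Ω a g α γ W L Q S δ)
    (hl : ∀ t ≥ t₀, IsLate q E₀ W δ σ t) {v : ℕ → ℝ → ℝ → ℝ}
    (hv : ∀ E φ, ∀ t > 0, VN q N v E φ t = E * W ((amp E, φ), eps q t)) :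
    IsReversible q N E₀ σ t₀ v where
  bounds E hE φ t ht := by
    rw [hv E φ t (hl t ht).pos]
    have h1 := abs_le.1 ((hl t ht).close _ (amp_mem_Icc hE) φ).1
    constructor <;> nlinarith [hE.1]
  deriv_bounds E hE φ t ht := by
    have h1 : (fun e => VN q N v e φ t) = fun E => E * W ((amp E, φ), eps q t) :=
      funext fun E => hv E φ t (hl t ht).pos
    have h2 := abs_le.1 ((hl t ht).close _ (amp_mem_Icc hE) φ).2
    rw [h1, (hasDerivAt_energy_mul h.smooth_W hE.1 φ _).hasDerivWithinAt.derivWithin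
      (uniqueDiffOn_Icc h.E₀_pos E hE)]
    constructor <;> linarith
  inverse := by
    refine ⟨fun w φ t => (invPoint q S w φ t).1.1 ^ 2 / 2, fun z hz => ?_, fun w hw φ t ht => ?_,
      fun E hE φ t ht _ => ?_⟩
    · have ht : t₀ ≤ z.2.2 := le_of_lt hz.2.2
      exact (((h.contDiffAt_invPoint hz.1.1 (hl _ ht).pos).fst.fst.pow 2).div_const
        2).contDiffWithinAt
    · obtain ⟨h1, h2, h3, h4⟩ := h.invPoint_spec (hl t ht) hw φ
      refine ⟨⟨by positivity, ?_⟩, ?_⟩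
      · have h5 := pow_le_pow_left₀ h1.1 h1.2 2
        rw [amp_sq h.E₀_pos.le] at h5
        linarith
      · rw [hv _ φ t (hl t ht).pos, amp_sq_div_two h1.1]
        exact h4
    · simp only [hv E φ t (hl t ht).pos, h.invPoint_energy (hl t ht) hE, amp_sq hE.1]
      ring

end ReductionEstimates

/-! ### Equivalence of the original and the reduced equations -/

section Equivalence

variable {q N : ℕ} {E₀ : ℝ} {U : Set (ℝ × ℝ)} {H₀ : ℝ × ℝ → ℝ} {x : ℝ × ℝ → ℝ × ℝ} {Ω : ℝ → ℝ}
  {a g : ℝ × ℝ → ℝ → ℝ} {α γ : ℕ → ℝ × ℝ → ℝ} {W : (ℝ × ℝ) × ℝ → ℝ} {L : ℝ × ℝ → ℝ}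
  {Q S : (ℝ × ℝ) × ℝ → ℝ} {δ : ℝ} {σ t t₀ : ℝ}

/-- A curve is differentiable if and only if its amplitude and angle are. -/
theorem IsAngleMap.hasDerivAt_iff (h : IsAngleMap E₀ U H₀ Ω x) (hH : Differentiable ℝ H₀)
    {s φ : ℝ → ℝ} (hs : ContinuousAt s t) (hφ : ContinuousAt φ t)
    (hst : s t ∈ Set.Ioc 0 (amp E₀)) (u v : ℝ) :
    HasDerivAt (fun t => x (s t, φ t)) (fderiv ℝ x (s t, φ t) (u, v)) t ↔
      HasDerivAt s u t ∧ HasDerivAt φ v t := by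
  constructor
  · intro hd
    obtain ⟨G, hG, -, hl, -⟩ := h.exists_local_inverse hH hst (φ t)
    have h1 : HasFDerivAt G (fderiv ℝ G (x (s t, φ t))) (x (s t, φ t)) :=
      (hG.differentiableAt (by simp)).hasFDerivAt
    have h2 := h1.comp_hasDerivAt t hd
    have h3 : (fderiv ℝ G (x (s t, φ t))).comp (fderiv ℝ x (s t, φ t)) =
        ContinuousLinearMap.id ℝ (ℝ × ℝ) :=
      ((h1.comp _ (h.hasFDerivAt (s t, φ t))).congr_of_eventuallyEq
        (hl.mono fun z hz => hz.symm)).unique (hasFDerivAt_id _)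
    have h4 : fderiv ℝ G (x (s t, φ t)) (fderiv ℝ x (s t, φ t) (u, v)) = (u, v) :=
      DFunLike.congr_fun h3 (u, v)
    rw [h4] at h2
    have h5 : (fun t => (s t, φ t)) =ᶠ[𝓝 t] G ∘ fun t => x (s t, φ t) :=
      ((hs.prodMk hφ).eventually hl).mono fun t' ht' => ht'.symm
    have h6 := h2.congr_of_eventuallyEq h5
    exact ⟨hasDerivAt_fst_comp h6, hasDerivAt_snd_comp h6⟩
  · rintro ⟨h1, h2⟩
    exact (h.hasFDerivAt (s t, φ t)).comp_hasDerivAt t (h1.prodMk h2)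

/-- The rate of change of `(s²/2) W` along a curve. -/
theorem hasDerivAt_transformed (hq : 0 < q) (hW : ContDiff ℝ ∞ W) {s φ : ℝ → ℝ} {u v : ℝ}
    (ht : 0 < t) (hs : HasDerivAt s u t) (hφ : HasDerivAt φ v t) (z : (ℝ × ℝ) × ℝ)
    (hz : z = ((s t, φ t), eps q t)) :
    HasDerivAt (fun t => s t ^ 2 / 2 * W ((s t, φ t), eps q t))
      (z.1.1 * u * (W z + z.1.1 / 2 * fderiv ℝ W z ((1, 0), 0)) + z.1.1 ^ 2 / 2 *
        (v * fderiv ℝ W z ((0, 1), 0) - 1 / (q : ℝ) * z.2 ^ (q + 1) * fderiv ℝ W z (0, 1))) t := by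
  have h1 : HasFDerivAt W (fderiv ℝ W z) ((s t, φ t), eps q t) := by
    rw [hz]; exact (hW.differentiable (by simp) _).hasFDerivAt
  have h2 := h1.comp_hasDerivAt t ((hs.prodMk hφ).prodMk (hasDerivAt_eps hq ht))
  have h3 := ((hs.fun_pow 2).div_const 2).mul h2
  have h4 : ∀ c d e : ℝ, fderiv ℝ W z ((c, d), e) = c * fderiv ℝ W z ((1, 0), 0) +
      d * fderiv ℝ W z ((0, 1), 0) + e * fderiv ℝ W z (0, 1) := fun c d e => by
    have h5 : (((c, d), e) : (ℝ × ℝ) × ℝ) = c • ((1, 0), 0) + d • ((0, 1), 0) + e • (0, 1) := by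
      simp
    rw [h5, map_add, map_add, map_smul, map_smul, map_smul]
    simp only [smul_eq_mul]
  rw [h4] at h3
  have h5 : (W ∘ fun t => ((s t, φ t), eps q t)) t = W z := by rw [hz]; rfl
  rw [h5] at h3
  have h6 : s t = z.1.1 := by rw [hz]
  have h7 : eps q t = z.2 := by rw [hz]
  have h8 := h3
  rw [h6, h7] at h8
  have h9 : ((2 : ℕ) : ℝ) * z.1.1 ^ (2 - 1) * u / 2 * W z + z.1.1 ^ 2 / 2 *
      (u * fderiv ℝ W z ((1, 0), 0) + v * fderiv ℝ W z ((0, 1), 0) +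
        -(1 / (q : ℝ)) * z.2 ^ (q + 1) * fderiv ℝ W z (0, 1)) =
      (z.1.1 * u * (W z + z.1.1 / 2 * fderiv ℝ W z ((1, 0), 0)) + z.1.1 ^ 2 / 2 *
        (v * fderiv ℝ W z ((0, 1), 0) - 1 / (q : ℝ) * z.2 ^ (q + 1) * fderiv ℝ W z (0, 1))) := by
    push_cast
    ring
  rw [h9] at h8
  exact h8

/-- In the transformed variables, the perturbed system becomes the averaged one. -/
theorem IsReduction.hasDerivAt_iff (h : IsReduction q N E₀ Ω a g α γ W L Q S δ)
    (hl : IsLate q E₀ W δ σ t) (hlate : ∀ᶠ t' in 𝓝 t, IsLate q E₀ W δ σ t') (hσ : σ < 1)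
    {E φ V : ℝ → ℝ} (hE : ContinuousAt E t) (hEt : E t ∈ Set.Ioo 0 E₀)
    (hV : ∀ᶠ t in 𝓝 t, V t = E t * W ((amp (E t), φ t), eps q t)) :
    (HasDerivAt (fun t => amp (E t)) (amp (E t) * a (amp (E t), φ t) t) t ∧
      HasDerivAt φ (Ω (amp (E t)) + g (amp (E t), φ t) t) t) ↔
    (HasDerivAt V (V t * L (amp (V t), eps q t) + averagedRem q Ω a g W L S (V t) (φ t) t) t ∧
      HasDerivAt φ (Ω (amp (V t)) + angularPert q Ω g S (V t) (φ t) t) t) := by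
  have hmem : ∀ᶠ t' in 𝓝 t, E t' ∈ Set.Ioo 0 E₀ := hE.eventually (isOpen_Ioo.mem_nhds hEt)
  have hEI : E t ∈ Set.Icc 0 E₀ := ⟨hEt.1.le, hEt.2.le⟩
  have hVt := hV.self_of_nhds
  have hp : invPoint q S (V t) (φ t) t = ((amp (E t), φ t), eps q t) := by
    rw [hVt]; exact h.invPoint_energy hl hEI _
  set z : (ℝ × ℝ) × ℝ := ((amp (E t), φ t), eps q t) with hz
  have hΩ : Ω (amp (V t)) + angularPert q Ω g S (V t) (φ t) t =
      Ω (amp (E t)) + g (amp (E t), φ t) t := by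
    simp only [angularPert, hp]
    ring
  have hR : V t * L (amp (V t), eps q t) + averagedRem q Ω a g W L S (V t) (φ t) t =
      amp (E t) ^ 2 / 2 * energyRate q Ω W z (a (amp (E t), φ t) t) (g (amp (E t), φ t) t) := by
    simp only [averagedRem, hp]
    ring
  have hVs : V =ᶠ[𝓝 t] fun t => amp (E t) ^ 2 / 2 * W ((amp (E t), φ t), eps q t) := by
    filter_upwards [hV, hmem] with t' h1 h2
    rw [h1, amp_sq h2.1.le]; ring
  rw [hΩ, hR]
  refine ⟨fun ⟨h1, h2⟩ => ⟨?_, h2⟩, fun ⟨h1, h2⟩ => ⟨?_, h2⟩⟩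
  · have h3 := (hasDerivAt_transformed h.q_pos h.smooth_W hl.pos h1 h2 z rfl).congr_of_eventuallyEq
      hVs
    have h4 : z.1.1 * (amp (E t) * a (amp (E t), φ t) t) *
        (W z + z.1.1 / 2 * fderiv ℝ W z ((1, 0), 0)) + z.1.1 ^ 2 / 2 *
        ((Ω (amp (E t)) + g (amp (E t), φ t) t) * fderiv ℝ W z ((0, 1), 0) -
          1 / (q : ℝ) * z.2 ^ (q + 1) * fderiv ℝ W z (0, 1)) =
        amp (E t) ^ 2 / 2 * energyRate q Ω W z (a (amp (E t), φ t) t) (g (amp (E t), φ t) t) := by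
      simp only [energyRate, z]
      ring
    rw [h4] at h3
    exact h3
  · have hspos := amp_pos hEt.1
    have hVpos : 0 < V t := by
      have := ((h.inverse _ hl.eps_mem (φ t)).1 _ (amp_mem_Icc hEI)).1
      rw [hVt]
      exact mul_pos hEt.1 (by linarith)
    -- Differentiability of the amplitude is not assumed: it follows because the amplitude is a
    -- smooth function of `V`, `φ` and `ε`.
    have h3 : (fun t => amp (E t)) =ᶠ[𝓝 t] fun t => S ((amp (V t), φ t), eps q t) := by
      filter_upwards [hV, hmem, hlate] with t' h4 h5 h6
      have h7 := h.invPoint_energy h6 ⟨h5.1.le, h5.2.le⟩ (φ t')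
      rw [h4]
      exact (congrArg (fun z => z.1.1) h7).symm
    have h4 : HasDerivAt (fun t => amp (V t)) _ t := (hasDerivAt_amp hVpos).comp t h1
    have h5 := ((h.smooth_S.differentiable (by simp) ((amp (V t), φ t), eps q t)).hasFDerivAt
      ).comp_hasDerivAt (f := fun t => ((amp (V t), φ t), eps q t)) t
      ((h4.prodMk h2).prodMk (hasDerivAt_eps h.q_pos hl.pos))
    have h6 := h5.congr_of_eventuallyEq h3
    -- The value of the derivative is irrelevant for now. Differentiating `V = (s²/2) W` gives a
    -- linear equation for `u` whose coefficient is `s` times a number at least `1 - σ > 0`, and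
    -- this determines `u`.
    generalize fderiv ℝ S ((amp (V t), φ t), eps q t) _ = u at h6
    have h7 := ((hasDerivAt_transformed h.q_pos h.smooth_W hl.pos h6 h2 z
      rfl).congr_of_eventuallyEq hVs).unique h1
    have h8 := (abs_le.1 (hl.close _ (amp_mem_Icc hEI) (φ t)).2).1
    have h9 : amp (E t) * (W z + amp (E t) / 2 * fderiv ℝ W z ((1, 0), 0)) ≠ 0 :=
      mul_ne_zero hspos.ne' (by simp only [z]; linarith)
    have h10 : u = amp (E t) * a (amp (E t), φ t) t := by
      apply mul_left_cancel₀ h9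
      simp only [energyRate, z] at h7 ⊢
      linear_combination h7
    rwa [h10] at h6

end Equivalence

/-! ### The coefficients in terms of the energy -/

section Coefficients

theorem isCoefficients {E₀ : ℝ} {b : ℕ → ℝ × ℝ → ℝ} {l : ℕ → ℝ → ℝ} (hb : ∀ k, ContDiff ℝ ∞ (b k))
    (hbp : ∀ k, Function.Periodic (b k) (0, 2 * Real.pi)) (hl : ∀ k, ContDiff ℝ ∞ (l k)) :
    IsCoefficients E₀ (fun k E φ => E * b k (amp E, φ)) (fun k E => E * l k (amp E)) where
  v_smooth k _ z hz := (contDiffAt_fst.mul ((hb k).contDiffAt.comp z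
    (((contDiffAt_amp hz.1.1).comp z contDiffAt_fst).prodMk contDiffAt_snd))).contDiffWithinAt
  v_periodic k _ E _ φ := by
    have := hbp k (amp E, φ)
    rw [Prod.mk_add_mk, add_zero] at this
    rw [this]
  v_zero k _ φ := zero_mul _
  Λ_smooth k _ E hE :=
    (contDiffAt_id.mul ((hl k).contDiffAt.comp E (contDiffAt_amp hE.1))).contDiffWithinAt
  Λ_zero k _ := zero_mul _
  Λ_near_zero k _ := by
    have h4 : (fun E => l k (amp E)) =O[𝓝[>] 0] (fun _ => (1 : ℝ)) :=
      (((hl k).continuous.comp continuous_amp).continuousAt.tendsto.mono_left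
        nhdsWithin_le_nhds).isBigO_one ℝ
    have h5 := (isBigO_refl (fun E : ℝ => E) (𝓝[>] 0)).mul h4
    simpa only [mul_one] using h5

theorem VN_eq (q N : ℕ) (b : ℕ → ℝ × ℝ → ℝ) (E φ : ℝ) {t : ℝ} (ht : 0 < t) :
    VN q N (fun k E φ => E * b k (amp E, φ)) E φ t =
      E * (1 + psum b N ((amp E, φ), eps q t)) := by
  simp only [VN, psum, rpow_eq_eps_pow q _ ht, mul_add, mul_one, Finset.mul_sum]
  congr 1
  exact Finset.sum_congr rfl fun k _ => by ring

theorem sum_averaged_eq (q N : ℕ) (l : ℕ → ℝ → ℝ) (w : ℝ) {t : ℝ} (ht : 0 < t) :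
    ∑ k ∈ Finset.Icc 1 N, t ^ (-(k : ℝ) / (q : ℝ)) * (w * l k (amp w)) =
      w * psum l N (amp w, eps q t) := by
  simp only [psum, rpow_eq_eps_pow q _ ht, Finset.mul_sum]
  exact Finset.sum_congr rfl fun k _ => by ring

end Coefficients
end AsympHam

end

/-! ### Assembly of the theorem -/

open AsympHam in
theorem mainTheorem12 (q : ℕ) (E₀ : ℝ) (U : Set (ℝ × ℝ)) (H F : ℝ × ℝ → ℝ → ℝ)
    (H₀ : ℝ × ℝ → ℝ) (Hk Fk : ℕ → ℝ × ℝ → ℝ) (hsys : IsSystem q E₀ U H F H₀ Hk Fk) :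
    ∃ (freq : ℝ → ℝ) (X Y : ℝ → ℝ → ℝ) (v : ℕ → ℝ → ℝ → ℝ) (Λ : ℕ → ℝ → ℝ),
      IsActionAngle E₀ U H₀ freq X Y ∧
      IsCoefficients E₀ v Λ ∧
      ∀ N : ℕ, ∃ (R G : ℝ → ℝ → ℝ → ℝ) (g : ℕ → ℝ → ℝ → ℝ),
        ∀ σ ∈ Set.Ioo (0 : ℝ) 1, ∃ t₀ : ℝ, 0 < t₀ ∧
          IsReversible q N E₀ σ t₀ v ∧
          IsRemainder q N ((1 - σ) * E₀) t₀ R ∧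
          IsAngularPerturbation q ((1 - σ) * E₀) t₀ G g ∧
          ∀ (I : Set ℝ) (x y E φ : ℝ → ℝ), IsOpen I → I ⊆ Set.Ioi t₀ →
            ContinuousOn E I → ContinuousOn φ I →
            (∀ t ∈ I, E t ∈ Set.Ioo 0 E₀ ∧ VN q N v (E t) (φ t) t ≤ (1 - σ) * E₀ ∧
              x t = X (φ t) (E t) ∧ y t = Y (φ t) (E t)) →
            (IsSolutionOn H F I x y ↔
              IsReducedSolutionOn q N Λ R freq G I (fun t => VN q N v (E t) (φ t) t) φ) := by
  have hc := hsys.isCenter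
  have hq := hsys.q_pos
  obtain ⟨Ω, x, h⟩ := hc.exists_angleMap
  obtain ⟨f₁, f₂, c₁, c₂, hf₁, hf₂, hfield⟩ := hsys.exists_pert
  obtain ⟨a, g, α, γ, ha, hg, hag⟩ := h.exists_reduced_field hc hq hf₁ hf₂
  obtain ⟨ρ, hρ, hρs⟩ := exists_smooth_sqrt
  obtain ⟨b, l, hb, hbp, hl, hI⟩ := exists_averaging hq h.freq_smooth
    (fun s => (h.freq_pos s).ne') hρ (by rw [hρs 1 (by norm_num), Real.sqrt_one])
    ha.coeff_smooth hg.coeff_smooth (fun k hk => (ha.coeff_periodic k hk).periodic)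
    (fun k hk => (hg.coeff_periodic k hk).periodic)
  refine ⟨fun E => Ω (amp E), fun φ E => (x (amp E, φ)).1, fun φ E => (x (amp E, φ)).2,
    fun k E φ => E * b k (amp E, φ), fun k E => E * l k (amp E),
    h.isActionAngle hc.differentiable, isCoefficients hb hbp hl, fun N => ?_⟩
  have hIN := hI N
  obtain ⟨Q, hQ, hQp, hQe⟩ := hIN.defect
  obtain ⟨S, δ, hδ, hS, hSp, hS0, hS0', hSinv⟩ := exists_amplitude_inverse hρ hρs hIN.smooth_W
    hIN.periodic hIN.W_zero (amp_pos hsys.E₀_pos)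
  have hR : IsReduction q N E₀ Ω a g α γ (fun z => 1 + psum b N z) (psum l N) Q S δ :=
    ⟨hq, hsys.E₀_pos, h.freq_smooth, ha, hg, hIN.smooth_W, hIN.periodic, hIN.W_zero, hIN.smooth_L,
      hQ, hQp, fun z hz => by rw [← hQe z, ← hρs _ hz]; rfl, hδ, hS, hSp, hS0, hS0', hSinv⟩
  refine ⟨averagedRem q Ω a g (fun z => 1 + psum b N z) (psum l N) S, angularPert q Ω g S,
    fun k w φ => reexpandCoeff (angularTerm Ω γ S) k (amp w, φ), fun σ hσ => ?_⟩
  obtain ⟨C₁, hC₁⟩ := ha.expansion N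
  obtain ⟨C₂, hC₂⟩ := hg.expansion N
  -- The functions are already fixed; `σ` only determines how late `t₀` is. The same `t₀` makes the
  -- order-`N` estimates for `a` and `g` valid.
  obtain ⟨t₀, ht₀⟩ := eventually_atTop.1 ((hR.eventually_late hσ.1).and (hC₁.and hC₂))
  have hlate := fun t ht => (ht₀ t ht).1
  refine ⟨t₀, (hlate t₀ le_rfl).pos, hR.isReversible hlate fun E φ t ht => VN_eq q N b E φ ht,
    hR.isRemainder hlate (fun t ht => (ht₀ t ht).2.1) (fun t ht => (ht₀ t ht).2.2),
    hR.isAngularPerturbation hσ hlate, fun I X Y E φ hIo hIt hE hφ hxy => ?_⟩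
  -- The two systems are compared at each time separately; openness of `I` makes the change of
  -- variables available near that time.
  refine forall₂_congr fun t ht => ?_
  have hIn : I ∈ 𝓝 t := hIo.mem_nhds ht
  have htt := hIt ht
  have hEt := hE.continuousAt hIn
  have hφt := hφ.continuousAt hIn
  have hs : amp (E t) ∈ Set.Ioc 0 (amp E₀) := amp_mem_Ioc ⟨(hxy t ht).1.1, (hxy t ht).1.2.le⟩
  have hpos : 0 < t := (hlate t (le_of_lt htt)).pos
  have h1 := hR.hasDerivAt_iff (φ := φ)
    (V := fun t => VN q N (fun k E φ => E * b k (amp E, φ)) (E t) (φ t) t)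
    (hlate t (le_of_lt htt)) (by
      filter_upwards [hIn] with t' ht'
      exact hlate t' (le_of_lt (hIt ht'))) hσ.2 hEt (hxy t ht).1 (by
      filter_upwards [lt_mem_nhds hpos] with t' ht'
      exact VN_eq q N b _ _ ht')
  have h2 := h.hasDerivAt_iff (s := fun t => amp (E t)) hc.differentiable
    (continuous_amp.continuousAt.comp hEt) hφt hs (amp (E t) * a (amp (E t), φ t) t)
    (Ω (amp (E t)) + g (amp (E t), φ t) t)
  have h3 : (X t, Y t) = x (amp (E t), φ t) := by rw [(hxy t ht).2.2.1, (hxy t ht).2.2.2]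
  have h4 : (fun t => (X t, Y t)) =ᶠ[𝓝 t] fun t => x (amp (E t), φ t) := by
    filter_upwards [hIn] with t' ht'
    rw [(hxy t' ht').2.2.1, (hxy t' ht').2.2.2]
  have h5 := hfield t hpos (X t, Y t)
  have h6 := hag _ hs (φ t) t
  rw [← h3] at h6
  rw [h6] at h5
  simp only [sum_averaged_eq q N l _ hpos]
  -- The chain runs from the reduced system to the amplitude-angle system to the curve `x (s, φ)`;
  -- what is left is to pass between a derivative in the plane and those of its components.
  rw [← h1, ← h2, ← h5]
  refine Iff.trans ⟨fun h7 => ?_, fun h7 => ?_⟩ h4.hasDerivAt_iff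
  · exact h7.1.prodMk h7.2
  · exact ⟨hasDerivAt_fst_comp h7, hasDerivAt_snd_comp h7⟩
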